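/- Let $\Sigma_g$ be a closed connected oriented surface of genus $g\ge 2$ with an area form $\omega$, let $D\subset\Sigma_g$ be a smoothly embedded closed disk, and let $j\colon\Sigma_g^0=\Sigma_g\setminus D\to\Sigma_g$ be the inclusion. Let $\mathrm{Symp}^c\Sigma_g^0$ be the group of compactly supported diffeomorphisms of $\Sigma_g^0$ preserving $j^*\omega$, regarded as a subgroup of $\mathrm{Symp}\,\Sigma_g$ by extending diffeomorphisms by the identity, and let $\mathrm{Symp}^c_0\Sigma_g^0$ be its identity component. These groups act on first cohomology by $\varphi\cdot u=(\varphi^{-1})^*u$. Let $\mathrm{Flux}\colon \mathrm{Symp}_0\Sigma_g\to H^1(\Sigma_g;\mathbb R)$ be the flux homomorphism: $\mathrm{Flux}(\varphi)=\left[\int_0^1\iota_{X_t}\omega\,dt\right]$ for any symplectic isotopy $\varphi_t$ from the identity to $\varphi$, where $\frac{d}{dt}\varphi_t=X_t\circ\varphi_t$. Extension by zero induces an isomorphism $H^1_c(\Sigma_g^0;\mathbb R)\cong H^1(\Sigma_g;\mathbb R)$ that is equivariant under $\mathrm{Symp}^c\Sigma_g^0$. For every $1$-form $\lambda$ on $\Sigma_g^0$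 with $d\lambda=-j^*\omega$, the map $$\widetilde{\mathrm{Flux}}_c\colon \mathrm{Symp}^c\Sigma_g^0\to H^1_c(\Sigma_g^0;\mathbb R)\cong H^1(\Sigma_g;\mathbb R),\qquad \widetilde{\mathrm{Flux}}_c(\varphi)=[(\varphi^{-1})^*\lambda-\lambda],$$ is a crossed homomorphism, that is, $$\widetilde{\mathrm{Flux}}_c(\varphi\psi)=\widetilde{\mathrm{Flux}}_c(\varphi)+(\varphi^{-1})^*\,\widetilde{\mathrm{Flux}}_c(\psi),$$ and it extends the restricted flux: $\widetilde{\mathrm{Flux}}_c(\varphi)=\mathrm{Flux}(\varphi)$ for all $\varphi\in\mathrm{Symp}^c_0\Sigma_g^0$. Its class $[\widetilde{\mathrm{Flux}}_c]$ in the group cohomology $H^1(\mathrm{Symp}^c\Sigma_g^0;H^1(\Sigma_g;\mathbb R))$ does not depend on the choice of $\lambda$ with $d\lambda=-j^*\omega$. -/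

import Mathlib

set_option linter.unusedSectionVars false

open scoped Manifold ContDiff Topology

namespace SurfaceFlux

section Forms

variable {E : Type*} [NormedAddCommGroup E] [NormedSpace ℝ E]
  {M : Type*} [TopologicalSpace M] [ChartedSpace E M]
  {N : Type*} [TopologicalSpace N] [ChartedSpace E N]
  {P : Type*} [TopologicalSpace P] [ChartedSpace E P]

variable (E M) in
/-- Not necessarily continuous differential `k`-forms on a manifold `M` modelled on `E`: a value at
`x` is an alternating form on the tangent space `TangentSpace 𝓘(ℝ, E) x`, which in Mathlib is `E`
by definition (through the preferred chart at `x`). -/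
abbrev Form (k : ℕ) : Type _ := M → E [⋀^Fin k]→L[ℝ] ℝ

/-- The differential of `f` at `x`, as a linear map between tangent spaces. -/
noncomputable def tangentMapAt (f : M → N) (x : M) : E →L[ℝ] E :=
  mfderiv 𝓘(ℝ, E) 𝓘(ℝ, E) f x

/-- Pullback of differential forms. -/
noncomputable def pull {k : ℕ} (f : M → N) (α : Form E N k) : Form E M k :=
  fun x => (α (f x)).compContinuousLinearMap (tangentMapAt f x)

/-- The form `α` written in the preferred chart around `x`: its pullback under the inverse chart. -/
noncomputable def localRep {k : ℕ} (α : Form E M k) (x : M) : Form E E k :=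
  pull (extChartAt 𝓘(ℝ, E) x).symm α

/-- `α` is smooth at `x`: its coefficients in the chart around `x` are smooth at the point. -/
def SmoothAt {k : ℕ} (α : Form E M k) (x : M) : Prop :=
  ContDiffAt ℝ ∞ (localRep α x) (extChartAt 𝓘(ℝ, E) x x)

/-- Exterior derivative: write the form in the chart around `x`, apply the exterior
derivative of the vector space `E`, and transport back. -/
noncomputable def extD {k : ℕ} (α : Form E M k) : Form E M (k + 1) :=
  fun x => (extDeriv (localRep α x) (extChartAt 𝓘(ℝ, E) x x)).compContinuousLinearMap
    (tangentMapAt (extChartAt 𝓘(ℝ, E) x) x)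

theorem contDiff_altComp [FiniteDimensional ℝ E] {k : ℕ} :
    ContDiff ℝ ∞ (fun p : (E [⋀^Fin k]→L[ℝ] ℝ) × (E →L[ℝ] E) =>
      p.1.compContinuousLinearMap p.2) := by
  have hfin : FiniteDimensional ℝ (ContinuousMultilinearMap ℝ (fun _ : Fin k => E) ℝ) :=
    Module.Finite.of_injective
      (ContinuousMultilinearMap.toMultilinearMapLinear (R' := ℝ) (A := ℝ)
        (M₁ := fun _ : Fin k => E) (M₂ := ℝ))
      ContinuousMultilinearMap.toMultilinearMap_injective
  let T := ContinuousAlternatingMap.toContinuousMultilinearMapCLM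
    (E := E) (F := ℝ) (ι := Fin k) (𝕜 := ℝ) ℝ
  have hT : Function.Injective T :=
    ContinuousAlternatingMap.toContinuousMultilinearMap_injective
  obtain ⟨L, hL⟩ := T.toLinearMap.exists_leftInverse_of_injective (LinearMap.ker_eq_bot.2 hT)
  have key : (fun p : (E [⋀^Fin k]→L[ℝ] ℝ) × (E →L[ℝ] E) => p.1.compContinuousLinearMap p.2) =
      fun p => L.toContinuousLinearMap
        (ContinuousMultilinearMap.compContinuousLinearMapContinuousMultilinear ℝ
          (fun _ : Fin k => E) (fun _ : Fin k => E) ℝ (fun _ => p.2) (T p.1)) := by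
    funext p
    have := LinearMap.congr_fun hL (p.1.compContinuousLinearMap p.2)
    exact this.symm
  rw [key]
  refine L.toContinuousLinearMap.contDiff.comp (ContDiff.clm_apply ?_ (T.contDiff.comp contDiff_fst))
  exact (ContinuousMultilinearMap.contDiff _).comp (contDiff_pi.2 fun _ => contDiff_snd)

theorem altComp_comp {k : ℕ} (α : E [⋀^Fin k]→L[ℝ] ℝ) (f g : E →L[ℝ] E) :
    (α.compContinuousLinearMap f).compContinuousLinearMap g =
      α.compContinuousLinearMap (f.comp g) := rfl

theorem tangentMapAt_comp {g : N → P} {f : M → N} {x : M}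
    (hg : MDifferentiableAt 𝓘(ℝ, E) 𝓘(ℝ, E) g (f x))
    (hf : MDifferentiableAt 𝓘(ℝ, E) 𝓘(ℝ, E) f x) :
    tangentMapAt (E := E) (g ∘ f) x = (tangentMapAt g (f x)).comp (tangentMapAt f x) :=
  mfderiv_comp x hg hf

theorem tangentMapAt_id (x : M) : tangentMapAt (E := E) (id : M → M) x = .id ℝ E :=
  mfderiv_id

theorem tangentMapAt_congr {f g : M → N} {x : M} (h : f =ᶠ[𝓝 x] g) :
    tangentMapAt (E := E) f x = tangentMapAt g x :=
  h.mfderiv_eq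

theorem pull_id {k : ℕ} (α : Form E M k) : pull id α = α := by
  funext x
  ext v
  simp [pull, tangentMapAt_id]

theorem pull_comp_apply {k : ℕ} {g : N → P} {f : M → N} {x : M} (α : Form E P k)
    (hg : MDifferentiableAt 𝓘(ℝ, E) 𝓘(ℝ, E) g (f x))
    (hf : MDifferentiableAt 𝓘(ℝ, E) 𝓘(ℝ, E) f x) :
    pull (g ∘ f) α x = pull f (pull g α) x := by
  simp only [pull, tangentMapAt_comp hg hf]
  rfl

theorem pull_congr {k : ℕ} {f g : M → N} {x : M} (h : f =ᶠ[𝓝 x] g) (α : Form E N k) :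
    pull f α x = pull g α x := by
  simp [pull, h.eq_of_nhds, tangentMapAt_congr h]

theorem pull_add {k : ℕ} (f : M → N) (α β : Form E N k) : pull f (α + β) = pull f α + pull f β := by
  funext x; ext v; simp [pull]

theorem pull_smul {k : ℕ} (f : M → N) (c : ℝ) (α : Form E N k) :
    pull f (c • α) = c • pull f α := by
  funext x; ext v; simp [pull]

theorem localRep_add {k : ℕ} (α β : Form E M k) (x : M) :
    localRep (α + β) x = localRep α x + localRep β x := pull_add _ _ _

theorem localRep_smul {k : ℕ} (c : ℝ) (α : Form E M k) (x : M) :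
    localRep (c • α) x = c • localRep α x := pull_smul _ _ _

theorem SmoothAt.add {k : ℕ} {α β : Form E M k} {x : M} (hα : SmoothAt α x) (hβ : SmoothAt β x) :
    SmoothAt (α + β) x := by
  unfold SmoothAt
  rw [localRep_add]
  exact ContDiffAt.add hα hβ

theorem SmoothAt.smul {k : ℕ} {α : Form E M k} {x : M} (c : ℝ) (hα : SmoothAt α x) :
    SmoothAt (c • α) x := by
  unfold SmoothAt
  rw [localRep_smul]
  exact ContDiffAt.const_smul c hα

theorem smoothAt_zero {k : ℕ} (x : M) : SmoothAt (0 : Form E M k) x := by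
  have : localRep (0 : Form E M k) x = 0 := by
    funext y; ext v; simp [localRep, pull]
  unfold SmoothAt
  rw [this]
  exact contDiffAt_const

theorem SmoothAt.differentiableAt {k : ℕ} {α : Form E M k} {x : M} (hα : SmoothAt α x) :
    DifferentiableAt ℝ (localRep α x) (extChartAt 𝓘(ℝ, E) x x) :=
  ContDiffAt.differentiableAt hα (by simp)

theorem extD_add_apply {k : ℕ} {α β : Form E M k} {x : M} (hα : SmoothAt α x)
    (hβ : SmoothAt β x) : extD (α + β) x = extD α x + extD β x := by
  unfold extD
  rw [localRep_add, extDeriv_add hα.differentiableAt hβ.differentiableAt]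
  ext v; simp

theorem extD_smul_apply {k : ℕ} (c : ℝ) (α : Form E M k) (x : M) :
    extD (c • α) x = c • extD α x := by
  unfold extD
  rw [localRep_smul, extDeriv_smul]
  ext v; simp

theorem localRep_congr {k : ℕ} {α β : Form E M k} {x : M} (h : α =ᶠ[𝓝 x] β) :
    localRep α x =ᶠ[𝓝 (extChartAt 𝓘(ℝ, E) x x)] localRep β x := by
  have hc : Filter.Tendsto (extChartAt 𝓘(ℝ, E) x).symm (𝓝 (extChartAt 𝓘(ℝ, E) x x)) (𝓝 x) := by
    have := continuousAt_extChartAt_symm (I := 𝓘(ℝ, E)) x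
    simpa [ContinuousAt] using this
  filter_upwards [hc.eventually h] with y hy
  simp only [localRep, pull]
  rw [hy]

theorem SmoothAt.congr {k : ℕ} {α β : Form E M k} {x : M} (hα : SmoothAt α x)
    (h : β =ᶠ[𝓝 x] α) : SmoothAt β x :=
  ContDiffAt.congr_of_eventuallyEq hα (localRep_congr h)

theorem extD_congr {k : ℕ} {α β : Form E M k} {x : M} (h : α =ᶠ[𝓝 x] β) :
    extD α x = extD β x := by
  unfold extD
  rw [(localRep_congr h).extDeriv_eq]

theorem chart_target_nhds (x : M) {p : M} (hp : p ∈ (extChartAt 𝓘(ℝ, E) x).source) :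
    (extChartAt 𝓘(ℝ, E) x).target ∈ 𝓝 (extChartAt 𝓘(ℝ, E) x p) :=
  (isOpen_extChartAt_target x).mem_nhds ((extChartAt 𝓘(ℝ, E) x).map_source hp)

theorem tendsto_chart_symm (x : M) {p : M} (hp : p ∈ (extChartAt 𝓘(ℝ, E) x).source) :
    Filter.Tendsto (extChartAt 𝓘(ℝ, E) x).symm (𝓝 (extChartAt 𝓘(ℝ, E) x p)) (𝓝 p) := by
  have := continuousAt_extChartAt_symm' (I := 𝓘(ℝ, E)) hp
  rwa [ContinuousAt, (extChartAt 𝓘(ℝ, E) x).left_inv hp] at this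

variable [IsManifold 𝓘(ℝ, E) ∞ M] [IsManifold 𝓘(ℝ, E) ∞ N]

theorem symm_comp_chart (x : M) {y : E} (hy : y ∈ (extChartAt 𝓘(ℝ, E) x).target) :
    (tangentMapAt (E := E) (extChartAt 𝓘(ℝ, E) x).symm y).comp
      (tangentMapAt (extChartAt 𝓘(ℝ, E) x) ((extChartAt 𝓘(ℝ, E) x).symm y)) = .id ℝ E := by
  have : IsManifold 𝓘(ℝ, E) 1 M := .of_le (n := ∞) (by simp)
  have := mfderivWithin_extChartAt_symm_comp_mfderiv_extChartAt (I := 𝓘(ℝ, E)) (x := x) hy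
  rw [modelWithCornersSelf_coe, Set.range_id, mfderivWithin_univ] at this
  exact this

theorem chart_comp_symm (x : M) {y : E} (hy : y ∈ (extChartAt 𝓘(ℝ, E) x).target) :
    (tangentMapAt (E := E) (extChartAt 𝓘(ℝ, E) x) ((extChartAt 𝓘(ℝ, E) x).symm y)).comp
      (tangentMapAt (extChartAt 𝓘(ℝ, E) x).symm y) = .id ℝ E := by
  have : IsManifold 𝓘(ℝ, E) 1 M := .of_le (n := ∞) (by simp)
  have := mfderiv_extChartAt_comp_mfderivWithin_extChartAt_symm (I := 𝓘(ℝ, E)) (x := x) hy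
  rw [modelWithCornersSelf_coe, Set.range_id, mfderivWithin_univ] at this
  exact this

theorem mdiff_symm (x : M) {y : E} (hy : y ∈ (extChartAt 𝓘(ℝ, E) x).target) :
    MDifferentiableAt 𝓘(ℝ, E) 𝓘(ℝ, E) (extChartAt 𝓘(ℝ, E) x).symm y := by
  have : IsManifold 𝓘(ℝ, E) 1 M := .of_le (n := ∞) (by simp)
  have := mdifferentiableWithinAt_extChartAt_symm (I := 𝓘(ℝ, E)) (x := x) hy
  simpa [mdifferentiableWithinAt_univ] using this

theorem mdiff_chart (x : M) {p : M} (hp : p ∈ (extChartAt 𝓘(ℝ, E) x).source) :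
    MDifferentiableAt 𝓘(ℝ, E) 𝓘(ℝ, E) (extChartAt 𝓘(ℝ, E) x) p := by
  have : IsManifold 𝓘(ℝ, E) 1 M := .of_le (n := ∞) (by simp)
  exact mdifferentiableAt_extChartAt (by simpa using hp)

/-- The pullback in coordinates. -/
theorem localRep_pull {k : ℕ} {f : M → N} (α : Form E N k) (x : M) (z : N) {y : E}
    (hy : y ∈ (extChartAt 𝓘(ℝ, E) x).target)
    (hf : MDifferentiableAt 𝓘(ℝ, E) 𝓘(ℝ, E) f ((extChartAt 𝓘(ℝ, E) x).symm y))
    (hz : f ((extChartAt 𝓘(ℝ, E) x).symm y) ∈ (extChartAt 𝓘(ℝ, E) z).source) :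
    localRep (pull f α) x y = pull (extChartAt 𝓘(ℝ, E) z ∘ f ∘ (extChartAt 𝓘(ℝ, E) x).symm)
      (localRep α z) y := by
  have h1 : MDifferentiableAt 𝓘(ℝ, E) 𝓘(ℝ, E) (f ∘ (extChartAt 𝓘(ℝ, E) x).symm) y :=
    MDifferentiableAt.comp y hf (mdiff_symm x hy)
  have h2 : tangentMapAt (E := E) (extChartAt 𝓘(ℝ, E) z ∘ f ∘ (extChartAt 𝓘(ℝ, E) x).symm) y =
      (tangentMapAt (extChartAt 𝓘(ℝ, E) z) (f ((extChartAt 𝓘(ℝ, E) x).symm y))).comp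
        ((tangentMapAt f ((extChartAt 𝓘(ℝ, E) x).symm y)).comp
          (tangentMapAt (extChartAt 𝓘(ℝ, E) x).symm y)) := by
    rw [← tangentMapAt_comp (g := f) hf (mdiff_symm x hy)]
    exact tangentMapAt_comp (f := f ∘ (extChartAt 𝓘(ℝ, E) x).symm) (mdiff_chart z hz) h1
  have h3 := symm_comp_chart (E := E) z ((extChartAt 𝓘(ℝ, E) z).map_source hz)
  rw [(extChartAt 𝓘(ℝ, E) z).left_inv hz] at h3
  simp only [localRep, pull, h2, Function.comp_apply, (extChartAt 𝓘(ℝ, E) z).left_inv hz,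
    altComp_comp]
  rw [← ContinuousLinearMap.comp_assoc, h3, ContinuousLinearMap.id_comp]

/-- The pullback in coordinates, near a point `p` of the chart around `x`. -/
theorem localRep_pull_eventually {k : ℕ} {f : M → N} (α : Form E N k) (x : M) {p : M} (z : N)
    (hp : p ∈ (extChartAt 𝓘(ℝ, E) x).source)
    (hf : ContMDiffAt 𝓘(ℝ, E) 𝓘(ℝ, E) ∞ f p) (hz : f p ∈ (extChartAt 𝓘(ℝ, E) z).source) :
    localRep (pull f α) x =ᶠ[𝓝 (extChartAt 𝓘(ℝ, E) x p)]
      pull (extChartAt 𝓘(ℝ, E) z ∘ f ∘ (extChartAt 𝓘(ℝ, E) x).symm) (localRep α z) := by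
  have : IsManifold 𝓘(ℝ, E) 1 M := .of_le (n := ∞) (by simp)
  have : IsManifold 𝓘(ℝ, E) 1 N := .of_le (n := ∞) (by simp)
  have hs : ∀ᶠ q in 𝓝 p, f q ∈ (extChartAt 𝓘(ℝ, E) z).source :=
    hf.continuousAt.eventually ((isOpen_extChartAt_source z).mem_nhds hz)
  have hd : ∀ᶠ q in 𝓝 p, MDifferentiableAt 𝓘(ℝ, E) 𝓘(ℝ, E) f q := by
    have := (contMDiffAt_iff_contMDiffAt_nhds (by simp)).1
      (hf.of_le (show (1 : ℕ∞ω) ≤ ∞ by simp))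
    filter_upwards [this] with q hq
    exact hq.mdifferentiableAt (by simp)
  have ht := tendsto_chart_symm x hp
  filter_upwards [ht.eventually hs, ht.eventually hd, chart_target_nhds x hp] with y h1 h2 h3
  exact localRep_pull α x z h3 h2 h1

theorem contDiffAt_coord {f : M → N} (x : M) {p : M} (z : N)
    (hp : p ∈ (extChartAt 𝓘(ℝ, E) x).source)
    (hf : ContMDiffAt 𝓘(ℝ, E) 𝓘(ℝ, E) ∞ f p) (hz : f p ∈ (extChartAt 𝓘(ℝ, E) z).source) :
    ContDiffAt ℝ ∞ (extChartAt 𝓘(ℝ, E) z ∘ f ∘ (extChartAt 𝓘(ℝ, E) x).symm)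
      (extChartAt 𝓘(ℝ, E) x p) := by
  have h := (contMDiffAt_iff_of_mem_source (I := 𝓘(ℝ, E)) (I' := 𝓘(ℝ, E)) (n := ∞) (f := f)
    (x := x) (y := z) (x' := p) (by simpa using hp) (by simpa using hz)).1 hf
  simpa [contDiffWithinAt_univ] using h.2

theorem contDiffAt_pull_coord [FiniteDimensional ℝ E] {k : ℕ} {F : E → E} {α : Form E E k} {y : E}
    (hF : ContDiffAt ℝ ∞ F y) (hα : ContDiffAt ℝ ∞ α (F y)) : ContDiffAt ℝ ∞ (pull F α) y := by
  have h : pull F α = fun y => (fun p : (E [⋀^Fin k]→L[ℝ] ℝ) × (E →L[ℝ] E) =>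
      p.1.compContinuousLinearMap p.2) (α (F y), fderiv ℝ F y) := by
    funext y; simp [pull, tangentMapAt, mfderiv_eq_fderiv]
  rw [h]
  exact contDiff_altComp.contDiffAt.comp y
    ((hα.comp y hF).prodMk (hF.fderiv_right (m := ∞) (by simp)))

theorem extDeriv_pull_coord {k : ℕ} {F : E → E} {α : Form E E k} {y : E}
    (hF : ContDiffAt ℝ ∞ F y) (hα : ContDiffAt ℝ ∞ α (F y)) :
    extDeriv (pull F α) y = pull F (extDeriv α) y := by
  have := extDeriv_pullback (r := ∞) (hα.differentiableAt (by simp)) hF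
    (by rw [minSmoothness_of_isRCLikeNormedField]; exact WithTop.coe_le_coe.2 le_top)
  have h : pull F α = fun y => (α (F y)).compContinuousLinearMap (fderiv ℝ F y) := by
    funext y; simp [pull, tangentMapAt, mfderiv_eq_fderiv]
  rw [h, this]
  simp [pull, tangentMapAt, mfderiv_eq_fderiv]

theorem SmoothAt.contDiffAt_localRep [FiniteDimensional ℝ E] {k : ℕ} {α : Form E M k} (x : M)
    {p : M} (hα : SmoothAt α p) (hp : p ∈ (extChartAt 𝓘(ℝ, E) x).source) :
    ContDiffAt ℝ ∞ (localRep α x) (extChartAt 𝓘(ℝ, E) x p) := by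
  have h := localRep_pull_eventually (f := id) α x p hp contMDiffAt_id (mem_extChartAt_source p)
  rw [pull_id] at h
  refine ContDiffAt.congr_of_eventuallyEq ?_ h
  refine contDiffAt_pull_coord (contDiffAt_coord x p hp contMDiffAt_id (mem_extChartAt_source p)) ?_
  simp only [Function.comp_apply, (extChartAt 𝓘(ℝ, E) x).left_inv hp, id]
  exact hα

theorem SmoothAt.pull [FiniteDimensional ℝ E] {k : ℕ} {α : Form E N k} {f : M → N} {x : M}
    (hα : SmoothAt α (f x)) (hf : ContMDiffAt 𝓘(ℝ, E) 𝓘(ℝ, E) ∞ f x) :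
    SmoothAt (pull f α) x := by
  have hx := mem_extChartAt_source (I := 𝓘(ℝ, E)) x
  have hz := mem_extChartAt_source (I := 𝓘(ℝ, E)) (f x)
  refine ContDiffAt.congr_of_eventuallyEq ?_ (localRep_pull_eventually α x (f x) hx hf hz)
  refine contDiffAt_pull_coord (contDiffAt_coord x (f x) hx hf hz) ?_
  simp only [Function.comp_apply, (extChartAt 𝓘(ℝ, E) x).left_inv hx]
  exact hα

/-- The exterior derivative commutes with pullback. -/
theorem extD_pull [FiniteDimensional ℝ E] {k : ℕ} {α : Form E N k} {f : M → N} {x : M}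
    (hα : SmoothAt α (f x)) (hf : ContMDiffAt 𝓘(ℝ, E) 𝓘(ℝ, E) ∞ f x) :
    extD (SurfaceFlux.pull f α) x = SurfaceFlux.pull f (extD α) x := by
  have hx := mem_extChartAt_source (I := 𝓘(ℝ, E)) x
  have hz := mem_extChartAt_source (I := 𝓘(ℝ, E)) (f x)
  have hfd : MDifferentiableAt 𝓘(ℝ, E) 𝓘(ℝ, E) f x := hf.mdifferentiableAt (by simp)
  have hα' : ContDiffAt ℝ ∞ (localRep α (f x))
      ((extChartAt 𝓘(ℝ, E) (f x) ∘ f ∘ (extChartAt 𝓘(ℝ, E) x).symm)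
        (extChartAt 𝓘(ℝ, E) x x)) := by
    simp only [Function.comp_apply, (extChartAt 𝓘(ℝ, E) x).left_inv hx]
    exact hα
  have hchain : (tangentMapAt (E := E) (extChartAt 𝓘(ℝ, E) (f x) ∘ f ∘
      (extChartAt 𝓘(ℝ, E) x).symm) (extChartAt 𝓘(ℝ, E) x x)).comp
      (tangentMapAt (extChartAt 𝓘(ℝ, E) x) x) =
      (tangentMapAt (extChartAt 𝓘(ℝ, E) (f x)) (f x)).comp (tangentMapAt f x) := by
    have ht := (extChartAt 𝓘(ℝ, E) x).map_source hx
    rw [← tangentMapAt_comp (mdiff_chart _ hz) hfd]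
    have hd : MDifferentiableAt 𝓘(ℝ, E) 𝓘(ℝ, E) (extChartAt 𝓘(ℝ, E) (f x) ∘ f ∘
        (extChartAt 𝓘(ℝ, E) x).symm) (extChartAt 𝓘(ℝ, E) x x) :=
      ((contDiffAt_coord x (f x) hx hf hz).differentiableAt (by simp)).mdifferentiableAt
    rw [← tangentMapAt_comp hd (mdiff_chart _ hx)]
    apply tangentMapAt_congr
    filter_upwards [(isOpen_extChartAt_source (I := 𝓘(ℝ, E)) x).mem_nhds hx] with q hq
    simp only [Function.comp_apply, (extChartAt 𝓘(ℝ, E) x).left_inv hq]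
  unfold extD
  rw [(localRep_pull_eventually α x (f x) hx hf hz).extDeriv_eq,
    extDeriv_pull_coord (contDiffAt_coord x (f x) hx hf hz) hα']
  simp only [SurfaceFlux.pull, altComp_comp, hchain, Function.comp_apply,
    (extChartAt 𝓘(ℝ, E) x).left_inv hx]

/-- The exterior derivative of a smooth form is smooth. -/
theorem smoothAt_extD [FiniteDimensional ℝ E] {k : ℕ} {α : Form E M k} {x : M}
    (hα : ∀ p, SmoothAt α p) : SmoothAt (extD α) x := by
  have hx := mem_extChartAt_source (I := 𝓘(ℝ, E)) x
  have h1 : localRep (extD α) x =ᶠ[𝓝 (extChartAt 𝓘(ℝ, E) x x)] extDeriv (localRep α x) := by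
    filter_upwards [chart_target_nhds x hx] with y hy
    set p := (extChartAt 𝓘(ℝ, E) x).symm y with hpdef
    have hp : p ∈ (extChartAt 𝓘(ℝ, E) x).source := (extChartAt 𝓘(ℝ, E) x).map_target hy
    have hyp : extChartAt 𝓘(ℝ, E) x p = y := (extChartAt 𝓘(ℝ, E) x).right_inv hy
    have hpp := mem_extChartAt_source (I := 𝓘(ℝ, E)) p
    have h := localRep_pull_eventually (f := id) α x p hp contMDiffAt_id hpp
    rw [pull_id, hyp] at h
    have hc := contDiffAt_coord (E := E) x p hp contMDiffAt_id hpp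
    rw [hyp] at hc
    have hα' : ContDiffAt ℝ ∞ (localRep α p)
      ((extChartAt 𝓘(ℝ, E) p ∘ id ∘ (extChartAt 𝓘(ℝ, E) x).symm) y) := by
      exact hα p
    rw [h.extDeriv_eq, extDeriv_pull_coord hc hα']
    have hch : tangentMapAt (E := E) (extChartAt 𝓘(ℝ, E) p ∘ id ∘ (extChartAt 𝓘(ℝ, E) x).symm) y =
      (tangentMapAt (extChartAt 𝓘(ℝ, E) p) p).comp (tangentMapAt (extChartAt 𝓘(ℝ, E) x).symm y) :=
      tangentMapAt_comp (f := (extChartAt 𝓘(ℝ, E) x).symm) (mdiff_chart p hpp) (mdiff_symm x hy)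
    simp only [pull, hch, Function.comp_apply, id, ← hpdef]
    simp only [localRep, pull, extD, ← hpdef, altComp_comp]
  refine ContDiffAt.congr_of_eventuallyEq ?_ h1
  have h2 : ContDiffAt ℝ ∞ (localRep α x) (extChartAt 𝓘(ℝ, E) x x) := hα x
  have := h2.fderiv_right (m := ∞) (by simp)
  exact (ContinuousAlternatingMap.alternatizeUncurryFinCLM ℝ E ℝ).contDiff.contDiffAt.comp _ this

end Forms

section Cohomology

variable (E : Type*) [NormedAddCommGroup E] [NormedSpace ℝ E] [FiniteDimensional ℝ E]
  (M : Type*) [TopologicalSpace M] [ChartedSpace E M] [IsManifold 𝓘(ℝ, E) ∞ M]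

/-- Smooth differential `k`-forms. -/
def Omega (k : ℕ) : Submodule ℝ (Form E M k) where
  carrier := {α | ∀ x, SmoothAt α x}
  add_mem' hα hβ x := (hα x).add (hβ x)
  zero_mem' x := smoothAt_zero x
  smul_mem' c _ hα x := (hα x).smul c

/-- A shortcut for instance search. -/
noncomputable instance instAddCommGroupOmega (k : ℕ) : AddCommGroup (Omega E M k) :=
  Submodule.addCommGroup _

/-- The exterior derivative on smooth forms. -/
noncomputable def d (k : ℕ) : Omega E M k →ₗ[ℝ] Omega E M (k + 1) where
  toFun α := ⟨extD α.1, fun _ => smoothAt_extD α.2⟩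
  map_add' α β := Subtype.ext <| funext fun x => extD_add_apply (α.2 x) (β.2 x)
  map_smul' c α := Subtype.ext <| funext fun x => extD_smul_apply c α.1 x

/-- Smooth forms vanishing outside some compact set. -/
def OmegaC (k : ℕ) : Submodule ℝ (Omega E M k) where
  carrier := {α | ∃ K : Set M, IsCompact K ∧ ∀ x ∉ K, α.1 x = 0}
  add_mem' := by
    rintro α β ⟨K, hK, hα⟩ ⟨L, hL, hβ⟩
    refine ⟨K ∪ L, hK.union hL, fun x hx => ?_⟩
    have h : x ∉ K ∧ x ∉ L := by simpa using hx
    simp [hα x h.1, hβ x h.2]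
  zero_mem' := ⟨∅, isCompact_empty, fun _ _ => rfl⟩
  smul_mem' := by
    rintro c α ⟨K, hK, hα⟩
    exact ⟨K, hK, fun x hx => by simp [hα x hx]⟩

/-- Closed smooth `1`-forms. -/
noncomputable def Z1 : Submodule ℝ (Omega E M 1) := LinearMap.ker (d E M 1)

/-- Closed smooth `1`-forms with compact support. -/
noncomputable def Z1c : Submodule ℝ (Omega E M 1) := LinearMap.ker (d E M 1) ⊓ OmegaC E M 1

/-- The first de Rham cohomology `H¹(M; ℝ)`. -/
abbrev H1 : Type _ := Z1 E M ⧸ (LinearMap.range (d E M 0)).comap (Z1 E M).subtype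

/-- The first de Rham cohomology with compact supports `H¹_c(M; ℝ)`: closed `1`-forms with compact
support modulo differentials of functions with compact support. -/
abbrev H1c : Type _ := Z1c E M ⧸ ((OmegaC E M 0).map (d E M 0)).comap (Z1c E M).subtype

variable {E M}

theorem d_val {k : ℕ} (α : Omega E M k) : (d E M k α).1 = extD α.1 := rfl

/-- The class in `H¹` of a closed `1`-form. -/
noncomputable def H1.mk (α : Z1 E M) : H1 E M := Submodule.Quotient.mk α

/-- The class in `H¹_c` of a closed `1`-form with compact support. -/
noncomputable def H1c.mk (α : Z1c E M) : H1c E M := Submodule.Quotient.mk α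

variable {N : Type*} [TopologicalSpace N] [ChartedSpace E N] [IsManifold 𝓘(ℝ, E) ∞ N]

/-- Pullback of smooth forms under a smooth map. -/
noncomputable def pullOmega {k : ℕ} (f : M → N) (hf : ContMDiff 𝓘(ℝ, E) 𝓘(ℝ, E) ∞ f) :
    Omega E N k →ₗ[ℝ] Omega E M k where
  toFun α := ⟨pull f α.1, fun x => (α.2 (f x)).pull (hf x)⟩
  map_add' α β := Subtype.ext <| pull_add f α.1 β.1
  map_smul' c α := Subtype.ext <| pull_smul f c α.1

theorem d_pullOmega {k : ℕ} (f : M → N) (hf : ContMDiff 𝓘(ℝ, E) 𝓘(ℝ, E) ∞ f) (α : Omega E N k) :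
    d E M k (pullOmega f hf α) = pullOmega f hf (d E N k α) :=
  Subtype.ext <| funext fun x => extD_pull (α.2 (f x)) (hf x)

end Cohomology

section Diffeomorphisms

variable {E : Type*} [NormedAddCommGroup E] [NormedSpace ℝ E] [FiniteDimensional ℝ E]
  {M : Type*} [TopologicalSpace M] [ChartedSpace E M] [IsManifold 𝓘(ℝ, E) ∞ M]

variable (E M) in
/-- Smooth diffeomorphisms of `M`. -/
abbrev Diff : Type _ := Diffeomorph 𝓘(ℝ, E) 𝓘(ℝ, E) M M ∞

/-- Diffeomorphisms form a group under composition, `(φ * ψ) x = φ (ψ x)`. -/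
noncomputable instance : Group (Diff E M) where
  mul φ ψ := ψ.trans φ
  one := Diffeomorph.refl 𝓘(ℝ, E) M ∞
  inv φ := φ.symm
  mul_assoc _ _ _ := rfl
  one_mul _ := rfl
  mul_one _ := rfl
  inv_mul_cancel φ := Diffeomorph.ext fun x => φ.symm_apply_apply x

theorem Diff.mul_apply (φ ψ : Diff E M) (x : M) : (φ * ψ) x = φ (ψ x) := rfl

theorem Diff.one_apply (x : M) : (1 : Diff E M) x = x := rfl

theorem Diff.inv_apply_self (φ : Diff E M) (x : M) : φ⁻¹ (φ x) = x := φ.symm_apply_apply x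

theorem Diff.apply_inv_self (φ : Diff E M) (x : M) : φ (φ⁻¹ x) = x := φ.apply_symm_apply x

/-- Pullback of smooth forms under a diffeomorphism. -/
noncomputable def Diff.pull {k : ℕ} (φ : Diff E M) : Omega E M k →ₗ[ℝ] Omega E M k :=
  pullOmega φ φ.contMDiff

theorem Diff.d_pull {k : ℕ} (φ : Diff E M) (α : Omega E M k) :
    d E M k (φ.pull α) = φ.pull (d E M k α) := d_pullOmega _ _ _

theorem Diff.pull_mul {k : ℕ} (φ ψ : Diff E M) (α : Omega E M k) :
    (φ * ψ).pull α = ψ.pull (φ.pull α) :=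
  Subtype.ext <| funext fun x => pull_comp_apply (g := φ) (f := ψ) α.1
    ((φ.contMDiff _).mdifferentiableAt (by simp)) ((ψ.contMDiff _).mdifferentiableAt (by simp))

theorem Diff.pull_one {k : ℕ} (α : Omega E M k) : (1 : Diff E M).pull α = α :=
  Subtype.ext <| pull_id α.1

theorem Diff.pull_mem_Z1 (φ : Diff E M) {α : Omega E M 1} (hα : α ∈ Z1 E M) :
    φ.pull α ∈ Z1 E M := by
  rw [Z1, LinearMap.mem_ker] at *
  rw [Diff.d_pull, hα, map_zero]

theorem Diff.pull_mem_OmegaC {k : ℕ} (φ : Diff E M) {α : Omega E M k} (hα : α ∈ OmegaC E M k) :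
    φ.pull α ∈ OmegaC E M k := by
  obtain ⟨K, hK, h⟩ := hα
  refine ⟨φ ⁻¹' K, ?_, fun x hx => ?_⟩
  · rw [← φ.symm_image_eq_preimage]
    exact hK.image φ.symm.continuous
  · change (α.1 (φ x)).compContinuousLinearMap _ = 0
    rw [h _ hx]
    rfl

theorem Diff.pull_mem_Z1c (φ : Diff E M) {α : Omega E M 1} (hα : α ∈ Z1c E M) :
    φ.pull α ∈ Z1c E M :=
  ⟨φ.pull_mem_Z1 hα.1, φ.pull_mem_OmegaC hα.2⟩

/-- Pullback `φ^*` on `H¹`. -/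
noncomputable def Diff.pullH1 (φ : Diff E M) : H1 E M →ₗ[ℝ] H1 E M :=
  Submodule.mapQ _ _ (φ.pull.restrict fun _ h => φ.pull_mem_Z1 h) <| by
    rintro ⟨_, hα⟩ ⟨β, rfl⟩
    exact ⟨φ.pull β, φ.d_pull β⟩

/-- Pullback `φ^*` on `H¹_c`. -/
noncomputable def Diff.pullH1c (φ : Diff E M) : H1c E M →ₗ[ℝ] H1c E M :=
  Submodule.mapQ _ _ (φ.pull.restrict fun _ h => φ.pull_mem_Z1c h) <| by
    rintro ⟨_, hα⟩ ⟨β, hβ, rfl⟩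
    exact ⟨φ.pull β, φ.pull_mem_OmegaC hβ, φ.d_pull β⟩

variable (E M) in
/-- The left action `φ · u = (φ⁻¹)^* u` on `H¹(M; ℝ)`. -/
noncomputable def actH1 : Representation ℝ (Diff E M) (H1 E M) where
  toFun φ := φ⁻¹.pullH1
  map_one' := by
    refine LinearMap.ext fun u => ?_
    obtain ⟨α, rfl⟩ := Submodule.Quotient.mk_surjective _ u
    exact congrArg H1.mk (Subtype.ext (Diff.pull_one α.1))
  map_mul' φ ψ := by
    refine LinearMap.ext fun u => ?_
    obtain ⟨α, rfl⟩ := Submodule.Quotient.mk_surjective _ u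
    refine congrArg H1.mk (Subtype.ext ?_)
    change (φ * ψ)⁻¹.pull α.1 = φ⁻¹.pull (ψ⁻¹.pull α.1)
    rw [mul_inv_rev, Diff.pull_mul]

variable (E M) in
/-- The left action `φ · u = (φ⁻¹)^* u` on `H¹_c(M; ℝ)`. -/
noncomputable def actH1c : Representation ℝ (Diff E M) (H1c E M) where
  toFun φ := φ⁻¹.pullH1c
  map_one' := by
    refine LinearMap.ext fun u => ?_
    obtain ⟨α, rfl⟩ := Submodule.Quotient.mk_surjective _ u
    exact congrArg H1c.mk (Subtype.ext (Diff.pull_one α.1))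
  map_mul' φ ψ := by
    refine LinearMap.ext fun u => ?_
    obtain ⟨α, rfl⟩ := Submodule.Quotient.mk_surjective _ u
    refine congrArg H1c.mk (Subtype.ext ?_)
    change (φ * ψ)⁻¹.pull α.1 = φ⁻¹.pull (ψ⁻¹.pull α.1)
    rw [mul_inv_rev, Diff.pull_mul]

/-- The diffeomorphisms preserving the form `Ω`. -/
noncomputable def Symp (Ω : Omega E M 2) : Subgroup (Diff E M) where
  carrier := {φ | φ.pull Ω = Ω}
  mul_mem' {φ ψ} hφ hψ := by
    simp only [Set.mem_ofPred_eq] at *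
    rw [Diff.pull_mul, hφ, hψ]
  one_mem' := Diff.pull_one Ω
  inv_mem' {φ} hφ := by
    simp only [Set.mem_ofPred_eq] at *
    conv_lhs => rw [← hφ]
    rw [← Diff.pull_mul, mul_inv_cancel, Diff.pull_one]

/-- The diffeomorphisms preserving `Ω` that are the identity outside some compact set. -/
noncomputable def SympC (Ω : Omega E M 2) : Subgroup (Diff E M) where
  carrier := {φ | φ ∈ Symp Ω ∧ ∃ K : Set M, IsCompact K ∧ ∀ x ∉ K, φ x = x}
  mul_mem' := by
    rintro φ ψ ⟨hφ, K, hK, h⟩ ⟨hψ, L, hL, h'⟩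
    refine ⟨mul_mem hφ hψ, K ∪ L, hK.union hL, fun x hx => ?_⟩
    have hx' : x ∉ K ∧ x ∉ L := by simpa using hx
    rw [Diff.mul_apply, h' x hx'.2, h x hx'.1]
  one_mem' := ⟨one_mem _, ∅, isCompact_empty, fun _ _ => rfl⟩
  inv_mem' := by
    rintro φ ⟨hφ, K, hK, h⟩
    refine ⟨inv_mem hφ, K, hK, fun x hx => ?_⟩
    conv_lhs => rw [← h x hx]
    exact φ.inv_apply_self x

/-- `Φ` is a smooth isotopy of diffeomorphisms preserving `Ω`, starting at the identity. (The time
parameter runs over `ℝ`; only the part over `[0, 1]` is used.) -/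
structure IsSympIsotopy (Ω : Omega E M 2) (Φ : ℝ → Diff E M) : Prop where
  smooth : ContMDiff (𝓘(ℝ, ℝ).prod 𝓘(ℝ, E)) 𝓘(ℝ, E) ∞ (fun p : ℝ × M => Φ p.1 p.2)
  mem : ∀ t, Φ t ∈ Symp Ω
  zero : Φ 0 = 1

/-- The identity component `Symp₀`: the end points of symplectic isotopies from the identity. -/
def Symp0 (Ω : Omega E M 2) : Set (Diff E M) := {φ | ∃ Φ, IsSympIsotopy Ω Φ ∧ Φ 1 = φ}

/-- The identity component `Symp₀^c` of the compactly supported group: the end points of symplectic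
isotopies from the identity that are supported in one compact set. -/
def Symp0c (Ω : Omega E M 2) : Set (Diff E M) :=
  {φ | ∃ Φ, IsSympIsotopy Ω Φ ∧
    (∃ K : Set M, IsCompact K ∧ ∀ t, ∀ x ∉ K, Φ t x = x) ∧ Φ 1 = φ}

/-- The velocity field `X_t` of an isotopy, `d/dt Φ_t (y) = X_t (Φ_t y)`. -/
noncomputable def velocity (Φ : ℝ → Diff E M) (t : ℝ) (x : M) : E :=
  mfderiv 𝓘(ℝ, ℝ) 𝓘(ℝ, E) (fun s : ℝ => Φ s ((Φ t)⁻¹ x)) t (1 : ℝ)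

/-- The `1`-form `∫₀¹ ι(X_t) Ω dt`. -/
noncomputable def fluxForm (Ω : Omega E M 2) (Φ : ℝ → Diff E M) : Form E M 1 :=
  fun x => ∫ t in (0 : ℝ)..1, (Ω.1 x).curryLeft (velocity Φ t x)

/-- The flux of the isotopy `Φ` is the class `c`: the form `∫₀¹ ι(X_t) Ω dt` is smooth and closed
and represents `c`. -/
def HasFlux (Ω : Omega E M 2) (Φ : ℝ → Diff E M) (c : H1 E M) : Prop :=
  ∃ α : Z1 E M, (α : Omega E M 1).1 = fluxForm Ω Φ ∧ H1.mk α = c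

/-- `Flux φ = c`: `φ` lies in `Symp₀`, and every symplectic isotopy from the identity to `φ` has
flux `c`. -/
def IsFlux (Ω : Omega E M 2) (φ : Diff E M) (c : H1 E M) : Prop :=
  φ ∈ Symp0 Ω ∧ ∀ Φ, IsSympIsotopy Ω Φ → Φ 1 = φ → HasFlux Ω Φ c

theorem pull_inv_sub_mem_Z1c [T2Space M] {Ω : Omega E M 2} {lam : Omega E M 1}
    (hlam : d E M 1 lam = -Ω) (φ : SympC Ω) : (φ.1⁻¹).pull lam - lam ∈ Z1c E M := by
  obtain ⟨hφ, K, hK, h⟩ := (inv_mem φ.2 : φ.1⁻¹ ∈ SympC Ω)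
  have hφ' : (φ.1⁻¹).pull Ω = Ω := hφ
  refine ⟨?_, K, hK, fun x hx => ?_⟩
  · rw [SetLike.mem_coe, LinearMap.mem_ker, map_sub, Diff.d_pull, hlam, map_neg, hφ', sub_self]
  · have he : ((φ.1⁻¹ : Diff E M) : M → M) =ᶠ[𝓝 x] id := by
      filter_upwards [hK.isClosed.isOpen_compl.mem_nhds hx] with y hy
      exact h y hy
    change pull ((φ.1⁻¹ : Diff E M) : M → M) lam.1 x - lam.1 x = 0
    rw [pull_congr he, pull_id, sub_self]

/-- For a `1`-form `λ` with `dλ = -Ω`, the map `φ ↦ [(φ⁻¹)^* λ - λ]` from `Symp^c` to `H¹_c`. -/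
noncomputable def fluxC [T2Space M] {Ω : Omega E M 2} (lam : Omega E M 1)
    (hlam : d E M 1 lam = -Ω) (φ : SympC Ω) : H1c E M :=
  H1c.mk ⟨(φ.1⁻¹).pull lam - lam, pull_inv_sub_mem_Z1c hlam φ⟩

end Diffeomorphisms

section OpenSubsets

open TopologicalSpace

variable {E : Type*} [NormedAddCommGroup E] [NormedSpace ℝ E] [FiniteDimensional ℝ E]
  {S : Type*} [TopologicalSpace S] [ChartedSpace E S] [IsManifold 𝓘(ℝ, E) ∞ S] {U : Opens S}

variable (U) in
/-- Restriction `j^*` of forms to an open subset, with inclusion `j`. -/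
noncomputable def restrictForm {k : ℕ} : Omega E S k →ₗ[ℝ] Omega E U k :=
  pullOmega (Subtype.val : U → S) contMDiff_subtype_val

open Classical in
/-- Extension by zero of a form on an open subset `U` (transported by the inverse of the
differential of the inclusion at the points of `U`). -/
noncomputable def extZero {k : ℕ} (α : Form E U k) : Form E S k := fun x =>
  if h : x ∈ U then (α ⟨x, h⟩).compContinuousLinearMap
    (tangentMapAt (E := E) (Subtype.val : U → S) ⟨x, h⟩).inverse
  else 0

open Classical in
/-- A local inverse of the inclusion of `U`, constant outside `U`. -/
noncomputable def retr (p : U) (x : S) : U := if h : x ∈ U then ⟨x, h⟩ else p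

theorem retr_val (p q : U) : retr p (q : S) = q := by simp [retr]

theorem val_retr_eventually (p q : U) : Subtype.val ∘ retr p =ᶠ[𝓝 (q : S)] id := by
  filter_upwards [U.isOpen.mem_nhds q.2] with y hy
  exact congrArg Subtype.val (retr_val p ⟨y, hy⟩)

theorem contMDiffAt_retr (p q : U) : ContMDiffAt 𝓘(ℝ, E) 𝓘(ℝ, E) ∞ (retr p) (q : S) := by
  rw [← contMDiffAt_subtype_iff]
  have : (fun x : U => retr p (x : S)) = id := funext fun x => retr_val p x
  rw [this]
  exact contMDiffAt_id

theorem inverse_tangentMapAt_val (p q : U) :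
    (tangentMapAt (E := E) (Subtype.val : U → S) q).inverse = tangentMapAt (retr p) (q : S) := by
  have h1 : MDifferentiableAt 𝓘(ℝ, E) 𝓘(ℝ, E) (retr p) (q : S) :=
    (contMDiffAt_retr p q).mdifferentiableAt (by simp)
  have h2 : MDifferentiableAt 𝓘(ℝ, E) 𝓘(ℝ, E) (Subtype.val : U → S) q :=
    (contMDiff_subtype_val (n := ∞) q).mdifferentiableAt (by simp)
  refine ContinuousLinearMap.inverse_eq ?_ ?_
  · have h2' : MDifferentiableAt 𝓘(ℝ, E) 𝓘(ℝ, E) (Subtype.val : U → S) (retr p (q : S)) := by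
      rwa [retr_val]
    have := tangentMapAt_comp h2' h1
    rw [tangentMapAt_congr (val_retr_eventually p q), tangentMapAt_id, retr_val] at this
    exact this.symm
  · have := tangentMapAt_comp h1 h2
    rw [show retr p ∘ (Subtype.val : U → S) = id from funext (retr_val p), tangentMapAt_id] at this
    exact this.symm

theorem extZero_eq_pull {k : ℕ} (α : Form E U k) (p q : U) :
    extZero α (q : S) = pull (retr p) α (q : S) := by
  simp only [extZero, pull, retr_val]
  rw [dif_pos q.2, inverse_tangentMapAt_val p q]

theorem extZero_eventually {k : ℕ} (α : Form E U k) (p : U) :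
    extZero α =ᶠ[𝓝 (p : S)] pull (retr p) α := by
  filter_upwards [U.isOpen.mem_nhds p.2] with y hy
  exact extZero_eq_pull α p ⟨y, hy⟩

theorem extZero_eventually_zero [T2Space S] {k : ℕ} {α : Omega E U k} (hα : α ∈ OmegaC E U k)
    {x : S} (hx : x ∉ U) : extZero α.1 =ᶠ[𝓝 x] 0 := by
  obtain ⟨K, hK, h⟩ := hα
  have hc : IsClosed (Subtype.val '' K : Set S) := (hK.image continuous_subtype_val).isClosed
  have hxK : x ∉ (Subtype.val '' K : Set S) := by
    rintro ⟨q, -, rfl⟩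
    exact hx q.2
  filter_upwards [hc.isOpen_compl.mem_nhds hxK] with y hy
  by_cases hyU : y ∈ U
  · have : α.1 ⟨y, hyU⟩ = 0 := h _ fun hK => hy ⟨_, hK, rfl⟩
    simp only [extZero]
    rw [dif_pos hyU, this]
    rfl
  · simp [extZero, hyU]

theorem smoothAt_extZero [T2Space S] {k : ℕ} {α : Omega E U k} (hα : α ∈ OmegaC E U k) (x : S) :
    SmoothAt (extZero α.1) x := by
  by_cases hx : x ∈ U
  · refine SmoothAt.congr (SmoothAt.pull ?_ (contMDiffAt_retr ⟨x, hx⟩ ⟨x, hx⟩))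
      (extZero_eventually α.1 ⟨x, hx⟩)
    exact α.2 _
  · exact (smoothAt_zero x).congr (extZero_eventually_zero hα hx)

theorem extD_extZero [T2Space S] {k : ℕ} {α : Omega E U k} (hα : α ∈ OmegaC E U k) :
    extD (extZero α.1) = extZero (extD α.1) := by
  funext x
  by_cases hx : x ∈ U
  · rw [extD_congr (extZero_eventually α.1 ⟨x, hx⟩),
      extD_pull (α.2 _) (contMDiffAt_retr ⟨x, hx⟩ ⟨x, hx⟩)]
    exact (extZero_eq_pull _ _ ⟨x, hx⟩).symm
  · rw [extD_congr (extZero_eventually_zero hα hx)]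
    have h0 := extD_smul_apply (E := E) 0 (0 : Form E S k) x
    rw [zero_smul, zero_smul] at h0
    rw [h0]
    simp [extZero, hx]

theorem extZero_add {k : ℕ} (α β : Form E U k) :
    (extZero (α + β) : Form E S k) = extZero α + extZero β := by
  funext x
  by_cases hx : x ∈ U
  · ext v; simp [extZero, hx]
  · simp [extZero, hx]

theorem extZero_smul {k : ℕ} (c : ℝ) (α : Form E U k) :
    (extZero (c • α) : Form E S k) = c • extZero α := by
  funext x
  by_cases hx : x ∈ U
  · ext v; simp [extZero, hx]
  · simp [extZero, hx]

/-- Extension by zero of closed compactly supported `1`-forms. -/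
noncomputable def extZ1c [T2Space S] : Z1c E U →ₗ[ℝ] Z1 E S where
  toFun α := ⟨⟨extZero α.1.1, smoothAt_extZero α.2.2⟩, by
    rw [Z1, LinearMap.mem_ker]
    apply Subtype.ext
    have h : extD α.1.1 = 0 := congrArg Subtype.val (LinearMap.mem_ker.1 α.2.1)
    rw [d_val, extD_extZero α.2.2, h]
    funext x
    by_cases hx : x ∈ U
    · ext v; simp [extZero, hx]
    · simp [extZero, hx]⟩
  map_add' α β := Subtype.ext <| Subtype.ext <| extZero_add _ _
  map_smul' c α := Subtype.ext <| Subtype.ext <| extZero_smul c _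

variable (U) in
/-- The map `H¹_c(U; ℝ) → H¹(S; ℝ)` induced by extension by zero. -/
noncomputable def extH1c [T2Space S] : H1c E U →ₗ[ℝ] H1 E S :=
  Submodule.mapQ _ _ extZ1c <| by
    rintro ⟨_, hα⟩ ⟨β, hβ, rfl⟩
    exact ⟨⟨extZero β.1, smoothAt_extZero hβ⟩, Subtype.ext (extD_extZero hβ)⟩

open Classical in
/-- Extension by the identity of a map `U → U`. -/
noncomputable def extId (f : U → U) (x : S) : S := if h : x ∈ U then (f ⟨x, h⟩ : S) else x

theorem extId_val (f : U → U) (q : U) : extId f (q : S) = f q := by simp [extId]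

theorem extId_of_notMem (f : U → U) {x : S} (hx : x ∉ U) : extId f x = x := by simp [extId, hx]

theorem extId_eventually [T2Space S] {f : U → U} {K : Set U} (hK : IsCompact K)
    (h : ∀ x ∉ K, f x = x) {x : S} (hx : x ∉ U) : extId f =ᶠ[𝓝 x] id := by
  have hc : IsClosed (Subtype.val '' K : Set S) := (hK.image continuous_subtype_val).isClosed
  have hxK : x ∉ (Subtype.val '' K : Set S) := by
    rintro ⟨q, -, rfl⟩
    exact hx q.2
  filter_upwards [hc.isOpen_compl.mem_nhds hxK] with y hy
  by_cases hyU : y ∈ U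
  · have : f ⟨y, hyU⟩ = ⟨y, hyU⟩ := h _ fun hK => hy ⟨_, hK, rfl⟩
    simp [extId, hyU, this]
  · simp [extId, hyU]

theorem contMDiff_extId [T2Space S] {f : U → U} (hf : ContMDiff 𝓘(ℝ, E) 𝓘(ℝ, E) ∞ f)
    {K : Set U} (hK : IsCompact K) (h : ∀ x ∉ K, f x = x) :
    ContMDiff 𝓘(ℝ, E) 𝓘(ℝ, E) ∞ (extId f : S → S) := by
  intro x
  by_cases hx : x ∈ U
  · have : ContMDiffAt 𝓘(ℝ, E) 𝓘(ℝ, E) ∞ (extId f) ((⟨x, hx⟩ : U) : S) := by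
      rw [← contMDiffAt_subtype_iff]
      have he : (fun q : U => extId f (q : S)) = Subtype.val ∘ f := funext (extId_val f)
      rw [he]
      exact (contMDiff_subtype_val.comp hf) _
    exact this
  · exact contMDiffAt_id.congr_of_eventuallyEq (extId_eventually hK h hx)

theorem extId_comp (f g : U → U) (x : S) : extId (f ∘ g) x = extId f (extId g x) := by
  by_cases hx : x ∈ U
  · lift x to U using hx
    simp [extId_val]
  · simp [extId_of_notMem _ hx]

theorem extId_id (x : S) : extId (id : U → U) x = x := by
  by_cases hx : x ∈ U
  · lift x to U using hx
    simp [extId_val]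
  · simp [extId_of_notMem _ hx]

/-- Extension by the identity of a compactly supported diffeomorphism of `U`. -/
noncomputable def extDiff [T2Space S] (φ : Diff E U)
    (hφ : ∃ K : Set U, IsCompact K ∧ ∀ x ∉ K, φ x = x) : Diff E S where
  toFun := extId φ
  invFun := extId (φ⁻¹ : Diff E U)
  left_inv x := by
    rw [← extId_comp, show (φ⁻¹ : Diff E U) ∘ φ = id from funext φ.inv_apply_self, extId_id]
  right_inv x := by
    rw [← extId_comp, show φ ∘ (φ⁻¹ : Diff E U) = id from funext φ.apply_inv_self, extId_id]
  contMDiff_toFun := by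
    obtain ⟨K, hK, h⟩ := hφ
    exact contMDiff_extId φ.contMDiff hK h
  contMDiff_invFun := by
    obtain ⟨K, hK, h⟩ := hφ
    refine contMDiff_extId (φ⁻¹ : Diff E U).contMDiff hK fun x hx => ?_
    conv_lhs => rw [← h x hx]
    exact φ.inv_apply_self x

theorem eq_of_pull_val {k : ℕ} {β γ : Form E S k} (q : U)
    (h : pull (Subtype.val : U → S) β q = pull (Subtype.val : U → S) γ q) :
    β (q : S) = γ (q : S) := by
  have h1 : MDifferentiableAt 𝓘(ℝ, E) 𝓘(ℝ, E) (retr q) (q : S) :=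
    (contMDiffAt_retr q q).mdifferentiableAt (by simp)
  have h2 : MDifferentiableAt 𝓘(ℝ, E) 𝓘(ℝ, E) (Subtype.val : U → S) (retr q (q : S)) :=
    (contMDiff_subtype_val (n := ∞) _).mdifferentiableAt (by simp)
  have key : ∀ δ : Form E S k, δ (q : S) = pull (retr q) (pull (Subtype.val : U → S) δ) (q : S) := by
    intro δ
    rw [← pull_comp_apply δ h2 h1, pull_congr (val_retr_eventually q q), pull_id]
  rw [key β, key γ]
  simp only [pull, retr_val] at h ⊢
  rw [h]

theorem extDiff_mem_Symp [T2Space S] {Ω : Omega E S 2} {φ : Diff E U}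
    (hφ : φ ∈ Symp (restrictForm U Ω)) (hK : ∃ K : Set U, IsCompact K ∧ ∀ x ∉ K, φ x = x) :
    extDiff φ hK ∈ Symp Ω := by
  refine Subtype.ext (funext fun x => ?_)
  change pull (extId φ) Ω.1 x = Ω.1 x
  by_cases hx : x ∈ U
  · have hd : MDifferentiableAt 𝓘(ℝ, E) 𝓘(ℝ, E) (extId φ) x :=
      ((extDiff φ hK).contMDiff x).mdifferentiableAt (by simp)
    have hv : ∀ q : U, MDifferentiableAt 𝓘(ℝ, E) 𝓘(ℝ, E) (Subtype.val : U → S) q := fun q =>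
      (contMDiff_subtype_val (n := ∞) q).mdifferentiableAt (by simp)
    refine eq_of_pull_val (⟨x, hx⟩ : U) ?_
    rw [← pull_comp_apply (g := extId φ) (f := (Subtype.val : U → S)) Ω.1 hd (hv _),
      show extId φ ∘ (Subtype.val : U → S) = Subtype.val ∘ φ from funext (extId_val φ),
      pull_comp_apply (g := (Subtype.val : U → S)) (f := φ) Ω.1 (hv _)
        ((φ.contMDiff _).mdifferentiableAt (by simp))]
    exact congrFun (congrArg Subtype.val hφ) _
  · obtain ⟨K, hK, h⟩ := hK
    rw [pull_congr (extId_eventually hK h hx), pull_id]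

variable (U) in
/-- The inclusion `Symp^c(U, j^*Ω) → Symp(S, Ω)` given by extension by the identity. -/
noncomputable def extSymp [T2Space S] (Ω : Omega E S 2) : SympC (restrictForm U Ω) →* Symp Ω where
  toFun φ := ⟨extDiff φ.1 φ.2.2, extDiff_mem_Symp φ.2.1 φ.2.2⟩
  map_one' := Subtype.ext <| Diffeomorph.ext fun x => extId_id x
  map_mul' φ ψ := Subtype.ext <| Diffeomorph.ext fun x => extId_comp φ.1 ψ.1 x

variable (U) in
/-- `H¹(S; ℝ)` as a module over `Symp^c(U, j^*Ω)`: the action `φ · u = (φ⁻¹)^* u` of `Symp(S, Ω)`,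
restricted along the inclusion. -/
noncomputable def actH1OfSympC [T2Space S] (Ω : Omega E S 2) :
    Representation ℝ (SympC (restrictForm U Ω)) (H1 E S) :=
  (actH1 E S).comp ((Symp Ω).subtype.comp (extSymp U Ω))

/-- `D` is a smoothly embedded closed disk: the image of the closed unit ball under a smooth
parametrization of an open subset of `S` whose domain contains the closed unit ball. -/
def IsClosedDisk (E : Type*) [NormedAddCommGroup E] [NormedSpace ℝ E]
    {S : Type*} [TopologicalSpace S] [ChartedSpace E S] (D : Set S) : Prop :=
  ∃ e ∈ IsManifold.maximalAtlas 𝓘(ℝ, E) ∞ S,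
    Metric.closedBall (0 : E) 1 ⊆ e.target ∧ D = e.symm '' Metric.closedBall (0 : E) 1

end OpenSubsets

/-- The model plane for surfaces. -/
abbrev Plane : Type := EuclideanSpace ℝ (Fin 2)

end SurfaceFlux

/-!
The forms on the closed surface `S` are compared through an area measure `μ` of `Ω`, which turns the
integral of a `2`-form into the integral of its quotient by `Ω`. For `1`-forms this gives the product
`brk Ω α β = (α ∧ β) / Ω` and the derivative `curl Ω η = dη / Ω`. Stokes' theorem says that
`∫ curl η dμ = 0` (`integral_curl_eq_zero`), symplectic diffeomorphisms preserve `μ`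
(`integral_comp_symp`), and Poincaré duality is `exists_primitive_of_pairing`: a closed form on an
open set `W` that pairs to zero with every closed form supported in `W` is exact on `W`.

*Cohomology.* A closed form is exact near the disk by the Poincaré lemma, and a primitive that is
locally constant near the disk is constant there. Hence extension by zero is an isomorphism
`H¹_c(U) ≅ H¹(S)` (`extH1c_injective`, `extH1c_surjective`).

*The flux.* For an isotopy `Φ` and a closed form `α`, let `F_α(x)` be the integral of `α` along the
trajectory of `x` (`trackInt`). Then `dF_α = Φ₁^* α - α`, and the flux form pairs with `α` to
`-∫ F_α dμ` (`integral_brk_fluxForm`). Stokes' theorem for `dλ = -Ω` gives the same value for the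
extended flux, if `Φ` is supported in the complement `U` of the disk (`integral_brk_extZero_flux`).
By duality the two classes agree once `F_α` is known to depend only on the end point of the isotopy.

*Dependence on the end point.* For two isotopies with the same end point the functions `F_α` differ
by a constant `c_α`. The integral over `S` of the cyclic sum of `F_α · Φ₁^* β ∧ Φ₁^* γ`,
`F_β · Φ₁^* γ ∧ α` and `F_γ · α ∧ β` is constant along the isotopy, hence zero
(`integral_trackInt_cyclic`). So the constants satisfy
`c_α ⟨β, γ⟩ + c_β ⟨γ, α⟩ + c_γ ⟨α, β⟩ = 0` for the intersection pairing. If `c ≠ 0`, a class that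
is annihilated by `c` and orthogonal to some `α` with `c_α ≠ 0` is orthogonal to everything; in
dimension at least three there is such a class other than zero, against duality. This is where the
genus enters, in place of the contractibility of the identity component.

*Independence of `λ`.* The difference of two choices is a closed form on `U`. Its pairing with
compactly supported forms is a functional on `H¹_c(U) ≅ H¹(S)`, hence given by a closed form `ν` on
`S`, and by duality on `U` the difference is `ν` plus an exact form (`exists_closed_extension`). The
two crossed homomorphisms differ by the coboundary of `[ν]`.
-/

namespace SurfaceFlux

/-! ### Exterior algebra of the plane -/

section Fibre

variable {V : Type*} [NormedAddCommGroup V] [NormedSpace ℝ V]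

/-- The covector underlying an alternating `1`-form. -/
noncomputable def cov : (V [⋀^Fin 1]→L[ℝ] ℝ) ≃ₗᵢ[ℝ] (V →L[ℝ] ℝ) :=
  (ContinuousAlternatingMap.ofSubsingletonLIE (𝕜 := ℝ) (E := V) (F := ℝ) (0 : Fin 1)).symm

theorem cov_apply (a : V [⋀^Fin 1]→L[ℝ] ℝ) (v : V) : cov a v = a (fun _ => v) := rfl

theorem apply_eq_cov (a : V [⋀^Fin 1]→L[ℝ] ℝ) (v : Fin 1 → V) : a v = cov a (v 0) := by
  rw [cov_apply]
  congr 1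
  funext i
  rw [Subsingleton.elim i 0]

/-- The exterior product of two `1`-forms. -/
noncomputable def wedge (a b : V [⋀^Fin 1]→L[ℝ] ℝ) : V [⋀^Fin 2]→L[ℝ] ℝ :=
  ContinuousAlternatingMap.alternatizeUncurryFin ((cov a).smulRight b)

theorem wedge_apply (a b : V [⋀^Fin 1]→L[ℝ] ℝ) (v : Fin 2 → V) :
    wedge a b v = cov a (v 0) * cov b (v 1) - cov a (v 1) * cov b (v 0) := by
  rw [wedge, ContinuousAlternatingMap.alternatizeUncurryFin_apply]
  simp [Fin.sum_univ_two, apply_eq_cov, Fin.removeNth]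
  ring

theorem cov_comp (a : V [⋀^Fin 1]→L[ℝ] ℝ) (L : V →L[ℝ] V) :
    cov (a.compContinuousLinearMap L) = (cov a).comp L := rfl

theorem wedge_comp (a b : V [⋀^Fin 1]→L[ℝ] ℝ) (L : V →L[ℝ] V) :
    (wedge a b).compContinuousLinearMap L =
      wedge (a.compContinuousLinearMap L) (b.compContinuousLinearMap L) := by
  ext v
  simp [wedge_apply, cov_comp]

theorem wedge_add_left (a a' b : V [⋀^Fin 1]→L[ℝ] ℝ) :
    wedge (a + a') b = wedge a b + wedge a' b := by
  ext v; simp [wedge_apply]; ring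

theorem wedge_add_right (a b b' : V [⋀^Fin 1]→L[ℝ] ℝ) :
    wedge a (b + b') = wedge a b + wedge a b' := by
  ext v; simp [wedge_apply]; ring

theorem wedge_smul_left (c : ℝ) (a b : V [⋀^Fin 1]→L[ℝ] ℝ) : wedge (c • a) b = c • wedge a b := by
  ext v; simp [wedge_apply]; ring

theorem wedge_smul_right (c : ℝ) (a b : V [⋀^Fin 1]→L[ℝ] ℝ) : wedge a (c • b) = c • wedge a b := by
  ext v; simp [wedge_apply]; ring

theorem wedge_swap (a b : V [⋀^Fin 1]→L[ℝ] ℝ) : wedge a b = -wedge b a := by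
  ext v; simp [wedge_apply]; ring

theorem contDiff_wedge [FiniteDimensional ℝ V] :
    ContDiff ℝ ∞ fun p : (V [⋀^Fin 1]→L[ℝ] ℝ) × (V [⋀^Fin 1]→L[ℝ] ℝ) => wedge p.1 p.2 :=
  (ContinuousAlternatingMap.alternatizeUncurryFinCLM ℝ V ℝ).contDiff.comp
    ((cov.toContinuousLinearEquiv.contDiff.comp contDiff_fst).smulRight contDiff_snd)

/-- The standard frame of the plane. -/
noncomputable def frame : Fin 2 → Plane := fun i => EuclideanSpace.single i 1

theorem frame_apply (i j : Fin 2) : frame i j = if j = i then 1 else 0 := by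
  simp [frame]

theorem eq_sum_frame (v : Plane) : v = v 0 • frame 0 + v 1 • frame 1 := by
  ext i; fin_cases i <;> simp [frame_apply]

theorem twoForm_apply (A : Plane [⋀^Fin 2]→L[ℝ] ℝ) (v : Fin 2 → Plane) :
    A v = (v 0 0 * v 1 1 - v 0 1 * v 1 0) * A frame := by
  have h := congrArg (fun f => f v)
    (A.toAlternatingMap.eq_smul_basis_det (EuclideanSpace.basisFun (Fin 2) ℝ).toBasis)
  have hf : ((EuclideanSpace.basisFun (Fin 2) ℝ).toBasis : Fin 2 → Plane) = frame := by
    funext i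
    simp [frame]
  simp only [AlternatingMap.smul_apply, smul_eq_mul, Module.Basis.det_apply, Matrix.det_fin_two,
    Module.Basis.toMatrix_apply, hf] at h
  simp only [OrthonormalBasis.coe_toBasis_repr_apply, EuclideanSpace.basisFun_repr] at h
  change A v = A frame * _ at h
  rw [h]
  ring

theorem twoForm_ext {A B : Plane [⋀^Fin 2]→L[ℝ] ℝ} (h : A frame = B frame) : A = B := by
  ext v
  rw [twoForm_apply A, twoForm_apply B, h]

theorem twoForm_frame_ne_zero {A : Plane [⋀^Fin 2]→L[ℝ] ℝ} (h : A ≠ 0) : A frame ≠ 0 :=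
  fun h0 => h (twoForm_ext (by simpa using h0))

/-- The determinant of a `2 × 2` endomorphism, as a polynomial in its entries. -/
theorem twoForm_comp_frame (A : Plane [⋀^Fin 2]→L[ℝ] ℝ) (L : Plane →L[ℝ] Plane) :
    A.compContinuousLinearMap L frame = L.det * A frame := by
  have h := congrArg (fun f => f (L ∘ frame))
    (A.toAlternatingMap.eq_smul_basis_det (EuclideanSpace.basisFun (Fin 2) ℝ).toBasis)
  have hf : ((EuclideanSpace.basisFun (Fin 2) ℝ).toBasis : Fin 2 → Plane) = frame := by
    funext i
    simp [frame]
  have hd := (EuclideanSpace.basisFun (Fin 2) ℝ).toBasis.det_comp (L : Plane →ₗ[ℝ] Plane)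
    (EuclideanSpace.basisFun (Fin 2) ℝ).toBasis
  rw [Module.Basis.det_self, mul_one, hf] at hd
  rw [hf] at h
  rw [mul_comm]
  exact h.trans (congrArg (A frame * ·) hd)

/-- The quotient `A / B` of two `2`-forms on the plane, a number. -/
noncomputable def ratio (A B : Plane [⋀^Fin 2]→L[ℝ] ℝ) : ℝ := A frame / B frame

theorem ratio_smul_self (A : Plane [⋀^Fin 2]→L[ℝ] ℝ) {B : Plane [⋀^Fin 2]→L[ℝ] ℝ} (hB : B ≠ 0) :
    A = ratio A B • B :=
  twoForm_ext (by simp [ratio, div_mul_cancel₀ _ (twoForm_frame_ne_zero hB)])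

theorem ratio_smul (c : ℝ) {B : Plane [⋀^Fin 2]→L[ℝ] ℝ} (hB : B ≠ 0) : ratio (c • B) B = c := by
  simp [ratio, mul_div_cancel_right₀ _ (twoForm_frame_ne_zero hB)]

theorem ratio_add (A A' B : Plane [⋀^Fin 2]→L[ℝ] ℝ) : ratio (A + A') B = ratio A B + ratio A' B := by
  simp [ratio, add_div]

theorem ratio_smul_left (c : ℝ) (A B : Plane [⋀^Fin 2]→L[ℝ] ℝ) :
    ratio (c • A) B = c * ratio A B := by
  simp [ratio, mul_div_assoc]

theorem ratio_zero (B : Plane [⋀^Fin 2]→L[ℝ] ℝ) : ratio 0 B = 0 := by simp [ratio]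

theorem ratio_comp (A : Plane [⋀^Fin 2]→L[ℝ] ℝ) {B : Plane [⋀^Fin 2]→L[ℝ] ℝ}
    {L : Plane →L[ℝ] Plane} (h : B.compContinuousLinearMap L ≠ 0) :
    ratio (A.compContinuousLinearMap L) (B.compContinuousLinearMap L) = ratio A B := by
  have hB : B ≠ 0 := by
    rintro rfl
    exact h (by ext v; simp)
  have : A.compContinuousLinearMap L = ratio A B • B.compContinuousLinearMap L := by
    conv_lhs => rw [ratio_smul_self A hB]
    ext v; simp
  rw [this, ratio_smul _ h]

/-- The contraction of the vanishing `3`-form `a ∧ b ∧ c` with a vector. -/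
theorem cyclic_wedge (a b c : Plane [⋀^Fin 1]→L[ℝ] ℝ) (v : Plane) :
    cov a v • wedge b c + cov b v • wedge c a + cov c v • wedge a b = 0 := by
  refine twoForm_ext ?_
  rw [eq_sum_frame v]
  simp [wedge_apply]
  ring

theorem cov_curryLeft (A : V [⋀^Fin 2]→L[ℝ] ℝ) (v w : V) :
    cov (A.curryLeft v) w = A ![v, w] := by
  rw [cov_apply]
  change A (Matrix.vecCons v fun _ => w) = _
  congr 1
  funext i
  fin_cases i <;> rfl

/-- `ι_v A ∧ b = -b(v) A` for a `2`-form `A` on the plane. -/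
theorem wedge_curryLeft (A : Plane [⋀^Fin 2]→L[ℝ] ℝ) (b : Plane [⋀^Fin 1]→L[ℝ] ℝ) (v : Plane) :
    wedge (A.curryLeft v) b = -cov b v • A := by
  refine twoForm_ext ?_
  rw [wedge_apply, cov_curryLeft, cov_curryLeft, twoForm_apply A ![v, _], twoForm_apply A ![v, _]]
  conv_rhs => rw [eq_sum_frame v]
  simp [frame_apply]
  ring

theorem curryLeft_wedge (a b : V [⋀^Fin 1]→L[ℝ] ℝ) (v : V) :
    (wedge a b).curryLeft v = cov a v • b - cov b v • a := by
  apply cov.injective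
  ext w
  rw [cov_curryLeft, wedge_apply]
  simp
  ring

end Fibre

/-! ### Functions, wedge products and quotients of forms -/

section FormOps

variable {E : Type*} [NormedAddCommGroup E] [NormedSpace ℝ E]
  {M : Type*} [TopologicalSpace M] [ChartedSpace E M]
  {N : Type*} [TopologicalSpace N] [ChartedSpace E N]

/-- A function as a `0`-form. -/
noncomputable def fun0 (f : M → ℝ) : Form E M 0 := fun x =>
  ContinuousAlternatingMap.constOfIsEmpty ℝ E (Fin 0) (f x)

theorem fun0_apply (f : M → ℝ) (x : M) (v : Fin 0 → E) : fun0 f x v = f x := rfl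

theorem eq_fun0 (α : Form E M 0) : α = fun0 (fun x => α x ![]) := by
  funext x; ext v
  rw [fun0_apply, Subsingleton.elim v ![]]

theorem pull_fun0 (φ : M → N) (f : N → ℝ) : pull φ (fun0 f : Form E N 0) = fun0 (f ∘ φ) := rfl

theorem localRep_fun0 (f : M → ℝ) (x : M) :
    localRep (fun0 f : Form E M 0) x = fun0 (f ∘ (extChartAt 𝓘(ℝ, E) x).symm) := rfl

theorem contDiffAt_fun0 {f : E → ℝ} {y : E} :
    ContDiffAt ℝ ∞ (fun0 f : Form E E 0) y ↔ ContDiffAt ℝ ∞ f y :=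
  (ContinuousAlternatingMap.constOfIsEmptyLIE ℝ E ℝ (Fin 0)).toContinuousLinearEquiv.comp_contDiffAt_iff

/-- The differential of a function, as a `1`-form. -/
noncomputable abbrev dfun (f : M → ℝ) : Form E M 1 := extD (fun0 f)

/-- The product of a function and a form. -/
noncomputable def fsmul {k : ℕ} (f : M → ℝ) (α : Form E M k) : Form E M k := fun x => f x • α x

theorem fsmul_apply {k : ℕ} (f : M → ℝ) (α : Form E M k) (x : M) : fsmul f α x = f x • α x := rfl

theorem localRep_fsmul {k : ℕ} (f : M → ℝ) (α : Form E M k) (x : M) :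
    localRep (fsmul f α) x = fun y => f ((extChartAt 𝓘(ℝ, E) x).symm y) • localRep α x y := by
  funext y; ext v; rfl

/-- The pointwise exterior product of `1`-forms. -/
noncomputable def wedgeForm (α β : Form E M 1) : Form E M 2 := fun x => wedge (α x) (β x)

theorem pull_wedgeForm (φ : M → N) (α β : Form E N 1) :
    pull φ (wedgeForm α β) = wedgeForm (pull φ α) (pull φ β) := by
  funext x
  exact wedge_comp _ _ _

theorem smoothAt_fun0 [IsManifold 𝓘(ℝ, E) ∞ M] {f : M → ℝ} {x : M} :
    SmoothAt (fun0 f : Form E M 0) x ↔ ContMDiffAt 𝓘(ℝ, E) 𝓘(ℝ, ℝ) ∞ f x := by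
  unfold SmoothAt
  rw [localRep_fun0, contDiffAt_fun0, contMDiffAt_iff_source]
  simp [contMDiffWithinAt_iff_contDiffWithinAt, contDiffWithinAt_univ]

/-- The differential of a real function at a point. -/
noncomputable def diffAt (f : M → ℝ) (x : M) : E →L[ℝ] ℝ := mfderiv 𝓘(ℝ, E) 𝓘(ℝ, ℝ) f x

theorem cov_dfun [IsManifold 𝓘(ℝ, E) ∞ M] {f : M → ℝ} {x : M}
    (hf : MDifferentiableAt 𝓘(ℝ, E) 𝓘(ℝ, ℝ) f x) :
    cov (dfun f x) = (diffAt f x : E →L[ℝ] ℝ) := by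
  have hx := mem_extChartAt_source (I := 𝓘(ℝ, E)) x
  have h1 : dfun f x = (ContinuousAlternatingMap.ofSubsingleton ℝ E ℝ (0 : Fin 1)
      (fderiv ℝ (f ∘ (extChartAt 𝓘(ℝ, E) x).symm)
        (extChartAt 𝓘(ℝ, E) x x))).compContinuousLinearMap
      (tangentMapAt (extChartAt 𝓘(ℝ, E) x) x) := by
    rw [← extDeriv_constOfIsEmpty]
    rfl
  have h2 : fderiv ℝ (f ∘ (extChartAt 𝓘(ℝ, E) x).symm) (extChartAt 𝓘(ℝ, E) x x) =
      (diffAt f x : E →L[ℝ] ℝ).comp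
        (tangentMapAt (extChartAt 𝓘(ℝ, E) x).symm (extChartAt 𝓘(ℝ, E) x x)) := by
    have hd := mdiff_symm (E := E) x ((extChartAt 𝓘(ℝ, E) x).map_source hx)
    have hf' : MDifferentiableAt 𝓘(ℝ, E) 𝓘(ℝ, ℝ) f
        ((extChartAt 𝓘(ℝ, E) x).symm (extChartAt 𝓘(ℝ, E) x x)) := by
      rwa [(extChartAt 𝓘(ℝ, E) x).left_inv hx]
    rw [← mfderiv_eq_fderiv, mfderiv_comp _ hf' hd, (extChartAt 𝓘(ℝ, E) x).left_inv hx]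
    rfl
  have h3 := symm_comp_chart (E := E) x ((extChartAt 𝓘(ℝ, E) x).map_source hx)
  rw [(extChartAt 𝓘(ℝ, E) x).left_inv hx] at h3
  rw [h1]
  change (fderiv ℝ (f ∘ (extChartAt 𝓘(ℝ, E) x).symm) (extChartAt 𝓘(ℝ, E) x x)).comp
    (tangentMapAt (extChartAt 𝓘(ℝ, E) x) x) = _
  rw [h2, ContinuousLinearMap.comp_assoc, h3, ContinuousLinearMap.comp_id]

theorem SmoothAt.fsmul {k : ℕ} [IsManifold 𝓘(ℝ, E) ∞ M] {f : M → ℝ} {α : Form E M k} {x : M}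
    (hf : ContMDiffAt 𝓘(ℝ, E) 𝓘(ℝ, ℝ) ∞ f x) (hα : SmoothAt α x) :
    SmoothAt (SurfaceFlux.fsmul f α) x := by
  have h : ContDiffAt ℝ ∞ _ _ := smoothAt_fun0.2 hf
  rw [localRep_fun0, contDiffAt_fun0] at h
  unfold SmoothAt
  rw [localRep_fsmul]
  exact h.smul hα

theorem SmoothAt.wedgeForm [FiniteDimensional ℝ E] {α β : Form E M 1} {x : M} (hα : SmoothAt α x)
    (hβ : SmoothAt β x) : SmoothAt (SurfaceFlux.wedgeForm α β) x := by
  have h : localRep (SurfaceFlux.wedgeForm α β) x =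
      fun y => wedge (localRep α x y) (localRep β x y) := pull_wedgeForm _ _ _
  unfold SmoothAt at *
  rw [h]
  exact contDiff_wedge.contDiffAt.comp (f := fun y => (localRep α x y, localRep β x y)) _
    (hα.prodMk hβ)

theorem extD_fsmul [IsManifold 𝓘(ℝ, E) ∞ M] {f : M → ℝ} {α : Form E M 1} {x : M}
    (hf : ContMDiffAt 𝓘(ℝ, E) 𝓘(ℝ, ℝ) ∞ f x) (hα : SmoothAt α x) :
    extD (fsmul f α) x = wedge (dfun f x) (α x) + f x • extD α x := by
  have hx := mem_extChartAt_source (I := 𝓘(ℝ, E)) x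
  have h : ContDiffAt ℝ ∞ _ _ := smoothAt_fun0.2 hf
  rw [localRep_fun0, contDiffAt_fun0] at h
  have h3 := symm_comp_chart (E := E) x ((extChartAt 𝓘(ℝ, E) x).map_source hx)
  rw [(extChartAt 𝓘(ℝ, E) x).left_inv hx] at h3
  have hα2 : α x = (localRep α x (extChartAt 𝓘(ℝ, E) x x)).compContinuousLinearMap
      (tangentMapAt (extChartAt 𝓘(ℝ, E) x) x) := by
    simp only [localRep, pull, altComp_comp, (extChartAt 𝓘(ℝ, E) x).left_inv hx]
    rw [h3]
    rfl
  have key : extDeriv (localRep (fsmul f α) x) (extChartAt 𝓘(ℝ, E) x x) =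
      wedge (extDeriv (fun0 (f ∘ (extChartAt 𝓘(ℝ, E) x).symm) : Form E E 0)
        (extChartAt 𝓘(ℝ, E) x x)) (localRep α x (extChartAt 𝓘(ℝ, E) x x)) +
      f x • extDeriv (localRep α x) (extChartAt 𝓘(ℝ, E) x x) := by
    have hd : fderiv ℝ (localRep (fsmul f α) x) (extChartAt 𝓘(ℝ, E) x x) =
        f x • fderiv ℝ (localRep α x) (extChartAt 𝓘(ℝ, E) x x) +
        (fderiv ℝ (f ∘ (extChartAt 𝓘(ℝ, E) x).symm) (extChartAt 𝓘(ℝ, E) x x)).smulRight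
          (localRep α x (extChartAt 𝓘(ℝ, E) x x)) := by
      rw [localRep_fsmul]
      have := fderiv_fun_smul (h.differentiableAt (by simp)) hα.differentiableAt
      simpa [Function.comp_def, (extChartAt 𝓘(ℝ, E) x).left_inv hx] using this
    have h0 : extDeriv (fun0 (f ∘ (extChartAt 𝓘(ℝ, E) x).symm) : Form E E 0)
        (extChartAt 𝓘(ℝ, E) x x) =
        cov.symm (fderiv ℝ (f ∘ (extChartAt 𝓘(ℝ, E) x).symm) (extChartAt 𝓘(ℝ, E) x x)) :=
      extDeriv_constOfIsEmpty _ _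
    rw [extDeriv, hd, ContinuousAlternatingMap.alternatizeUncurryFin_add,
      ContinuousAlternatingMap.alternatizeUncurryFin_smul, h0, wedge,
      LinearIsometryEquiv.apply_symm_apply]
    exact add_comm _ _
  unfold extD
  rw [key]
  conv_rhs => rw [hα2]
  unfold dfun extD
  rw [← wedge_comp, localRep_fun0]
  rfl

end FormOps

/-! ### Forms in the charts of the maximal atlas -/

section Charts

variable {E : Type*} [NormedAddCommGroup E] [NormedSpace ℝ E] [FiniteDimensional ℝ E]
  {S : Type*} [TopologicalSpace S] [ChartedSpace E S] [IsManifold 𝓘(ℝ, E) ∞ S]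
  {e : OpenPartialHomeomorph S E}

theorem localRep_self {k : ℕ} (α : Form E E k) (y : E) : localRep α y = α := by
  unfold localRep
  rw [extChartAt_model_space_eq_id]
  exact pull_id α

theorem smoothAt_self {k : ℕ} {α : Form E E k} {y : E} : SmoothAt α y ↔ ContDiffAt ℝ ∞ α y := by
  unfold SmoothAt
  rw [localRep_self, extChartAt_model_space_eq_id]
  rfl

theorem extD_self {k : ℕ} (α : Form E E k) : extD α = extDeriv α := by
  funext y
  unfold extD
  rw [localRep_self, extChartAt_model_space_eq_id]
  change (extDeriv α y).compContinuousLinearMap (tangentMapAt (id : E → E) y) = _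
  rw [tangentMapAt_id]
  rfl

theorem contMDiffAt_chart (he : e ∈ IsManifold.maximalAtlas 𝓘(ℝ, E) ∞ S) {x : S}
    (hx : x ∈ e.source) : ContMDiffAt 𝓘(ℝ, E) 𝓘(ℝ, E) ∞ e x :=
  contMDiffAt_of_mem_maximalAtlas he hx

theorem contMDiffAt_chart_symm (he : e ∈ IsManifold.maximalAtlas 𝓘(ℝ, E) ∞ S) {y : E}
    (hy : y ∈ e.target) : ContMDiffAt 𝓘(ℝ, E) 𝓘(ℝ, E) ∞ e.symm y :=
  contMDiffAt_symm_of_mem_maximalAtlas he hy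

theorem pull_chart_pull_symm {k : ℕ} (he : e ∈ IsManifold.maximalAtlas 𝓘(ℝ, E) ∞ S)
    (α : Form E S k) {x : S} (hx : x ∈ e.source) : pull e (pull e.symm α) x = α x := by
  have h1 := (contMDiffAt_chart he hx).mdifferentiableAt (by simp)
  have h2 := (contMDiffAt_chart_symm he (e.map_source hx)).mdifferentiableAt (by simp)
  rw [← pull_comp_apply α h2 h1]
  have : e.symm ∘ e =ᶠ[𝓝 x] id := e.eventually_left_inverse hx
  rw [pull_congr this, pull_id]

theorem contDiffAt_pull_symm {k : ℕ} (he : e ∈ IsManifold.maximalAtlas 𝓘(ℝ, E) ∞ S)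
    {α : Form E S k} {y : E} (hy : y ∈ e.target) (hα : SmoothAt α (e.symm y)) :
    ContDiffAt ℝ ∞ (pull e.symm α) y :=
  smoothAt_self.1 (hα.pull (contMDiffAt_chart_symm he hy))

theorem extDeriv_pull_symm {k : ℕ} (he : e ∈ IsManifold.maximalAtlas 𝓘(ℝ, E) ∞ S)
    {α : Form E S k} {y : E} (hy : y ∈ e.target) (hα : SmoothAt α (e.symm y)) :
    extDeriv (pull e.symm α) y = pull e.symm (extD α) y := by
  rw [← extD_self]
  exact extD_pull hα (contMDiffAt_chart_symm he hy)

theorem pull_symm_ne_zero {k : ℕ} (he : e ∈ IsManifold.maximalAtlas 𝓘(ℝ, E) ∞ S)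
    {α : Form E S k} {y : E} (hy : y ∈ e.target) (hα : α (e.symm y) ≠ 0) :
    pull e.symm α y ≠ 0 := by
  intro h
  apply hα
  rw [← pull_chart_pull_symm he α (e.map_target hy), pull, e.right_inv hy, h]
  ext v; rfl

section Transport

variable {M : Type*} [TopologicalSpace M] [ChartedSpace E M] [IsManifold 𝓘(ℝ, E) ∞ M]
  {N : Type*} [TopologicalSpace N] [ChartedSpace E N] [IsManifold 𝓘(ℝ, E) ∞ N]
  {Φ : OpenPartialHomeomorph M N}

open Classical in
/-- The pullback of a form under a partially defined map, extended by zero. It is applied to charts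
and to their inverses. -/
noncomputable def transport {k : ℕ} (Φ : OpenPartialHomeomorph M N) (β : Form E N k) : Form E M k :=
  fun x => if x ∈ Φ.source then pull Φ β x else 0

theorem transport_of_mem {k : ℕ} (β : Form E N k) {x : M} (hx : x ∈ Φ.source) :
    transport Φ β x = pull Φ β x := if_pos hx

theorem transport_eventually {k : ℕ} (β : Form E N k) {x : M} (hx : x ∈ Φ.source) :
    transport Φ β =ᶠ[𝓝 x] pull Φ β := by
  filter_upwards [Φ.open_source.mem_nhds hx] with z hz using transport_of_mem β hz

theorem tsupport_transport [T2Space M] {k : ℕ} {β : Form E N k} (hβ : HasCompactSupport β)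
    (h : tsupport β ⊆ Φ.target) : tsupport (transport Φ β) ⊆ Φ.symm '' tsupport β := by
  refine closure_minimal ?_
    (hβ.isCompact.image_of_continuousOn (Φ.continuousOn_symm.mono h)).isClosed
  intro x hx
  by_cases hxe : x ∈ Φ.source
  · refine ⟨Φ x, subset_tsupport _ fun h0 => hx ?_, Φ.left_inv hxe⟩
    rw [transport_of_mem _ hxe, pull, h0]
    rfl
  · exact absurd (if_neg hxe) hx

theorem hasCompactSupport_transport [T2Space M] {k : ℕ} {β : Form E N k}
    (hβ : HasCompactSupport β) (h : tsupport β ⊆ Φ.target) : HasCompactSupport (transport Φ β) :=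
  (hβ.isCompact.image_of_continuousOn (Φ.continuousOn_symm.mono h)).of_isClosed_subset
    (isClosed_tsupport _) (tsupport_transport hβ h)

theorem tsupport_transport_subset [T2Space M] {k : ℕ} {β : Form E N k} (hβ : HasCompactSupport β)
    (h : tsupport β ⊆ Φ.target) : tsupport (transport Φ β) ⊆ Φ.source := by
  refine (tsupport_transport hβ h).trans ?_
  rintro _ ⟨y, hy, rfl⟩
  exact Φ.map_target (h hy)

theorem smoothAt_transport [T2Space M] {k : ℕ}
    (hΦ : ∀ x ∈ Φ.source, ContMDiffAt 𝓘(ℝ, E) 𝓘(ℝ, E) ∞ Φ x)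
    {β : Form E N k} (hβ : ∀ y, SmoothAt β y) (hc : HasCompactSupport β)
    (h : tsupport β ⊆ Φ.target) (x : M) : SmoothAt (transport Φ β) x := by
  by_cases hx : x ∈ Φ.source
  · exact SmoothAt.congr (SmoothAt.pull (hβ _) (hΦ x hx)) (transport_eventually β hx)
  · refine (smoothAt_zero x).congr ?_
    exact notMem_tsupport_iff_eventuallyEq.1 fun h' => hx (tsupport_transport_subset hc h h')

theorem extD_transport {k : ℕ} (hΦ : ∀ x ∈ Φ.source, ContMDiffAt 𝓘(ℝ, E) 𝓘(ℝ, E) ∞ Φ x)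
    {β : Form E N k} (hβ : ∀ y, SmoothAt β y) {x : M} (hx : x ∈ Φ.source) :
    extD (transport Φ β) x = pull Φ (extD β) x := by
  rw [extD_congr (transport_eventually β hx), extD_pull (hβ _) (hΦ x hx)]

end Transport

theorem extD_of_notMem_tsupport {k : ℕ} {α : Form E S k} {x : S} (hx : x ∉ tsupport α) :
    extD α x = 0 := by
  rw [extD_congr (notMem_tsupport_iff_eventuallyEq.1 hx)]
  have h0 := extD_smul_apply (E := E) 0 (0 : Form E S k) x
  rwa [zero_smul, zero_smul] at h0

end Charts

/-! ### Quotients by an area form -/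

section Ratio

variable {S : Type*} [TopologicalSpace S] [ChartedSpace Plane S] [IsManifold 𝓘(ℝ, Plane) ∞ S]
  {e : OpenPartialHomeomorph S Plane}

/-- The quotient of two `2`-forms on a surface, as a function. -/
noncomputable def ratioForm (A Ω : Form Plane S 2) (x : S) : ℝ := ratio (A x) (Ω x)

/-- The function `b` with `α ∧ β = b Ω`; it is zero where `Ω` vanishes. -/
noncomputable def brk (Ω : Form Plane S 2) (α β : Form Plane S 1) : S → ℝ :=
  ratioForm (wedgeForm α β) Ω

/-- The function `c` with `dη = c Ω`; it is zero where `Ω` vanishes. -/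
noncomputable def curl (Ω : Form Plane S 2) (η : Form Plane S 1) : S → ℝ := ratioForm (extD η) Ω

/-- The coefficient of the form `Ω` in a chart. -/
noncomputable def density (Ω : Form Plane S 2) (e : OpenPartialHomeomorph S Plane) (y : Plane) : ℝ :=
  pull e.symm Ω y frame

theorem density_ne_zero (he : e ∈ IsManifold.maximalAtlas 𝓘(ℝ, Plane) ∞ S) {Ω : Form Plane S 2}
    (hΩ : ∀ x, Ω x ≠ 0) {y : Plane} (hy : y ∈ e.target) : density Ω e y ≠ 0 :=
  twoForm_frame_ne_zero (pull_symm_ne_zero he hy (hΩ _))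

theorem contDiffAt_density (he : e ∈ IsManifold.maximalAtlas 𝓘(ℝ, Plane) ∞ S) {Ω : Form Plane S 2}
    {y : Plane} (hy : y ∈ e.target) (hΩ : SmoothAt Ω (e.symm y)) :
    ContDiffAt ℝ ∞ (density Ω e) y :=
  (ContinuousAlternatingMap.apply ℝ Plane ℝ frame).contDiff.contDiffAt.comp y
    (contDiffAt_pull_symm he hy hΩ)

theorem ratioForm_chart_symm (he : e ∈ IsManifold.maximalAtlas 𝓘(ℝ, Plane) ∞ S)
    (A : Form Plane S 2) {Ω : Form Plane S 2} (hΩ : ∀ x, Ω x ≠ 0) {y : Plane} (hy : y ∈ e.target) :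
    ratioForm A Ω (e.symm y) * density Ω e y = pull e.symm A y frame := by
  have h := ratio_comp (A (e.symm y)) (pull_symm_ne_zero he hy (hΩ _))
  rw [ratioForm, ← h]
  exact div_mul_cancel₀ _ (density_ne_zero he hΩ hy)

theorem contMDiffAt_ratioForm {A Ω : Form Plane S 2} {x : S} (hA : SmoothAt A x)
    (hΩs : SmoothAt Ω x) (hΩ : ∀ x, Ω x ≠ 0) :
    ContMDiffAt 𝓘(ℝ, Plane) 𝓘(ℝ, ℝ) ∞ (ratioForm A Ω) x := by
  have he : chartAt Plane x ∈ IsManifold.maximalAtlas 𝓘(ℝ, Plane) ∞ S :=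
    IsManifold.chart_mem_maximalAtlas x
  have hx := mem_chart_source Plane x
  have hy := (chartAt Plane x).map_source hx
  have h1 : ContDiffAt ℝ ∞ (fun y => density A (chartAt Plane x) y / density Ω (chartAt Plane x) y)
      (chartAt Plane x x) := by
    refine (contDiffAt_density he hy ?_).div (contDiffAt_density he hy ?_)
      (density_ne_zero he hΩ hy) <;> rwa [(chartAt Plane x).left_inv hx]
  refine (h1.contMDiffAt.comp x (contMDiffAt_chart he hx)).congr_of_eventuallyEq ?_
  filter_upwards [(chartAt Plane x).open_source.mem_nhds hx] with z hz
  have hz' := (chartAt Plane x).map_source hz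
  have := ratioForm_chart_symm he A hΩ hz'
  rw [(chartAt Plane x).left_inv hz] at this
  rw [Function.comp_apply, eq_div_iff (density_ne_zero he hΩ hz'), this]
  rfl

theorem ratioForm_eq_zero {A Ω : Form Plane S 2} {x : S} (h : A x = 0) : ratioForm A Ω x = 0 := by
  rw [ratioForm, h, ratio_zero]

theorem ratioForm_pull {A Ω : Form Plane S 2} {φ : S → S} {x : S} (h : pull φ Ω x ≠ 0) :
    ratioForm (pull φ A) (pull φ Ω) x = ratioForm A Ω (φ x) :=
  ratio_comp _ h

variable (Ω : Form Plane S 2)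

theorem brk_add_left (α α' β : Form Plane S 1) (x : S) :
    brk Ω (α + α') β x = brk Ω α β x + brk Ω α' β x := by
  simp only [brk, ratioForm, wedgeForm, Pi.add_apply, wedge_add_left, ratio_add]

theorem brk_add_right (α β β' : Form Plane S 1) (x : S) :
    brk Ω α (β + β') x = brk Ω α β x + brk Ω α β' x := by
  simp only [brk, ratioForm, wedgeForm, Pi.add_apply, wedge_add_right, ratio_add]

theorem brk_smul_left (c : ℝ) (α β : Form Plane S 1) (x : S) :
    brk Ω (c • α) β x = c * brk Ω α β x := by
  simp only [brk, ratioForm, wedgeForm, Pi.smul_apply, wedge_smul_left, ratio_smul_left]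

theorem brk_smul_right (c : ℝ) (α β : Form Plane S 1) (x : S) :
    brk Ω α (c • β) x = c * brk Ω α β x := by
  simp only [brk, ratioForm, wedgeForm, Pi.smul_apply, wedge_smul_right, ratio_smul_left]

theorem brk_swap (α β : Form Plane S 1) (x : S) : brk Ω α β x = -brk Ω β α x := by
  simp only [brk, ratioForm, wedgeForm]
  rw [wedge_swap, ← neg_one_smul ℝ, ratio_smul_left]
  ring

theorem brk_sub_left (α α' β : Form Plane S 1) (x : S) :
    brk Ω (α - α') β x = brk Ω α β x - brk Ω α' β x := by
  rw [sub_eq_add_neg, brk_add_left, ← neg_one_smul ℝ, brk_smul_left]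
  ring

theorem brk_sub_right (α β β' : Form Plane S 1) (x : S) :
    brk Ω α (β - β') x = brk Ω α β x - brk Ω α β' x := by
  rw [sub_eq_add_neg, brk_add_right, ← neg_one_smul ℝ, brk_smul_right]
  ring

theorem brk_congr {α α' β β' : Form Plane S 1} {x : S} (h : α x = α' x) (h' : β x = β' x) :
    brk Ω α β x = brk Ω α' β' x := by
  simp only [brk, ratioForm, wedgeForm, h, h']

theorem brk_eq_zero_left {α β : Form Plane S 1} {x : S} (h : α x = 0) : brk Ω α β x = 0 := by
  have := brk_smul_left Ω 0 α β x
  rw [zero_mul] at this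
  rw [← this]
  exact brk_congr Ω (by simp [h]) rfl

theorem brk_eq_zero_right {α β : Form Plane S 1} {x : S} (h : β x = 0) : brk Ω α β x = 0 := by
  rw [brk_swap, brk_eq_zero_left Ω h, neg_zero]

variable {Ω}

theorem contMDiffAt_brk {α β : Form Plane S 1} {x : S} (hΩs : SmoothAt Ω x) (hΩ : ∀ x, Ω x ≠ 0)
    (hα : SmoothAt α x) (hβ : SmoothAt β x) :
    ContMDiffAt 𝓘(ℝ, Plane) 𝓘(ℝ, ℝ) ∞ (brk Ω α β) x :=
  contMDiffAt_ratioForm (hα.wedgeForm hβ) hΩs hΩ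

theorem contMDiff_curl {η : Form Plane S 1} (hΩs : ∀ x, SmoothAt Ω x) (hΩ : ∀ x, Ω x ≠ 0)
    (hη : ∀ x, SmoothAt η x) : ContMDiff 𝓘(ℝ, Plane) 𝓘(ℝ, ℝ) ∞ (curl Ω η) := fun x =>
  contMDiffAt_ratioForm (smoothAt_extD hη) (hΩs x) hΩ

theorem curl_fsmul {f : S → ℝ} {η : Form Plane S 1} {x : S}
    (hf : ContMDiffAt 𝓘(ℝ, Plane) 𝓘(ℝ, ℝ) ∞ f x) (hη : SmoothAt η x) :
    curl Ω (fsmul f η) x = brk Ω (dfun f) η x + f x * curl Ω η x := by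
  simp only [curl, brk, ratioForm, extD_fsmul hf hη, wedgeForm]
  exact (ratio_add _ _ _).trans (congrArg _ (ratio_smul_left _ _ _))

theorem curl_add {η η' : Form Plane S 1} {x : S} (hη : SmoothAt η x) (hη' : SmoothAt η' x) :
    curl Ω (η + η') x = curl Ω η x + curl Ω η' x := by
  simp only [curl, ratioForm, extD_add_apply hη hη']
  exact ratio_add _ _ _

theorem curl_eq_zero {η : Form Plane S 1} {x : S} (h : extD η x = 0) : curl Ω η x = 0 :=
  ratioForm_eq_zero h

theorem extD_eq_zero_of_curl (hΩ : ∀ x, Ω x ≠ 0) {η : Form Plane S 1} {x : S}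
    (h : curl Ω η x = 0) : extD η x = 0 := by
  rw [ratio_smul_self (extD η x) (hΩ x)]
  change curl Ω η x • _ = _
  rw [h, zero_smul]

theorem brk_pull {φ : S → S} {x : S} (h : pull φ Ω x = Ω x) (hΩ : Ω x ≠ 0)
    (α β : Form Plane S 1) : brk Ω (pull φ α) (pull φ β) x = brk Ω α β (φ x) := by
  have := ratioForm_pull (A := wedgeForm α β) (φ := φ) (x := x) (h.symm ▸ hΩ)
  rw [pull_wedgeForm] at this
  exact Eq.trans (by rw [brk, ratioForm, ratioForm, h]) this

end Ratio

/-! ### Integrals depending on a parameter -/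

section Parametric

open MeasureTheory intervalIntegral

universe u

theorem continuousOn_integral_param {X : Type*} [TopologicalSpace X] [LocallyCompactSpace X]
    [FirstCountableTopology X] {F : Type*} [NormedAddCommGroup F] [NormedSpace ℝ F]
    {f : X × ℝ → F} {W : Set X} (hW : IsOpen W) (hf : ContinuousOn f (W ×ˢ Set.univ)) (a b : ℝ) :
    ContinuousOn (fun x => ∫ t in a..b, f (x, t)) W := by
  intro x hx
  refine ContinuousAt.continuousWithinAt ?_
  obtain ⟨K, hK, hKW, hKc⟩ := exists_compact_subset hW hx
  obtain ⟨C, hC⟩ := (hK.prod (isCompact_uIcc (a := a) (b := b))).exists_bound_of_continuousOn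
    (hf.mono (Set.prod_mono hKc (Set.subset_univ _)))
  have hslice : ∀ y ∈ W, Continuous fun t => f (y, t) := fun y hy =>
    hf.comp_continuous (by fun_prop) fun t => ⟨hy, trivial⟩
  refine intervalIntegral.continuousAt_of_dominated_interval (bound := fun _ => C) ?_ ?_ ?_ ?_
  · filter_upwards [hW.mem_nhds hx] with y hy
    exact (hslice y hy).aestronglyMeasurable
  · filter_upwards [isOpen_interior.mem_nhds hKW] with y hy
    exact Filter.Eventually.of_forall fun t ht =>
      hC (y, t) ⟨interior_subset hy, Set.uIoc_subset_uIcc ht⟩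
  · exact intervalIntegrable_const
  · refine Filter.Eventually.of_forall fun t _ => ?_
    have : ContinuousAt f (x, t) := hf.continuousAt ((hW.prod isOpen_univ).mem_nhds ⟨hx, trivial⟩)
    exact this.comp (f := fun y => (y, t)) (by fun_prop)

/-- Differentiation under the integral sign, by induction on the order. The step from `n` to `n + 1`
applies the hypothesis to the derivative, whose values are in `V →L[ℝ] F`; hence the single universe
for `V` and `F`. -/
theorem contDiffOn_integral_param_aux {V : Type u} [NormedAddCommGroup V] [NormedSpace ℝ V]
    [FiniteDimensional ℝ V] (n : ℕ) : ∀ {F : Type u} [NormedAddCommGroup F] [NormedSpace ℝ F]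
    {f : V × ℝ → F} {W : Set V}, IsOpen W → ContDiffOn ℝ n f (W ×ˢ Set.univ) → ∀ a b : ℝ,
    ContDiffOn ℝ n (fun x => ∫ t in a..b, f (x, t)) W := by
  have : ProperSpace V := FiniteDimensional.proper ℝ V
  induction n with
  | zero =>
    intro F _ _ f W hW hf a b
    simp only [Nat.cast_zero, contDiffOn_zero] at hf ⊢
    exact continuousOn_integral_param hW hf a b
  | succ n ih =>
    intro F _ _ f W hW hf a b
    have hO : IsOpen (W ×ˢ (Set.univ : Set ℝ)) := hW.prod isOpen_univ
    have hf1 := (contDiffOn_succ_iff_fderiv_of_isOpen (n := n) hO).1 (by exact_mod_cast hf)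
    set g : V × ℝ → V →L[ℝ] F := fun p => (fderiv ℝ f p).comp (ContinuousLinearMap.inl ℝ V ℝ) with hg
    have hgn : ContDiffOn ℝ n g (W ×ˢ Set.univ) := hf1.2.2.clm_comp contDiffOn_const
    have hder : ∀ x ∈ W, HasFDerivAt (fun x => ∫ t in a..b, f (x, t)) (∫ t in a..b, g (x, t)) x := by
      intro x hx
      obtain ⟨K, hK, hKW, hKc⟩ := exists_compact_subset hW hx
      obtain ⟨C, hC⟩ := (hK.prod (isCompact_uIcc (a := a) (b := b))).exists_bound_of_continuousOn
        (hgn.continuousOn.mono (Set.prod_mono hKc (Set.subset_univ _)))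
      have hslice : ∀ y ∈ W, Continuous fun t => f (y, t) := fun y hy =>
        hf.continuousOn.comp_continuous (by fun_prop) fun t => ⟨hy, trivial⟩
      have hslice' : ∀ y ∈ W, Continuous fun t => g (y, t) := fun y hy =>
        hgn.continuousOn.comp_continuous (by fun_prop) fun t => ⟨hy, trivial⟩
      refine intervalIntegral.hasFDerivAt_integral_of_dominated_of_fderiv_le
        (F := fun y t => f (y, t)) (F' := fun y t => g (y, t)) (bound := fun _ => C)
        (isOpen_interior.mem_nhds hKW) ?_ ?_ ?_ ?_ ?_ ?_
      · filter_upwards [hW.mem_nhds hx] with y hy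
        exact (hslice y hy).aestronglyMeasurable
      · exact (hslice x hx).intervalIntegrable _ _
      · exact (hslice' x hx).aestronglyMeasurable
      · exact Filter.Eventually.of_forall fun t ht y hy =>
          hC (y, t) ⟨interior_subset hy, Set.uIoc_subset_uIcc ht⟩
      · exact intervalIntegrable_const
      · refine Filter.Eventually.of_forall fun t _ y hy => ?_
        have h1 : HasFDerivAt f (fderiv ℝ f (y, t)) (y, t) :=
          ((hf1.1 (y, t) ⟨hKc (interior_subset hy), trivial⟩).differentiableAt
            (hO.mem_nhds ⟨hKc (interior_subset hy), trivial⟩)).hasFDerivAt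
        exact h1.comp y (hasFDerivAt_prodMk_left y t)
    have : ContDiffOn ℝ (n + 1) (fun x => ∫ t in a..b, f (x, t)) W := by
      refine (contDiffOn_succ_iff_fderiv_of_isOpen (n := n) hW).2
        ⟨fun x hx => (hder x hx).differentiableAt.differentiableWithinAt, by simp, ?_⟩
      exact (ih hW hgn a b).congr fun x hx => (hder x hx).fderiv
    exact_mod_cast this

theorem contDiffOn_integral_param {V F : Type u} [NormedAddCommGroup V] [NormedSpace ℝ V]
    [FiniteDimensional ℝ V] [NormedAddCommGroup F] [NormedSpace ℝ F]
    {f : V × ℝ → F} {W : Set V} (hW : IsOpen W) (hf : ContDiffOn ℝ ∞ f (W ×ˢ Set.univ)) (a b : ℝ) :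
    ContDiffOn ℝ ∞ (fun x => ∫ t in a..b, f (x, t)) W :=
  contDiffOn_infty.2 fun n => contDiffOn_integral_param_aux n hW (contDiffOn_infty.1 hf n) a b

theorem contDiff_integral_param {f : ℝ × ℝ → ℝ} (hf : ContDiff ℝ ∞ f) (a b : ℝ) :
    ContDiff ℝ ∞ (fun x => ∫ t in a..b, f (x, t)) :=
  contDiffOn_univ.1 (contDiffOn_integral_param isOpen_univ hf.contDiffOn a b)

/-- A primitive in the first variable depends smoothly on both variables. -/
theorem contDiff_primitive_param {f : ℝ × ℝ → ℝ} (hf : ContDiff ℝ ∞ f) (a : ℝ) :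
    ContDiff ℝ ∞ (fun p : ℝ × ℝ => ∫ r in a..p.1, f (r, p.2)) := by
  -- substitute `r = a + (p.1 - a) t` to make the limits constant
  have h : (fun p : ℝ × ℝ => ∫ r in a..p.1, f (r, p.2)) =
      fun p => ∫ t in (0 : ℝ)..1, (p.1 - a) * f (a + (p.1 - a) * t, p.2) := by
    funext p
    have := intervalIntegral.smul_integral_comp_add_mul (a := 0) (b := 1)
      (fun r => f (r, p.2)) (p.1 - a) a
    rw [intervalIntegral.integral_const_mul, ← smul_eq_mul, this]
    simp
  rw [h]
  refine contDiffOn_univ.1 (contDiffOn_integral_param (V := ℝ × ℝ) (F := ℝ)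
    (f := fun q : (ℝ × ℝ) × ℝ => (q.1.1 - a) * f (a + (q.1.1 - a) * q.2, q.1.2))
    isOpen_univ ?_ 0 1)
  exact ContDiff.contDiffOn (by fun_prop)

end Parametric

/-! ### Functions with integral zero in a rectangle -/

section Rectangle

open MeasureTheory

theorem exists_contDiff_bump {a b : ℝ} (hab : a < b) : ∃ φ : ℝ → ℝ, ContDiff ℝ ∞ φ ∧
    (∀ s, s ∉ Set.Icc a b → φ s = 0) ∧ ∫ s in a..b, φ s = 1 := by
  let c : ContDiffBump ((a + b) / 2) := ⟨(b - a) / 4, (b - a) / 2, by linarith, by linarith⟩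
  have hr : c.rOut = (b - a) / 2 := rfl
  have hs : ∀ s, s ∉ Set.Icc a b → c.normed volume s = 0 := fun s hs => by
    by_contra h
    have := c.support_normed_eq (μ := volume) ▸ Function.mem_support.2 h
    rw [Real.ball_eq_Ioo, Set.mem_Ioo, hr] at this
    exact hs ⟨by linarith, by linarith⟩
  refine ⟨c.normed volume, c.contDiff_normed, hs, ?_⟩
  rw [intervalIntegral.integral_of_le hab.le, ← integral_Icc_eq_integral_Ioc,
    setIntegral_eq_integral_of_forall_compl_eq_zero hs, c.integral_normed]

/-- The Poincaré lemma with compact supports for `2`-forms on a rectangle: a function with integral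
zero is a divergence. -/
theorem exists_divergence_rectangle {a b c d : ℝ} (hab : a < b) (hcd : c < d) {u : ℝ × ℝ → ℝ}
    (hu : ContDiff ℝ ∞ u) (hsupp : ∀ p, p ∉ Set.Icc a b ×ˢ Set.Icc c d → u p = 0)
    (hint : ∫ t in c..d, ∫ s in a..b, u (s, t) = 0) :
    ∃ p q : ℝ × ℝ → ℝ, ContDiff ℝ ∞ p ∧ ContDiff ℝ ∞ q ∧
      (∀ z, z ∉ Set.Icc a b ×ˢ Set.Icc c d → p z = 0) ∧
      (∀ z, z ∉ Set.Icc a b ×ˢ Set.Icc c d → q z = 0) ∧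
      ∀ z, u z = fderiv ℝ q z (1, 0) - fderiv ℝ p z (0, 1) := by
  obtain ⟨φ, hφ, hφs, hφi⟩ := exists_contDiff_bump hab
  set g : ℝ → ℝ := fun t => ∫ s in a..b, u (s, t) with hg
  have hgs : ContDiff ℝ ∞ g := contDiff_integral_param (f := fun z => u (z.2, z.1)) (by fun_prop) a b
  have hg0 : ∀ t, t ∉ Set.Icc c d → g t = 0 := fun t ht => by
    simp only [hg]
    rw [intervalIntegral.integral_congr (g := fun _ => (0 : ℝ))]
    · simp
    · exact fun s _ => hsupp _ fun h => ht h.2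
  -- Subtracting `φ(s) g(t)` makes the integral over every row zero, so that a primitive along the
  -- rows has compact support; `g` itself has integral zero and is treated in the other variable.
  set w : ℝ × ℝ → ℝ := fun z => u z - φ z.1 * g z.2 with hw
  have hws : ContDiff ℝ ∞ w := by fun_prop
  have hw0 : ∀ z, z ∉ Set.Icc a b ×ˢ Set.Icc c d → w z = 0 := fun z hz => by
    have : φ z.1 * g z.2 = 0 := by
      by_cases h : z.1 ∈ Set.Icc a b
      · rw [hg0 z.2 fun h' => hz ⟨h, h'⟩, mul_zero]
      · rw [hφs _ h, zero_mul]
    simp only [hw, hsupp z hz, this, sub_zero]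
  have hwi : ∀ t, ∫ s in a..b, w (s, t) = 0 := fun t => by
    simp only [hw]
    rw [intervalIntegral.integral_sub, intervalIntegral.integral_mul_const, hφi, one_mul]
    · exact sub_self _
    · exact Continuous.intervalIntegrable (by have := hu.continuous; fun_prop) _ _
    · exact Continuous.intervalIntegrable (by have := hφ.continuous; fun_prop) _ _
  -- A primitive from the left end of an interval vanishes outside it when the total integral is 0.
  have vanish : ∀ (f : ℝ → ℝ) (a b s : ℝ), a < b → Continuous f → (∀ r, r ∉ Set.Icc a b → f r = 0) →
      ∫ r in a..b, f r = 0 → s ∉ Set.Icc a b → ∫ r in a..s, f r = 0 := by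
    intro f a b s hab hf h0 hi hs
    rcases lt_or_ge s a with h | h
    · rw [intervalIntegral.integral_congr_ae (g := fun _ => (0 : ℝ))]
      · simp
      · have : ∀ᵐ r : ℝ, r ≠ a := by simp [ae_iff, measure_singleton]
        filter_upwards [this] with r hr hr'
        rw [Set.uIoc_of_ge h.le] at hr'
        exact h0 r fun h' => hr (le_antisymm hr'.2 h'.1)
    · have hb : b < s := lt_of_not_ge fun h' => hs ⟨h, h'⟩
      rw [← intervalIntegral.integral_add_adjacent_intervals (b := b)
        (hf.intervalIntegrable _ _) (hf.intervalIntegrable _ _), hi, zero_add,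
        intervalIntegral.integral_congr_ae (g := fun _ => (0 : ℝ))]
      · simp
      · refine Filter.Eventually.of_forall fun r hr => h0 r fun h' => ?_
        rw [Set.uIoc_of_le hb.le] at hr
        exact absurd hr.1 (not_lt.2 h'.2)
  have hzero : ∀ (f : ℝ → ℝ) (a s : ℝ), (∀ r, f r = 0) → ∫ r in a..s, f r = 0 := by
    intro f a s h
    simp [h]
  refine ⟨fun z => -φ z.1 * ∫ r in c..z.2, g r, fun z => ∫ r in a..z.1, w (r, z.2), ?_, ?_, ?_, ?_,
    ?_⟩
  · have h1 := contDiff_primitive_param (f := fun z => g z.1) (by fun_prop) c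
    have h2 : ContDiff ℝ ∞ fun z : ℝ × ℝ => ∫ r in c..z.2, g r :=
      h1.comp (contDiff_snd.prodMk contDiff_fst)
    fun_prop
  · exact contDiff_primitive_param hws a
  · intro z hz
    by_cases h : z.1 ∈ Set.Icc a b
    · have : ∫ r in c..z.2, g r = 0 :=
        vanish g c d z.2 hcd hgs.continuous hg0 hint fun h' => hz ⟨h, h'⟩
      simp [this]
    · simp [hφs _ h]
  · intro z hz
    by_cases h : z.2 ∈ Set.Icc c d
    · refine vanish _ a b z.1 hab (by have := hws.continuous; fun_prop) (fun r hr => ?_) (hwi _)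
        fun h' => hz ⟨h', h⟩
      exact hw0 _ fun h' => hr h'.1
    · exact hzero _ _ _ fun r => hw0 _ fun h' => h h'.2
  · intro z
    have h1 := contDiff_primitive_param (f := fun z => g z.1) (by fun_prop) c
    have h2 : ContDiff ℝ ∞ fun z : ℝ × ℝ => ∫ r in c..z.2, g r :=
      h1.comp (contDiff_snd.prodMk contDiff_fst)
    have hp : ContDiff ℝ ∞ fun z : ℝ × ℝ => -φ z.1 * ∫ r in c..z.2, g r := by fun_prop
    have hq := contDiff_primitive_param hws a
    have e1 : fderiv ℝ (fun z : ℝ × ℝ => ∫ r in a..z.1, w (r, z.2)) z (1, 0) = w z := by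
      have h3 := ((hq.differentiable (by simp)) z).hasFDerivAt.comp_hasDerivAt (x := z.1)
        (f := fun s => (s, z.2)) (f' := (1, 0)) ((hasDerivAt_id _).prodMk (hasDerivAt_const _ _))
      have h4 := (Continuous.deriv_integral (fun r => w (r, z.2))
        (by have := hws.continuous; fun_prop) a z.1)
      rw [← h4]
      exact h3.deriv.symm
    have e2 : fderiv ℝ (fun z : ℝ × ℝ => -φ z.1 * ∫ r in c..z.2, g r) z (0, 1) = -φ z.1 * g z.2 := by
      have h3 := ((hp.differentiable (by simp)) z).hasFDerivAt.comp_hasDerivAt (x := z.2)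
        (f := fun t => (z.1, t)) (f' := (0, 1)) ((hasDerivAt_const _ _).prodMk (hasDerivAt_id _))
      have h4 := (intervalIntegral.integral_hasDerivAt_right (a := c) (b := z.2)
        (hgs.continuous.intervalIntegrable _ _) (hgs.continuous.stronglyMeasurableAtFilter _ _)
        hgs.continuous.continuousAt).const_mul (-φ z.1)
      exact h3.unique h4
    rw [e1, e2]
    simp only [hw]
    ring

end Rectangle

/-! ### Integration of forms on the plane -/

section PlaneIntegral

open MeasureTheory

theorem extDeriv_frame {η : Form Plane Plane 1} {y : Plane} (h : DifferentiableAt ℝ η y) :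
    extDeriv η y frame = fderiv ℝ (fun z => cov (η z) (frame 1)) y (frame 0) -
      fderiv ℝ (fun z => cov (η z) (frame 0)) y (frame 1) := by
  rw [extDeriv_apply h]
  simp [Fin.sum_univ_two, apply_eq_cov, Fin.removeNth]
  ring

theorem integral_fderiv_eq_zero {f : Plane → ℝ} (hf : ContDiff ℝ ∞ f) (hc : HasCompactSupport f)
    (v : Plane) : ∫ y, fderiv ℝ f y v = 0 := by
  have hd : Integrable (fun y => fderiv ℝ f y v) :=
    ((hf.continuous_fderiv (by simp)).clm_apply continuous_const).integrable_of_hasCompactSupport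
      (hc.fderiv_apply (𝕜 := ℝ) v)
  have := integral_mul_fderiv_eq_neg_fderiv_mul_of_integrable (μ := (volume : Measure Plane))
    (f := fun _ => (1 : ℝ)) (g := f) (v := v) (by simp) (by simpa using hd)
    (by simpa using hf.continuous.integrable_of_hasCompactSupport hc) (by simp)
    (fun x _ => hf.differentiable (by simp) x)
  simpa using this

theorem integral_extDeriv_eq_zero {η : Form Plane Plane 1} (hη : ContDiff ℝ ∞ η)
    (hc : HasCompactSupport η) : ∫ y, extDeriv η y frame = 0 := by
  have hs : ∀ i, ContDiff ℝ ∞ fun z => cov (η z) (frame i) := fun i =>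
    (cov.toContinuousLinearEquiv.contDiff.comp hη).clm_apply contDiff_const
  have hcs : ∀ i, HasCompactSupport fun z => cov (η z) (frame i) := fun i =>
    hc.comp_left (g := fun a => cov a (frame i)) (by simp)
  have hint : ∀ i j, Integrable fun y => fderiv ℝ (fun z => cov (η z) (frame i)) y (frame j) :=
    fun i j => (((hs i).continuous_fderiv (by simp)).clm_apply
      continuous_const).integrable_of_hasCompactSupport ((hcs i).fderiv_apply (𝕜 := ℝ) _)
  simp_rw [fun y => extDeriv_frame (hη.differentiable (by simp) y)]
  rw [integral_sub (hint _ _) (hint _ _), integral_fderiv_eq_zero (hs _) (hcs _),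
    integral_fderiv_eq_zero (hs _) (hcs _), sub_self]

/-- The open rectangle with the given sides. -/
def Rect (a b c d : ℝ) : Set Plane := {y | (a < y 0 ∧ y 0 < b) ∧ (c < y 1 ∧ y 1 < d)}

theorem isOpen_rect (a b c d : ℝ) : IsOpen (Rect a b c d) := by
  have h0 : Continuous fun y : Plane => y 0 := by fun_prop
  have h1 : Continuous fun y : Plane => y 1 := by fun_prop
  exact ((isOpen_lt continuous_const h0).inter (isOpen_lt h0 continuous_const)).inter
    ((isOpen_lt continuous_const h1).inter (isOpen_lt h1 continuous_const))

theorem convex_rect (a b c d : ℝ) : Convex ℝ (Rect a b c d) := by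
  have h0 : IsLinearMap ℝ fun y : Plane => y 0 := ⟨fun _ _ => rfl, fun _ _ => rfl⟩
  have h1 : IsLinearMap ℝ fun y : Plane => y 1 := ⟨fun _ _ => rfl, fun _ _ => rfl⟩
  exact ((convex_halfSpace_gt h0 a).inter (convex_halfSpace_lt h0 b)).inter
    ((convex_halfSpace_gt h1 c).inter (convex_halfSpace_lt h1 d))

/-- The identification of `ℝ × ℝ` with the plane. -/
noncomputable def toPlane : (ℝ × ℝ) ≃L[ℝ] Plane :=
  (ContinuousLinearEquiv.finTwoArrow ℝ ℝ).symm.trans (EuclideanSpace.equiv (Fin 2) ℝ).symm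

@[simp] theorem toPlane_zero (z : ℝ × ℝ) : toPlane z 0 = z.1 := rfl

@[simp] theorem toPlane_one (z : ℝ × ℝ) : toPlane z 1 = z.2 := rfl

theorem toPlane_symm_apply (y : Plane) : toPlane.symm y = (y 0, y 1) := rfl

theorem measurePreserving_toPlane : MeasurePreserving toPlane (volume : Measure (ℝ × ℝ)) volume :=
  (EuclideanSpace.volume_preserving_symm_measurableEquiv_toLp (Fin 2)).symm.comp
    (volume_preserving_finTwoArrow ℝ).symm

theorem integral_plane (f : Plane → ℝ) : ∫ y, f y = ∫ z : ℝ × ℝ, f (toPlane z) :=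
  (measurePreserving_toPlane.integral_comp toPlane.toHomeomorph.measurableEmbedding f).symm

theorem exists_closed_rect {K : Set Plane} (hK : IsCompact K) {a b c d : ℝ} (hab : a < b)
    (hcd : c < d) (h : K ⊆ Rect a b c d) : ∃ a' b' c' d', a < a' ∧ a' < b' ∧ b' < b ∧ c < c' ∧
      c' < d' ∧ d' < d ∧ ∀ y ∈ K, y 0 ∈ Set.Icc a' b' ∧ y 1 ∈ Set.Icc c' d' := by
  have key : ∀ (i : Fin 2) (a b : ℝ), a < b → (∀ y ∈ K, a < y i ∧ y i < b) →
      ∃ a' b', a < a' ∧ a' < b' ∧ b' < b ∧ ∀ y ∈ K, y i ∈ Set.Icc a' b' := by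
    intro i a b hab h
    have hc : Continuous fun y : Plane => y i := by fun_prop
    rcases K.eq_empty_or_nonempty with rfl | hne
    · exact ⟨a + (b - a) / 3, b - (b - a) / 3, by linarith, by linarith, by linarith, by simp⟩
    · obtain ⟨p, hp, hpm⟩ := hK.exists_isMinOn hne hc.continuousOn
      obtain ⟨q, hq, hqm⟩ := hK.exists_isMaxOn hne hc.continuousOn
      have h1 := h p hp
      have h2 := h q hq
      have h3 : p i ≤ q i := hpm hq
      exact ⟨(a + p i) / 2, (b + q i) / 2, by linarith, by linarith, by linarith, fun y hy =>
        ⟨by have : p i ≤ y i := hpm hy; linarith, by have : y i ≤ q i := hqm hy; linarith⟩⟩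
  obtain ⟨a', b', h1, h2, h3, h4⟩ := key 0 a b hab fun y hy => (h hy).1
  obtain ⟨c', d', h5, h6, h7, h8⟩ := key 1 c d hcd fun y hy => (h hy).2
  exact ⟨a', b', c', d', h1, h2, h3, h5, h6, h7, fun y hy => ⟨h4 y hy, h8 y hy⟩⟩

/-- The Poincaré lemma with compact supports for `2`-forms on a rectangle in the plane. -/
theorem exists_extDeriv_eq {a b c d : ℝ} (hab : a < b) (hcd : c < d) {u : Plane → ℝ}
    (hu : ContDiff ℝ ∞ u) (hc : HasCompactSupport u) (h : tsupport u ⊆ Rect a b c d)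
    (hint : ∫ y, u y = 0) : ∃ η : Form Plane Plane 1, ContDiff ℝ ∞ η ∧ HasCompactSupport η ∧
      tsupport η ⊆ Rect a b c d ∧ ∀ y, extDeriv η y frame = u y := by
  obtain ⟨a', b', c', d', h1, h2, h3, h4, h5, h6, hK⟩ := exists_closed_rect hc hab hcd h
  have hsupp : ∀ z : ℝ × ℝ, z ∉ Set.Icc a' b' ×ˢ Set.Icc c' d' → u (toPlane z) = 0 := by
    intro z hz
    by_contra h0
    exact hz (hK _ (subset_tsupport _ h0))
  have hu' : ContDiff ℝ ∞ fun z => u (toPlane z) := hu.comp toPlane.contDiff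
  have hint' : ∫ t in c'..d', ∫ s in a'..b', u (toPlane (s, t)) = 0 := by
    rw [integral_plane, ← setIntegral_eq_integral_of_forall_compl_eq_zero hsupp] at hint
    have hI : IntegrableOn (fun z : ℝ × ℝ => u (toPlane z)) (Set.Icc a' b' ×ˢ Set.Icc c' d') :=
      hu'.continuous.continuousOn.integrableOn_compact (isCompact_Icc.prod isCompact_Icc)
    rw [Measure.volume_eq_prod] at hint hI
    rw [intervalIntegral.integral_of_le h5.le, ← integral_Icc_eq_integral_Ioc]
    simp_rw [intervalIntegral.integral_of_le h2.le, ← integral_Icc_eq_integral_Ioc]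
    rw [← Measure.prod_restrict, integral_prod_symm] at hint
    · exact hint
    · rw [Measure.prod_restrict]
      exact hI
  obtain ⟨p, q, hp, hq, hp0, hq0, hpq⟩ := exists_divergence_rectangle h2 h5 hu' hsupp hint'
  have hps : ContDiff ℝ ∞ (p ∘ toPlane.symm) := hp.comp toPlane.symm.contDiff
  have hqs : ContDiff ℝ ∞ (q ∘ toPlane.symm) := hq.comp toPlane.symm.contDiff
  set η : Form Plane Plane 1 := fun y => cov.symm
    ((p ∘ toPlane.symm) y • (EuclideanSpace.proj 0 : Plane →L[ℝ] ℝ) +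
      (q ∘ toPlane.symm) y • (EuclideanSpace.proj 1 : Plane →L[ℝ] ℝ)) with hη
  have hηs : ContDiff ℝ ∞ η := by
    have h0 : ContDiff ℝ ∞ fun y => (p ∘ toPlane.symm) y • (EuclideanSpace.proj 0 : Plane →L[ℝ] ℝ) +
        (q ∘ toPlane.symm) y • (EuclideanSpace.proj 1 : Plane →L[ℝ] ℝ) :=
      (hps.smul contDiff_const).add (hqs.smul contDiff_const)
    exact (cov (V := Plane)).symm.contDiff.comp h0
  set K : Set Plane := toPlane '' (Set.Icc a' b' ×ˢ Set.Icc c' d')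
  have hKc : IsCompact K := (isCompact_Icc.prod isCompact_Icc).image toPlane.continuous
  have hη0 : ∀ y, y ∉ K → η y = 0 := by
    intro y hy
    have hz : toPlane.symm y ∉ Set.Icc a' b' ×ˢ Set.Icc c' d' := fun h' =>
      hy ⟨_, h', toPlane.apply_symm_apply y⟩
    simp [hη, hp0 _ hz, hq0 _ hz]
  have hsub : tsupport η ⊆ K :=
    closure_minimal (fun y hy => by_contra fun h' => hy (hη0 y h')) hKc.isClosed
  refine ⟨η, hηs, hKc.of_isClosed_subset (isClosed_tsupport _) hsub, hsub.trans ?_, fun y => ?_⟩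
  · rintro _ ⟨z, ⟨⟨z1, z2⟩, z3, z4⟩, rfl⟩
    refine ⟨⟨?_, ?_⟩, ?_, ?_⟩ <;> simp only [toPlane_zero, toPlane_one] <;> linarith
  · rw [extDeriv_frame (hηs.differentiable (by simp) y)]
    have e0 : (fun z => cov (η z) (frame 0)) = p ∘ toPlane.symm := by
      funext z; simp [hη, frame_apply]
    have e1 : (fun z => cov (η z) (frame 1)) = q ∘ toPlane.symm := by
      funext z; simp [hη, frame_apply]
    have f0 : toPlane.symm (frame 0) = (1, 0) := by
      rw [toPlane_symm_apply]; simp [frame_apply]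
    have f1 : toPlane.symm (frame 1) = (0, 1) := by
      rw [toPlane_symm_apply]; simp [frame_apply]
    rw [e0, e1, toPlane.symm.comp_right_fderiv, toPlane.symm.comp_right_fderiv]
    simp only [ContinuousLinearMap.comp_apply, ContinuousLinearEquiv.coe_coe, f0, f1]
    rw [← hpq, toPlane.apply_symm_apply]

end PlaneIntegral

/-! ### The measure of an area form -/

section AreaMeasure

open MeasureTheory

variable {S : Type*} [TopologicalSpace S] [ChartedSpace Plane S] [IsManifold 𝓘(ℝ, Plane) ∞ S]
  {e e' : OpenPartialHomeomorph S Plane} {Ω : Form Plane S 2}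

/-- The charts of the maximal atlas. -/
abbrev MaxAtlas (S : Type*) [TopologicalSpace S] [ChartedSpace Plane S] :
    Set (OpenPartialHomeomorph S Plane) := IsManifold.maximalAtlas 𝓘(ℝ, Plane) ∞ S

/-- The chart `e` has a rectangle as its image. -/
def IsRectChart (e : OpenPartialHomeomorph S Plane) : Prop :=
  e ∈ MaxAtlas S ∧ ∃ a b c d, a < b ∧ c < d ∧ e.target = Rect a b c d

theorem exists_rect_subset {O : Set Plane} (hO : IsOpen O) {y : Plane} (hy : y ∈ O) :
    ∃ a b c d, a < b ∧ c < d ∧ y ∈ Rect a b c d ∧ Rect a b c d ⊆ O := by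
  have h : toPlane ⁻¹' O ∈ 𝓝 (y 0, y 1) := by
    refine (hO.preimage toPlane.continuous).mem_nhds ?_
    rw [← toPlane_symm_apply, Set.mem_preimage, toPlane.apply_symm_apply]
    exact hy
  obtain ⟨r, hr, hb⟩ := Metric.mem_nhds_iff.1 h
  refine ⟨y 0 - r, y 0 + r, y 1 - r, y 1 + r, by linarith, by linarith,
    ⟨⟨by linarith, by linarith⟩, by linarith, by linarith⟩, fun z hz => ?_⟩
  have hz' : (z 0, z 1) ∈ toPlane ⁻¹' O := hb <| by
    rw [← ball_prod_same, Set.mem_prod, Real.ball_eq_Ioo, Real.ball_eq_Ioo]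
    exact hz
  rwa [← toPlane_symm_apply, Set.mem_preimage, toPlane.apply_symm_apply] at hz'

theorem exists_rectChart {W : Set S} (hW : IsOpen W) {x : S} (hx : x ∈ W) :
    ∃ e, IsRectChart e ∧ x ∈ e.source ∧ e.source ⊆ W := by
  set e₀ := chartAt Plane x
  have hx₀ : x ∈ e₀.source := mem_chart_source Plane x
  obtain ⟨a, b, c, d, hab, hcd, hy, hsub⟩ := exists_rect_subset
    (e₀.isOpen_inter_preimage_symm hW)
    (show e₀ x ∈ e₀.target ∩ e₀.symm ⁻¹' W from
      ⟨e₀.map_source hx₀, by rw [Set.mem_preimage, e₀.left_inv hx₀]; exact hx⟩)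
  have he₀ : e₀ ∈ MaxAtlas S := IsManifold.chart_mem_maximalAtlas x
  obtain ⟨h1, h2⟩ := (IsManifold.mem_maximalAtlas_iff_contMDiffOn _).1 he₀
  set e := (e₀.symm.restrOpen _ (isOpen_rect a b c d)).symm with he
  have hs : e.source = e₀.source ∩ e₀ ⁻¹' Rect a b c d := by
    simp [he]
  have ht : e.target = e₀.target ∩ Rect a b c d := by
    simp [he]
  refine ⟨e, ⟨(IsManifold.mem_maximalAtlas_iff_contMDiffOn _).2 ⟨?_, ?_⟩, a, b, c, d, hab, hcd, ?_⟩,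
    ?_, ?_⟩
  · exact h1.mono (hs.subset.trans Set.inter_subset_left)
  · exact h2.mono (ht.subset.trans Set.inter_subset_left)
  · rw [ht]
    exact Set.inter_eq_right.2 (hsub.trans Set.inter_subset_left)
  · rw [hs]
    exact ⟨hx₀, hy⟩
  · rw [hs]
    rintro z ⟨hz, hz'⟩
    have := (hsub hz').2
    rwa [Set.mem_preimage, e₀.left_inv hz] at this

/-- The integral of `f |Ω|` computed in a chart. -/
noncomputable def chartIntegral (Ω : Form Plane S 2) (e : OpenPartialHomeomorph S Plane)
    (f : S → ℝ) : ℝ := ∫ y in e.target, f (e.symm y) * |density Ω e y|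

/-- Under a change of charts the density is multiplied by the Jacobian determinant. -/
theorem density_transition (he : e ∈ MaxAtlas S) (he' : e' ∈ MaxAtlas S) {y : Plane}
    (hy : y ∈ e.target) (hy' : e.symm y ∈ e'.source) :
    density Ω e y = (fderiv ℝ (e' ∘ e.symm) y).det * density Ω e' (e' (e.symm y)) := by
  have h1 := (contMDiffAt_chart_symm he hy).mdifferentiableAt (by simp)
  have h2 := (contMDiffAt_chart he' hy').mdifferentiableAt (by simp)
  have h3 := (contMDiffAt_chart_symm he' (e'.map_source hy')).mdifferentiableAt (by simp)
  have h4 : MDifferentiableAt 𝓘(ℝ, Plane) 𝓘(ℝ, Plane) (e' ∘ e.symm) y := h2.comp y h1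
  have h5 : e'.symm ∘ (e' ∘ e.symm) =ᶠ[𝓝 y] e.symm := by
    have := (e.continuousAt_symm hy).eventually (e'.open_source.mem_nhds hy')
    filter_upwards [this] with z hz using e'.left_inv hz
  rw [density, ← pull_congr h5, pull_comp_apply (g := e'.symm) (f := e' ∘ e.symm) Ω h3 h4, pull,
    twoForm_comp_frame, tangentMapAt, mfderiv_eq_fderiv]
  rfl

/-- The integral of a function supported in two charts is the same in both, by the change of
variables formula. -/
theorem chartIntegral_eq (he : e ∈ MaxAtlas S) (he' : e' ∈ MaxAtlas S) {f : S → ℝ}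
    (hf : ∀ x, f x ≠ 0 → x ∈ e.source ∧ x ∈ e'.source) :
    chartIntegral Ω e f = chartIntegral Ω e' f := by
  have restrict : ∀ e e' : OpenPartialHomeomorph S Plane, (∀ x, f x ≠ 0 → x ∈ e'.source) →
      chartIntegral Ω e f =
        ∫ y in e.target ∩ e.symm ⁻¹' e'.source, f (e.symm y) * |density Ω e y| := by
    intro e e' h
    refine setIntegral_eq_of_subset_of_forall_sdiff_eq_zero e.open_target.measurableSet
      Set.inter_subset_left ?_
    rintro y ⟨hy, hy'⟩
    rw [show f (e.symm y) = 0 from by_contra fun h0 => hy' ⟨hy, h _ h0⟩, zero_mul]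
  rw [restrict e e' fun x hx => (hf x hx).2, restrict e' e fun x hx => (hf x hx).1]
  set s := e.target ∩ e.symm ⁻¹' e'.source
  have hs : IsOpen s := e.isOpen_inter_preimage_symm e'.open_source
  have him : (e' ∘ e.symm) '' s = e'.target ∩ e'.symm ⁻¹' e.source := by
    ext z
    constructor
    · rintro ⟨y, ⟨hy, hy'⟩, rfl⟩
      refine ⟨e'.map_source hy', ?_⟩
      rw [Set.mem_preimage, Function.comp_apply, e'.left_inv hy']
      exact e.map_target hy
    · rintro ⟨hz, hz'⟩
      refine ⟨e (e'.symm z), ⟨e.map_source hz', ?_⟩, ?_⟩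
      · rw [Set.mem_preimage, e.left_inv hz']
        exact e'.map_target hz
      · rw [Function.comp_apply, e.left_inv hz', e'.right_inv hz]
  have hinj : Set.InjOn (e' ∘ e.symm) s := by
    rintro y ⟨hy, hy'⟩ z ⟨hz, hz'⟩ h
    exact e.symm.injOn hy hz (e'.injOn hy' hz' h)
  have hd : ∀ y ∈ s, HasFDerivWithinAt (e' ∘ e.symm) (fderiv ℝ (e' ∘ e.symm) y) s y := by
    rintro y ⟨hy, hy'⟩
    have h : ContMDiffAt 𝓘(ℝ, Plane) 𝓘(ℝ, Plane) ∞ (e' ∘ e.symm) y :=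
      (contMDiffAt_chart he' hy').comp y (contMDiffAt_chart_symm he hy)
    exact (h.contDiffAt.differentiableAt (by simp)).hasFDerivAt.hasFDerivWithinAt
  rw [← him, integral_image_eq_integral_abs_det_fderiv_smul volume hs.measurableSet hd hinj]
  refine setIntegral_congr_fun hs.measurableSet ?_
  rintro y ⟨hy, hy'⟩
  simp only [Function.comp_apply, smul_eq_mul]
  rw [e'.left_inv hy', density_transition he he' hy hy', abs_mul]
  ring

theorem continuousOn_density (he : e ∈ MaxAtlas S) (hΩs : ∀ x, SmoothAt Ω x) :
    ContinuousOn (density Ω e) e.target := fun _ hy =>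
  (contDiffAt_density he hy (hΩs _)).continuousAt.continuousWithinAt

theorem integrableOn_chart (he : e ∈ MaxAtlas S) (hΩs : ∀ x, SmoothAt Ω x) {f : S → ℝ}
    (hf : Continuous f) (hc : HasCompactSupport f) (hsupp : tsupport f ⊆ e.source) :
    IntegrableOn (fun y => f (e.symm y) * |density Ω e y|) e.target := by
  have hK : IsCompact (e '' tsupport f) :=
    hc.isCompact.image_of_continuousOn (e.continuousOn.mono hsupp)
  have hKt : e '' tsupport f ⊆ e.target := by
    rintro _ ⟨x, hx, rfl⟩
    exact e.map_source (hsupp hx)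
  have h1 : ContinuousOn (fun y => f (e.symm y) * |density Ω e y|) e.target :=
    (hf.comp_continuousOn e.continuousOn_symm).mul (continuousOn_density he hΩs).abs
  refine ((h1.mono hKt).integrableOn_compact hK).of_forall_sdiff_eq_zero
    e.open_target.measurableSet ?_
  rintro y ⟨hy, hy'⟩
  rw [show f (e.symm y) = 0 from by_contra fun h0 =>
    hy' ⟨_, subset_tsupport _ h0, e.right_inv hy⟩, zero_mul]

theorem chartIntegral_add (he : e ∈ MaxAtlas S) (hΩs : ∀ x, SmoothAt Ω x) {f g : S → ℝ}
    (hf : Continuous f) (hcf : HasCompactSupport f) (hsf : tsupport f ⊆ e.source)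
    (hg : Continuous g) (hcg : HasCompactSupport g) (hsg : tsupport g ⊆ e.source) :
    chartIntegral Ω e (fun x => f x + g x) = chartIntegral Ω e f + chartIntegral Ω e g := by
  simp only [chartIntegral, add_mul]
  exact integral_add (integrableOn_chart he hΩs hf hcf hsf) (integrableOn_chart he hΩs hg hcg hsg)

theorem chartIntegral_smul (c : ℝ) (f : S → ℝ) :
    chartIntegral Ω e (fun x => c * f x) = c * chartIntegral Ω e f := by
  simp only [chartIntegral, mul_assoc]
  exact integral_const_mul _ _

/-- A measure on the surface that is given by `|Ω|` in every chart. The condition is tested on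
continuous functions supported in the chart. -/
def IsAreaMeasure [MeasurableSpace S] (Ω : Form Plane S 2) (μ : Measure S) : Prop :=
  ∀ e ∈ MaxAtlas S, ∀ f : S → ℝ, Continuous f → tsupport f ⊆ e.source →
    ∫ x, f x ∂μ = chartIntegral Ω e f

variable [T2Space S] [CompactSpace S]

/-- A finite partition of unity subordinate to charts with rectangles as images. -/
theorem exists_partition (S : Type*) [TopologicalSpace S] [ChartedSpace Plane S]
    [IsManifold 𝓘(ℝ, Plane) ∞ S] [T2Space S] [CompactSpace S] :
    ∃ (t : Finset S) (e : t → OpenPartialHomeomorph S Plane) (ρ : t → S → ℝ),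
    (∀ i, IsRectChart (e i)) ∧ (∀ i, ContMDiff 𝓘(ℝ, Plane) 𝓘(ℝ, ℝ) ∞ (ρ i)) ∧
    (∀ i x, 0 ≤ ρ i x) ∧ (∀ i, tsupport (ρ i) ⊆ (e i).source) ∧ ∀ x, ∑ i, ρ i x = 1 := by
  choose e he hx _ using fun x : S => exists_rectChart isOpen_univ (Set.mem_univ x)
  obtain ⟨t, ht⟩ := isCompact_univ.elim_finite_subcover (fun x => (e x).source)
    (fun x => (e x).open_source) fun x _ => Set.mem_iUnion.2 ⟨x, hx x⟩
  obtain ⟨ρ, hρ⟩ := SmoothPartitionOfUnity.exists_isSubordinate 𝓘(ℝ, Plane)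
    (isClosed_univ (X := S)) (fun i : t => (e i).source) (fun i => (e i).open_source) (by
      intro x hx
      obtain ⟨i, hi, hx'⟩ := Set.mem_iUnion₂.1 (ht hx)
      exact Set.mem_iUnion.2 ⟨⟨i, hi⟩, hx'⟩)
  refine ⟨t, fun i => e i, fun i => ρ i, fun i => he i, fun i => (ρ i).contMDiff,
    fun i x => ρ.nonneg i x, hρ, fun x => ?_⟩
  rw [← finsum_eq_sum_of_fintype]
  exact ρ.sum_eq_one (Set.mem_univ x)

/-- The area measure exists: a partition of unity glues the integrals in charts to a positive linear
functional, which the Riesz–Markov–Kakutani theorem represents by a measure. -/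
theorem exists_areaMeasure [MeasurableSpace S] [BorelSpace S] (hΩs : ∀ x, SmoothAt Ω x) :
    ∃ μ : Measure S, IsFiniteMeasure μ ∧ IsAreaMeasure Ω μ := by
  obtain ⟨t, e, ρ, he, hρ, hρ0, hρs, hρ1⟩ := exists_partition S
  have hc : ∀ f : S → ℝ, HasCompactSupport f := fun f => HasCompactSupport.of_compactSpace f
  have hs : ∀ i (f : S → ℝ), tsupport (fun x => ρ i x * f x) ⊆ (e i).source := fun i f =>
    (tsupport_mul_subset_left (f := ρ i) (g := f)).trans (hρs i)
  have hadd : ∀ f g : S → ℝ, Continuous f → Continuous g →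
      ∑ i, chartIntegral Ω (e i) (fun x => ρ i x * (f x + g x)) =
      ∑ i, chartIntegral Ω (e i) (fun x => ρ i x * f x) +
        ∑ i, chartIntegral Ω (e i) (fun x => ρ i x * g x) := by
    intro f g hf hg
    rw [← Finset.sum_add_distrib]
    refine Finset.sum_congr rfl fun i _ => ?_
    simp only [mul_add]
    exact chartIntegral_add (he i).1 hΩs ((hρ i).continuous.mul hf) (hc _) (hs i f)
      ((hρ i).continuous.mul hg) (hc _) (hs i g)
  let Λ₀ : CompactlySupportedContinuousMap S ℝ →ₗ[ℝ] ℝ :=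
    { toFun := fun f => ∑ i, chartIntegral Ω (e i) (fun x => ρ i x * f x)
      map_add' := fun f g => hadd f g f.continuous g.continuous
      map_smul' := fun c f => by
        simp only [CompactlySupportedContinuousMap.coe_smul, Pi.smul_apply, smul_eq_mul,
          RingHom.id_apply, Finset.mul_sum]
        refine Finset.sum_congr rfl fun i _ => ?_
        rw [← chartIntegral_smul]
        congr 1
        funext x
        ring }
  let Λ : CompactlySupportedContinuousMap S ℝ →ₚ[ℝ] ℝ := PositiveLinearMap.mk₀ Λ₀ <| by
    intro f hf
    refine Finset.sum_nonneg fun i _ => ?_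
    refine setIntegral_nonneg (e i).open_target.measurableSet fun y _ => ?_
    exact mul_nonneg (mul_nonneg (hρ0 i _) (hf _)) (abs_nonneg _)
  refine ⟨RealRMK.rieszMeasure Λ, inferInstance, ?_⟩
  intro e' he' f hf hfs
  have h1 : ∫ x, f x ∂(RealRMK.rieszMeasure Λ) =
      ∑ i, chartIntegral Ω (e i) (fun x => ρ i x * f x) :=
    RealRMK.integral_rieszMeasure Λ ⟨⟨f, hf⟩, hc f⟩
  have h2 : ∀ i, chartIntegral Ω (e i) (fun x => ρ i x * f x) =
      chartIntegral Ω e' (fun x => ρ i x * f x) := fun i =>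
    chartIntegral_eq (he i).1 he' fun x hx => ⟨hρs i (subset_tsupport _ (left_ne_zero_of_mul hx)),
      hfs (subset_tsupport _ (right_ne_zero_of_mul hx))⟩
  have hs' : ∀ i, tsupport (fun x => ρ i x * f x) ⊆ e'.source := fun i =>
    (tsupport_mul_subset_right (f := ρ i) (g := f)).trans hfs
  rw [h1, Finset.sum_congr rfl fun i _ => h2 i]
  unfold chartIntegral
  have hI : ∀ i, IntegrableOn (fun y => ρ i (e'.symm y) * f (e'.symm y) * |density Ω e' y|)
      e'.target := fun i => integrableOn_chart he' hΩs ((hρ i).continuous.mul hf) (hc _) (hs' i)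
  rw [← integral_finsetSum _ fun i _ => hI i]
  refine setIntegral_congr_fun e'.open_target.measurableSet fun y _ => ?_
  simp only [← Finset.sum_mul, hρ1, one_mul]

end AreaMeasure

/-! ### Stokes' theorem and invariance of the area measure -/

section Stokes

open MeasureTheory

variable {S : Type*} [TopologicalSpace S] [ChartedSpace Plane S] [IsManifold 𝓘(ℝ, Plane) ∞ S]
  [T2Space S] [CompactSpace S] [MeasurableSpace S] [BorelSpace S]
  {Ω : Form Plane S 2} {μ : Measure S} [IsFiniteMeasure μ]

theorem integrable_of_continuous {f : S → ℝ} (hf : Continuous f) : Integrable f μ :=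
  hf.integrable_of_hasCompactSupport (HasCompactSupport.of_compactSpace f)

/-- A nowhere vanishing density has a constant sign on the connected image of a chart, so that
integration against `|Ω|` is, up to this sign, integration against `Ω`. -/
theorem abs_density_eq {e : OpenPartialHomeomorph S Plane} (he : IsRectChart e)
    (hΩs : ∀ x, SmoothAt Ω x) (hΩ : ∀ x, Ω x ≠ 0) :
    ∃ s : ℝ, s ≠ 0 ∧ ∀ y ∈ e.target, |density Ω e y| = s * density Ω e y := by
  obtain ⟨he, a, b, c, d, -, -, ht⟩ := he
  have hp : IsPreconnected e.target := ht ▸ (convex_rect a b c d).isPreconnected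
  have hc := continuousOn_density he hΩs
  have h0 : ∀ y ∈ e.target, density Ω e y ≠ 0 := fun y hy => density_ne_zero he hΩ hy
  by_cases h : ∃ y ∈ e.target, 0 < density Ω e y
  · obtain ⟨y, hy, hy0⟩ := h
    refine ⟨1, one_ne_zero, fun z hz => ?_⟩
    rw [one_mul, abs_of_pos]
    by_contra hz0
    obtain ⟨w, hw, hw0⟩ := hp.intermediate_value hz hy hc ⟨not_lt.1 hz0, hy0.le⟩
    exact h0 w hw hw0
  · push Not at h
    refine ⟨-1, by norm_num, fun z hz => ?_⟩
    rw [abs_of_nonpos (h z hz), neg_one_mul]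

/-- Stokes' theorem for a `1`-form supported in a single chart. -/
theorem integral_curl_eq_zero_of_tsupport (hμ : IsAreaMeasure Ω μ) (hΩs : ∀ x, SmoothAt Ω x)
    (hΩ : ∀ x, Ω x ≠ 0) {e : OpenPartialHomeomorph S Plane} (he : IsRectChart e)
    {η : Form Plane S 1} (hη : ∀ x, SmoothAt η x) (hs : tsupport η ⊆ e.source) :
    ∫ x, curl Ω η x ∂μ = 0 := by
  obtain ⟨s, -, hsd⟩ := abs_density_eq he hΩs hΩ
  have hcs : tsupport (curl Ω η) ⊆ tsupport η := by
    refine closure_minimal (fun x hx => by_contra fun h => hx ?_) (isClosed_tsupport η)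
    exact curl_eq_zero (extD_of_notMem_tsupport h)
  rw [hμ e he.1 _ (contMDiff_curl hΩs hΩ hη).continuous (hcs.trans hs), chartIntegral]
  have hcomp : HasCompactSupport η := HasCompactSupport.of_compactSpace η
  have hsm : ∀ y ∈ e.symm.source, ContMDiffAt 𝓘(ℝ, Plane) 𝓘(ℝ, Plane) ∞ e.symm y :=
    fun y hy => contMDiffAt_chart_symm he.1 hy
  set ζ : Form Plane Plane 1 := transport e.symm η with hζ
  have hζs : ContDiff ℝ ∞ ζ := contDiff_iff_contDiffAt.2 fun y =>
    smoothAt_self.1 (smoothAt_transport hsm hη hcomp hs y)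
  have hζc : HasCompactSupport ζ := hasCompactSupport_transport hcomp hs
  have hζt : tsupport ζ ⊆ e.target := tsupport_transport_subset (Φ := e.symm) hcomp hs
  have key : ∀ y ∈ e.target,
      curl Ω η (e.symm y) * |density Ω e y| = s * extDeriv ζ y frame := by
    intro y hy
    rw [hsd y hy, ← extD_self, extD_transport hsm hη hy]
    have := ratioForm_chart_symm he.1 (extD η) hΩ hy
    rw [← this]
    unfold curl
    ring
  rw [setIntegral_congr_fun e.open_target.measurableSet key,
    setIntegral_eq_integral_of_forall_compl_eq_zero, integral_const_mul,
    integral_extDeriv_eq_zero hζs hζc, mul_zero]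
  intro y hy
  rw [← extD_self, extD_of_notMem_tsupport fun h => hy (hζt h)]
  simp

theorem smoothAt_sum {ι : Type*} {η : ι → Form Plane S 1} {x : S} (hη : ∀ i, SmoothAt (η i) x)
    (s : Finset ι) : SmoothAt (∑ i ∈ s, η i) x := by
  classical
  induction s using Finset.induction_on with
  | empty => exact smoothAt_zero x
  | insert i s hi ih => rw [Finset.sum_insert hi]; exact (hη i).add ih

theorem curl_sum {ι : Type*} {η : ι → Form Plane S 1} {x : S} (hη : ∀ i, SmoothAt (η i) x)
    (s : Finset ι) : curl Ω (∑ i ∈ s, η i) x = ∑ i ∈ s, curl Ω (η i) x := by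
  classical
  induction s using Finset.induction_on with
  | empty =>
    refine curl_eq_zero ?_
    have h0 := extD_smul_apply (E := Plane) 0 (0 : Form Plane S 1) x
    rwa [zero_smul, zero_smul] at h0
  | insert i s hi ih =>
    rw [Finset.sum_insert hi, Finset.sum_insert hi, curl_add (hη i) (smoothAt_sum hη s), ih]

/-- Stokes' theorem on the closed surface. -/
theorem integral_curl_eq_zero (hμ : IsAreaMeasure Ω μ) (hΩs : ∀ x, SmoothAt Ω x)
    (hΩ : ∀ x, Ω x ≠ 0) {η : Form Plane S 1} (hη : ∀ x, SmoothAt η x) :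
    ∫ x, curl Ω η x ∂μ = 0 := by
  obtain ⟨t, e, ρ, he, hρ, hρ0, hρs, hρ1⟩ := exists_partition S
  have hsm : ∀ i x, SmoothAt (fsmul (ρ i) η) x := fun i x => SmoothAt.fsmul (hρ i x) (hη x)
  have hsum : η = ∑ i, fsmul (ρ i) η := by
    funext x
    simp only [Finset.sum_apply, fsmul_apply, ← Finset.sum_smul, hρ1, one_smul]
  have h1 : ∀ x, curl Ω η x = ∑ i, curl Ω (fsmul (ρ i) η) x := fun x => by
    conv_lhs => rw [hsum]
    exact curl_sum (fun i => hsm i x) _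
  simp_rw [h1]
  rw [integral_finsetSum _ fun i _ =>
    integrable_of_continuous (contMDiff_curl hΩs hΩ (hsm i)).continuous]
  refine Finset.sum_eq_zero fun i _ =>
    integral_curl_eq_zero_of_tsupport hμ hΩs hΩ (he i) (hsm i) ?_
  exact (tsupport_smul_subset_left (ρ i) η).trans (hρs i)

/-- Integration by parts. -/
theorem integral_brk_dfun (hμ : IsAreaMeasure Ω μ) (hΩs : ∀ x, SmoothAt Ω x)
    (hΩ : ∀ x, Ω x ≠ 0) {f : S → ℝ} (hf : ContMDiff 𝓘(ℝ, Plane) 𝓘(ℝ, ℝ) ∞ f)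
    {η : Form Plane S 1} (hη : ∀ x, SmoothAt η x) :
    ∫ x, brk Ω (dfun f) η x ∂μ = -∫ x, f x * curl Ω η x ∂μ := by
  have hfη : ∀ x, SmoothAt (fsmul f η) x := fun x => SmoothAt.fsmul (hf x) (hη x)
  have h := integral_curl_eq_zero hμ hΩs hΩ hfη
  have hdf : ∀ x, SmoothAt (dfun f : Form Plane S 1) x := fun x =>
    smoothAt_extD fun y => smoothAt_fun0.2 (hf y)
  have h1 : Continuous (brk Ω (dfun f) η) := ContMDiff.continuous (I := 𝓘(ℝ, Plane)) (n := ∞)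
    fun x => contMDiffAt_brk (hΩs x) hΩ (hdf x) (hη x)
  have h2 : Continuous fun x => f x * curl Ω η x :=
    hf.continuous.mul (contMDiff_curl hΩs hΩ hη).continuous
  simp_rw [fun x => curl_fsmul (Ω := Ω) (hf x) (hη x)] at h
  rw [integral_add (integrable_of_continuous h1) (integrable_of_continuous h2)] at h
  linarith

/-- A diffeomorphism preserving the area form preserves its measure. -/
theorem integral_comp_symp (hμ : IsAreaMeasure Ω μ) {φ : Diff Plane S}
    (hφ : pull (φ⁻¹ : Diff Plane S) Ω = Ω) {f : S → ℝ} (hf : Continuous f) :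
    ∫ x, f (φ x) ∂μ = ∫ x, f x ∂μ := by
  obtain ⟨t, e, ρ, he, hρ, hρ0, hρs, hρ1⟩ := exists_partition S
  have hφc : Continuous φ := φ.continuous
  have h1 : ∀ x, f x = ∑ i, ρ i x * f x := fun x => by rw [← Finset.sum_mul, hρ1, one_mul]
  rw [integral_congr_ae (Filter.Eventually.of_forall fun x => h1 (φ x)),
    integral_congr_ae (Filter.Eventually.of_forall h1)]
  have hc : ∀ i, Continuous fun x => ρ i x * f x := fun i => (hρ i).continuous.mul hf
  have hcφ : ∀ i, Continuous fun x => ρ i (φ x) * f (φ x) := fun i => (hc i).comp hφc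
  rw [integral_finsetSum _ fun i _ => integrable_of_continuous (hcφ i),
    integral_finsetSum _ fun i _ => integrable_of_continuous (hc i)]
  refine Finset.sum_congr rfl fun i _ => ?_
  have hs : tsupport (fun x => ρ i x * f x) ⊆ (e i).source :=
    (tsupport_mul_subset_left (f := ρ i) (g := f)).trans (hρs i)
  -- The chart composed with the diffeomorphism is again a chart, with the same image and density.
  set e' : OpenPartialHomeomorph S Plane :=
    φ.toHomeomorph.toOpenPartialHomeomorph.trans (e i) with he'
  have hsrc : e'.source = φ ⁻¹' (e i).source := by ext x; simp [he']
  have htgt : e'.target = (e i).target := by ext x; simp [he']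
  have hmem : e' ∈ MaxAtlas S := by
    refine (IsManifold.mem_maximalAtlas_iff_contMDiffOn _).2 ⟨?_, ?_⟩
    · intro x hx
      rw [hsrc] at hx
      exact ((contMDiffAt_chart (he i).1 hx).comp x (φ.contMDiff x)).contMDiffWithinAt
    · intro y hy
      rw [htgt] at hy
      exact ((φ.symm.contMDiff _).comp y (contMDiffAt_chart_symm (he i).1 hy)).contMDiffWithinAt
  have hs' : tsupport (fun x => ρ i (φ x) * f (φ x)) ⊆ e'.source := by
    rw [hsrc]
    exact (tsupport_comp_subset_preimage _ hφc).trans (Set.preimage_mono hs)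
  rw [hμ (e i) (he i).1 _ (hc i) hs, hμ e' hmem _ (hcφ i) hs', chartIntegral,
    chartIntegral, htgt]
  refine setIntegral_congr_fun (e i).open_target.measurableSet fun y hy => ?_
  have h2 : φ (e'.symm y) = (e i).symm y := φ.apply_symm_apply _
  have h3 : density Ω e' y = density Ω (e i) y := by
    have h4 := (contMDiffAt_chart_symm (he i).1 hy).mdifferentiableAt (by simp)
    have h5 := pull_comp_apply (g := (φ⁻¹ : Diff Plane S)) (f := (e i).symm) Ω
      (((φ⁻¹ : Diff Plane S).contMDiff _).mdifferentiableAt (by simp)) h4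
    rw [hφ] at h5
    rw [density, density, ← h5]
    rfl
  simp only [h2, h3]

theorem isOpenPosMeasure_of_isAreaMeasure (hμ : IsAreaMeasure Ω μ) (hΩs : ∀ x, SmoothAt Ω x)
    (hΩ : ∀ x, Ω x ≠ 0) : μ.IsOpenPosMeasure := by
  refine ⟨fun W hW ⟨x, hx⟩ h0 => ?_⟩
  obtain ⟨e, he, hxe, heW⟩ := exists_rectChart hW hx
  obtain ⟨f, hf1, hf2, hf3⟩ : ∃ f : C(S, ℝ), f x = 1 ∧ tsupport f ⊆ e.source ∧ ∀ z, 0 ≤ f z := by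
    obtain ⟨f, hft, hf1, hf⟩ := exists_tsupport_one_of_isOpen_isClosed e.open_source
      (isClosed_closure.isCompact) (isClosed_singleton (x := x)) (Set.singleton_subset_iff.2 hxe)
    exact ⟨f, hf1 rfl, hft, fun z => (hf z).1⟩
  have h1 : ∫ z, f z ∂μ = 0 := by
    rw [← setIntegral_eq_integral_of_forall_compl_eq_zero (s := W), Measure.restrict_eq_zero.2 h0,
      integral_zero_measure]
    intro z hz
    by_contra hz'
    exact hz (heW (hf2 (subset_tsupport _ hz')))
  rw [hμ e he.1 f f.continuous hf2, chartIntegral] at h1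
  have hI := integrableOn_chart he.1 hΩs f.continuous (HasCompactSupport.of_compactSpace _) hf2
  have hn : ∀ y, 0 ≤ f (e.symm y) * |density Ω e y| := fun y => mul_nonneg (hf3 _) (abs_nonneg _)
  have h2 := (setIntegral_eq_zero_iff_of_nonneg_ae (Filter.Eventually.of_forall hn) hI).1 h1
  have hco : ContinuousOn (fun y => f (e.symm y) * |density Ω e y|) e.target :=
    (f.continuous.comp_continuousOn e.continuousOn_symm).mul (continuousOn_density he.1 hΩs).abs
  have h3 := Measure.eqOn_open_of_ae_eq h2 e.open_target hco continuousOn_const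
    (e.map_source hxe)
  simp only [e.left_inv hxe, hf1, one_mul, Pi.zero_apply, abs_eq_zero] at h3
  exact density_ne_zero he.1 hΩ (e.map_source hxe) h3

/-- The fundamental lemma of the calculus of variations. -/
theorem eqOn_zero_of_integral_mul (hμ : IsAreaMeasure Ω μ) (hΩs : ∀ x, SmoothAt Ω x)
    (hΩ : ∀ x, Ω x ≠ 0) {g : S → ℝ} (hg : Continuous g) {W : Set S} (hW : IsOpen W)
    (h : ∀ τ : S → ℝ, ContMDiff 𝓘(ℝ, Plane) 𝓘(ℝ, ℝ) ∞ τ → tsupport τ ⊆ W → ∫ x, g x * τ x ∂μ = 0) :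
    Set.EqOn g 0 W := by
  have := isOpenPosMeasure_of_isAreaMeasure hμ hΩs hΩ
  have h1 := hW.ae_eq_zero_of_integral_contMDiff_smul_eq_zero (I := 𝓘(ℝ, Plane)) (μ := μ) (f := g)
    ((integrable_of_continuous hg).locallyIntegrable.locallyIntegrableOn W) fun τ hτ _ hs => by
      simpa [mul_comm] using h τ hτ hs
  refine Measure.eqOn_open_of_ae_eq (μ := μ) ?_ hW hg.continuousOn continuousOn_const
  rw [Filter.EventuallyEq, ae_restrict_iff' hW.measurableSet]
  exact h1

end Stokes

/-! ### Local primitives -/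

section Primitives

/-- The Poincaré lemma for `1`-forms on a convex open subset of the plane. -/
theorem exists_hasFDerivAt_of_extDeriv_eq_zero {B : Set Plane} (hB : Convex ℝ B) (hBo : IsOpen B)
    {α : Form Plane Plane 1} (hα : ∀ y ∈ B, ContDiffAt ℝ ∞ α y) (h : ∀ y ∈ B, extDeriv α y = 0) :
    ∃ f : Plane → ℝ, ∀ y ∈ B, HasFDerivAt f (cov (α y)) y := by
  have hc : ∀ y ∈ B, DifferentiableAt ℝ (fun z => cov (α z)) y := fun y hy =>
    (cov (V := Plane)).toContinuousLinearEquiv.differentiableAt.comp y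
      ((hα y hy).differentiableAt (by simp))
  refine hB.exists_forall_hasFDerivAt_of_fderiv_symmetric hBo
    (fun y hy => (hc y hy).differentiableWithinAt) fun y hy v w => ?_
  have h1 := congrArg (fun A => A ![v, w]) (h y hy)
  have h2 : ∀ u v : Plane, fderiv ℝ (fun z => cov (α z) u) y v =
      fderiv ℝ (fun z => cov (α z)) y v u := by
    intro u v
    rw [fderiv_clm_apply (hc y hy) (differentiableAt_const u)]
    simp
  simp only [extDeriv_apply ((hα y hy).differentiableAt (by simp)), apply_eq_cov,
    Fin.removeNth] at h1
  simp [h2] at h1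
  linarith

theorem contDiffAt_of_hasFDerivAt_cov {B : Set Plane} (hBo : IsOpen B) {α : Form Plane Plane 1}
    (hα : ∀ y ∈ B, ContDiffAt ℝ ∞ α y) {f : Plane → ℝ}
    (hf : ∀ y ∈ B, HasFDerivAt f (cov (α y)) y) {y : Plane} (hy : y ∈ B) : ContDiffAt ℝ ∞ f y := by
  refine ContDiffOn.contDiffAt ?_ (hBo.mem_nhds hy)
  refine (contDiffOn_infty_iff_fderiv_of_isOpen hBo).2
    ⟨fun z hz => (hf z hz).differentiableAt.differentiableWithinAt, ?_⟩
  refine ContDiffOn.congr (f := fun z => cov (α z)) (fun z hz => ?_) fun z hz => (hf z hz).fderiv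
  exact (cov.toContinuousLinearEquiv.contDiff.contDiffAt.comp z (hα z hz)).contDiffWithinAt

variable {S : Type*} [TopologicalSpace S] [ChartedSpace Plane S] [IsManifold 𝓘(ℝ, Plane) ∞ S]

theorem dfun_congr {f g : S → ℝ} {x : S} (h : f =ᶠ[𝓝 x] g) :
    (dfun f : Form Plane S 1) x = dfun g x :=
  extD_congr (by filter_upwards [h] with y hy; simp only [fun0, hy])

theorem dfun_add {f g : S → ℝ} {x : S} (hf : ContMDiffAt 𝓘(ℝ, Plane) 𝓘(ℝ, ℝ) ∞ f x)
    (hg : ContMDiffAt 𝓘(ℝ, Plane) 𝓘(ℝ, ℝ) ∞ g x) :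
    (dfun (fun y => f y + g y) : Form Plane S 1) x = dfun f x + dfun g x := by
  rw [← extD_add_apply (smoothAt_fun0.2 hf) (smoothAt_fun0.2 hg)]
  rfl

theorem dfun_smul (c : ℝ) (f : S → ℝ) (x : S) :
    (dfun (fun y => c * f y) : Form Plane S 1) x = c • dfun f x := by
  rw [← extD_smul_apply]
  rfl

theorem dfun_sub {f g : S → ℝ} {x : S} (hf : ContMDiffAt 𝓘(ℝ, Plane) 𝓘(ℝ, ℝ) ∞ f x)
    (hg : ContMDiffAt 𝓘(ℝ, Plane) 𝓘(ℝ, ℝ) ∞ g x) :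
    (dfun (fun y => f y - g y) : Form Plane S 1) x = dfun f x - dfun g x := by
  have h : ContMDiffAt 𝓘(ℝ, Plane) 𝓘(ℝ, ℝ) ∞ (fun y => (-1) * g y) x := contMDiffAt_const.mul hg
  have := dfun_add hf h
  rw [dfun_smul] at this
  rw [sub_eq_add_neg]
  have key : ∀ a : Plane [⋀^Fin 1]→L[ℝ] ℝ, (-1 : ℝ) • a = -a := fun a => neg_one_smul ℝ a
  refine (dfun_congr (Filter.Eventually.of_forall fun y => ?_)).trans
    (this.trans (congrArg _ (key _)))
  ring

theorem dfun_const (c : ℝ) (x : S) : (dfun (fun _ => c) : Form Plane S 1) x = 0 := by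
  refine cov.injective ?_
  have hd : MDifferentiableAt 𝓘(ℝ, Plane) 𝓘(ℝ, ℝ) (fun _ : S => c) x := mdifferentiableAt_const
  rw [cov_dfun hd, diffAt, mfderiv_const, map_zero]
  rfl

theorem dfun_sub_const {f : S → ℝ} {x : S} (hf : ContMDiffAt 𝓘(ℝ, Plane) 𝓘(ℝ, ℝ) ∞ f x) (c : ℝ) :
    (dfun (fun y => f y - c) : Form Plane S 1) x = dfun f x := by
  rw [dfun_sub hf contMDiffAt_const, dfun_const, sub_zero]

variable [T2Space S] [CompactSpace S]

theorem exists_cutoff {K O : Set S} (hK : IsClosed K) (hO : IsOpen O) (h : K ⊆ O) :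
    ∃ χ : S → ℝ, ContMDiff 𝓘(ℝ, Plane) 𝓘(ℝ, ℝ) ∞ χ ∧ tsupport χ ⊆ O ∧
      ∃ N, IsOpen N ∧ K ⊆ N ∧ ∀ x ∈ N, χ x = 1 := by
  obtain ⟨χ, h0, h1, -⟩ := exists_contMDiffMap_zero_one_nhds_of_isClosed 𝓘(ℝ, Plane) (n := ⊤)
    hO.isClosed_compl hK (Set.disjoint_left.2 fun x hx hx' => hx (h hx'))
  obtain ⟨N, hN, hKN, hN1⟩ := eventually_nhdsSet_iff_exists.1 h1
  obtain ⟨N', hN', hKN', hN0⟩ := eventually_nhdsSet_iff_exists.1 h0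
  refine ⟨χ, χ.contMDiff, ?_, N, hN, hKN, hN1⟩
  have : tsupport χ ⊆ N'ᶜ := closure_minimal (fun x hx hx' => hx (hN0 x hx')) hN'.isClosed_compl
  exact this.trans fun x hx => by_contra fun hx' => hx (hKN' hx')

/-- A closed form has a globally defined smooth primitive near a compact subset of a convex piece
of a chart. -/
theorem exists_primitive_near {e : OpenPartialHomeomorph S Plane} (he : e ∈ MaxAtlas S)
    {B : Set Plane} (hB : Convex ℝ B) (hBo : IsOpen B) (hBe : B ⊆ e.target) {σ : Form Plane S 1}
    (hσ : ∀ x ∈ e.symm '' B, SmoothAt σ x) (hσ0 : ∀ x ∈ e.symm '' B, extD σ x = 0)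
    {K : Set S} (hK : IsClosed K) (hKB : K ⊆ e.symm '' B) :
    ∃ f : S → ℝ, ContMDiff 𝓘(ℝ, Plane) 𝓘(ℝ, ℝ) ∞ f ∧ ∃ N, IsOpen N ∧ K ⊆ N ∧
      ∀ x ∈ N, dfun f x = σ x := by
  have hs : ∀ y ∈ B, SmoothAt σ (e.symm y) := fun y hy => hσ _ ⟨y, hy, rfl⟩
  have hsm : ∀ y ∈ B, ContDiffAt ℝ ∞ (pull e.symm σ) y := fun y hy =>
    contDiffAt_pull_symm he (hBe hy) (hs y hy)
  obtain ⟨g, hg⟩ := exists_hasFDerivAt_of_extDeriv_eq_zero hB hBo hsm fun y hy => by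
    rw [extDeriv_pull_symm he (hBe hy) (hs y hy), pull, hσ0 _ ⟨y, hy, rfl⟩]
    ext v; rfl
  have hgs : ∀ y ∈ B, ContDiffAt ℝ ∞ g y := fun y hy =>
    contDiffAt_of_hasFDerivAt_cov hBo hsm hg hy
  set O := e.symm '' B with hOdef
  have hO : IsOpen O := e.symm.isOpen_image_of_subset_source hBo hBe
  have hOe : ∀ x ∈ O, x ∈ e.source ∧ e x ∈ B := by
    rintro _ ⟨y, hy, rfl⟩
    exact ⟨e.map_target (hBe hy), by rwa [e.right_inv (hBe hy)]⟩
  have hge : ∀ x ∈ O, ContMDiffAt 𝓘(ℝ, Plane) 𝓘(ℝ, ℝ) ∞ (g ∘ e) x := fun x hx =>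
    (hgs _ (hOe x hx).2).contMDiffAt.comp x (contMDiffAt_chart he (hOe x hx).1)
  obtain ⟨χ, hχ, hχs, N, hN, hKN, hN1⟩ := exists_cutoff hK hO hKB
  refine ⟨fun x => χ x * (g ∘ e) x, fun x => ?_, N ∩ O, hN.inter hO, fun x hx => ⟨hKN hx, hKB hx⟩, ?_⟩
  · by_cases hx : x ∈ O
    · exact (hχ x).mul (hge x hx)
    · have h0 : χ =ᶠ[𝓝 x] 0 := notMem_tsupport_iff_eventuallyEq.1 fun h => hx (hχs h)
      refine (contMDiffAt_const (c := (0 : ℝ))).congr_of_eventuallyEq ?_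
      filter_upwards [h0] with y hy
      simp [hy]
  · rintro x ⟨hxN, hxO⟩
    have h1 : (fun x => χ x * (g ∘ e) x) =ᶠ[𝓝 x] g ∘ e := by
      filter_upwards [hN.mem_nhds hxN] with y hy
      rw [hN1 y hy, one_mul]
    rw [dfun_congr h1]
    have hxe := (hOe x hxO).1
    have h2 : dfun (g ∘ e) x = pull e (dfun g : Form Plane Plane 1) x := by
      rw [dfun, ← pull_fun0 (E := Plane) e g]
      exact extD_pull (smoothAt_fun0.2 (hgs _ (hOe x hxO).2).contMDiffAt) (contMDiffAt_chart he hxe)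
    have h3 : (dfun g : Form Plane Plane 1) (e x) = pull e.symm σ (e x) := by
      apply cov.injective
      have hd : MDifferentiableAt 𝓘(ℝ, Plane) 𝓘(ℝ, ℝ) g (e x) :=
        (hg _ (hOe x hxO).2).differentiableAt.mdifferentiableAt
      rw [cov_dfun hd, diffAt, mfderiv_eq_fderiv]
      exact (hg _ (hOe x hxO).2).fderiv
    rw [h2, ← pull_chart_pull_symm he σ hxe, pull, h3]
    rfl

/-- A closed form has a globally defined smooth primitive on a small chart around a point. -/
theorem exists_primitive_chart {W : Set S} (hW : IsOpen W) {σ : Form Plane S 1}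
    (hσ : ∀ x ∈ W, SmoothAt σ x) (hσ0 : ∀ x ∈ W, extD σ x = 0) {x : S} (hx : x ∈ W) :
    ∃ (e : OpenPartialHomeomorph S Plane) (f : S → ℝ), IsRectChart e ∧ x ∈ e.source ∧
      e.source ⊆ W ∧ ContMDiff 𝓘(ℝ, Plane) 𝓘(ℝ, ℝ) ∞ f ∧ ∀ z ∈ e.source, dfun f z = σ z := by
  obtain ⟨e, he, hxe, heW⟩ := exists_rectChart hW hx
  have hsub : e.symm '' e.target ⊆ W := by
    rw [e.symm_image_target_eq_source]
    exact heW
  have hconv : Convex ℝ e.target := by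
    obtain ⟨-, a, b, c, d, -, -, ht⟩ := he
    exact ht ▸ convex_rect a b c d
  obtain ⟨f, hf, N, hN, hxN, hfN⟩ := exists_primitive_near he.1 hconv e.open_target subset_rfl
    (fun z hz => hσ z (hsub hz)) (fun z hz => hσ0 z (hsub hz)) (isClosed_singleton (x := x))
    (by rw [e.symm_image_target_eq_source]; simpa using hxe)
  obtain ⟨e', he', hxe', heN⟩ := exists_rectChart (hN.inter hW) ⟨hxN rfl, hx⟩
  exact ⟨e', f, he', hxe', heN.trans Set.inter_subset_right, hf, fun z hz => hfN z (heN hz).1⟩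

end Primitives

/-! ### Poincaré duality -/

section Duality

open MeasureTheory

variable {S : Type*} [TopologicalSpace S] [ChartedSpace Plane S] [IsManifold 𝓘(ℝ, Plane) ∞ S]
  [T2Space S] [CompactSpace S] [MeasurableSpace S] [BorelSpace S]
  {Ω : Form Plane S 2} {μ : Measure S} [IsFiniteMeasure μ]

/-- A function with vanishing integral and support in a rectangular chart is the curl of a form
supported there. -/
theorem exists_curl_eq (hμ : IsAreaMeasure Ω μ) (hΩs : ∀ x, SmoothAt Ω x) (hΩ : ∀ x, Ω x ≠ 0)
    {e : OpenPartialHomeomorph S Plane} (he : IsRectChart e) {τ : S → ℝ}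
    (hτ : ContMDiff 𝓘(ℝ, Plane) 𝓘(ℝ, ℝ) ∞ τ) (hs : tsupport τ ⊆ e.source)
    (hint : ∫ x, τ x ∂μ = 0) :
    ∃ η : Form Plane S 1, (∀ x, SmoothAt η x) ∧ tsupport η ⊆ e.source ∧
      ∀ x, curl Ω η x = τ x := by
  obtain ⟨s, hs0, hsd⟩ := abs_density_eq he hΩs hΩ
  obtain ⟨he, a, b, c, d, hab, hcd, ht⟩ := he
  set A : Form Plane S 2 := fsmul τ Ω
  have hA : ∀ x, SmoothAt A x := fun x => SmoothAt.fsmul (hτ x) (hΩs x)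
  have hAs : tsupport A ⊆ e.source := (tsupport_smul_subset_left τ Ω).trans hs
  have hAc : HasCompactSupport A := HasCompactSupport.of_compactSpace A
  have hsm : ∀ y ∈ e.symm.source, ContMDiffAt 𝓘(ℝ, Plane) 𝓘(ℝ, Plane) ∞ e.symm y :=
    fun y hy => contMDiffAt_chart_symm he hy
  set B : Form Plane Plane 2 := transport e.symm A with hB
  have hBs : ContDiff ℝ ∞ B := contDiff_iff_contDiffAt.2 fun y =>
    smoothAt_self.1 (smoothAt_transport hsm hA hAc hAs y)
  have hBc : HasCompactSupport B := hasCompactSupport_transport hAc hAs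
  have hBt : tsupport B ⊆ e.target := tsupport_transport_subset (Φ := e.symm) hAc hAs
  have hu : ContDiff ℝ ∞ fun y => B y frame :=
    (ContinuousAlternatingMap.apply ℝ Plane ℝ frame).contDiff.comp hBs
  have hut : tsupport (fun y => B y frame) ⊆ tsupport B :=
    closure_minimal (fun y hy => by_contra fun h => hy (by
      change B y frame = 0
      rw [image_eq_zero_of_notMem_tsupport h]; rfl)) (isClosed_tsupport B)
  have hBint : ∫ y, B y frame = 0 := by
    rw [hμ e he τ hτ.continuous hs, chartIntegral] at hint
    have key : ∀ y ∈ e.target, τ (e.symm y) * |density Ω e y| = s * B y frame := by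
      intro y hy
      rw [hsd y hy, hB, transport_of_mem (Φ := e.symm) A hy]
      change _ = s * (τ (e.symm y) * density Ω e y)
      ring
    rw [setIntegral_congr_fun e.open_target.measurableSet key,
      setIntegral_eq_integral_of_forall_compl_eq_zero, integral_const_mul] at hint
    · exact (mul_eq_zero.1 hint).resolve_left hs0
    · intro y hy
      rw [image_eq_zero_of_notMem_tsupport fun h => hy (hBt h)]
      simp
  obtain ⟨ζ, hζ, hζc, hζt, hζB⟩ := exists_extDeriv_eq hab hcd hu
    (hBc.of_isClosed_subset (isClosed_tsupport _) hut) (hut.trans (ht ▸ hBt)) hBint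
  rw [← ht] at hζt
  have hζs : ∀ y, SmoothAt ζ y := fun y => smoothAt_self.2 hζ.contDiffAt
  have hsm' : ∀ y ∈ e.source, ContMDiffAt 𝓘(ℝ, Plane) 𝓘(ℝ, Plane) ∞ e y :=
    fun y hy => contMDiffAt_chart he hy
  have hsub := tsupport_transport_subset (Φ := e) hζc hζt
  refine ⟨transport e ζ, smoothAt_transport hsm' hζs hζc hζt, hsub, fun x => ?_⟩
  by_cases hx : x ∈ e.source
  · have h1 : extD ζ = B := by
      rw [extD_self]
      exact funext fun y => twoForm_ext (hζB y)
    have h2 : extD (transport e ζ) x = τ x • Ω x := by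
      rw [extD_transport hsm' hζs hx, h1]
      have h3 : pull e B x = pull e (pull e.symm A) x := by
        rw [pull, pull, hB, transport_of_mem (Φ := e.symm) A (e.map_source hx)]
      exact h3.trans (pull_chart_pull_symm he A hx)
    exact (congrArg (fun C => ratio C (Ω x)) h2).trans (ratio_smul _ (hΩ x))
  · rw [curl_eq_zero (extD_of_notMem_tsupport fun h => hx (hsub h)),
      image_eq_zero_of_notMem_tsupport fun h => hx (hs h)]

/-- The product with a form supported in an open set only needs smoothness there. -/
theorem contMDiff_brk_of_tsupport (hΩs : ∀ x, SmoothAt Ω x) (hΩ : ∀ x, Ω x ≠ 0) {W : Set S}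
    {σ η : Form Plane S 1} (hσ : ∀ x ∈ W, SmoothAt σ x) (hη : ∀ x, SmoothAt η x)
    (hs : tsupport η ⊆ W) : ContMDiff 𝓘(ℝ, Plane) 𝓘(ℝ, ℝ) ∞ (brk Ω σ η) := by
  intro x
  by_cases hx : x ∈ W
  · exact contMDiffAt_brk (hΩs x) hΩ (hσ x hx) (hη x)
  · refine (contMDiffAt_const (c := (0 : ℝ))).congr_of_eventuallyEq ?_
    filter_upwards [notMem_tsupport_iff_eventuallyEq.1 fun h => hx (hs h)] with y hy
    exact brk_eq_zero_right Ω hy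

/-- Smooth `1`-forms with support in `W`. -/
def supportedForms (W : Set S) : Submodule ℝ (Form Plane S 1) where
  carrier := {η | (∀ x, SmoothAt η x) ∧ tsupport η ⊆ W}
  add_mem' hα hβ := ⟨fun x => (hα.1 x).add (hβ.1 x),
    (tsupport_add _ _).trans (Set.union_subset hα.2 hβ.2)⟩
  zero_mem' := ⟨smoothAt_zero, by simp [tsupport]⟩
  smul_mem' c α hα := ⟨fun x => (hα.1 x).smul c,
    (closure_mono (Function.support_const_smul_subset c α)).trans hα.2⟩

/-- A shortcut for instance search. -/
noncomputable instance instAddCommGroupSupportedForms (W : Set S) :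
    AddCommGroup (supportedForms W) :=
  Submodule.addCommGroup _

theorem exists_comp_eq_of_ker_le {V W : Type*} [AddCommGroup V] [Module ℝ V] [AddCommGroup W]
    [Module ℝ W] (L : V →ₗ[ℝ] W) (P : V →ₗ[ℝ] ℝ) (h : ∀ v, L v = 0 → P v = 0) :
    ∃ F : W →ₗ[ℝ] ℝ, ∀ v, F (L v) = P v := by
  have hP : P ∈ LinearMap.range L.dualMap := by
    rw [LinearMap.range_dualMap_eq_dualAnnihilator_ker, Submodule.mem_dualAnnihilator]
    exact h
  obtain ⟨F, hF⟩ := hP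
  exact ⟨F, LinearMap.congr_fun hF⟩

/-- If a form pairs to zero with the closed forms supported in `W`, its pairing with the forms
supported in `W` factors through their curl. -/
theorem exists_functional (hΩs : ∀ x, SmoothAt Ω x) (hΩ : ∀ x, Ω x ≠ 0) {W : Set S}
    {σ : Form Plane S 1} (hσ : ∀ x ∈ W, SmoothAt σ x)
    (h : ∀ β : Form Plane S 1, (∀ x, SmoothAt β x) → (∀ x, extD β x = 0) → tsupport β ⊆ W →
      ∫ x, brk Ω σ β x ∂μ = 0) :
    ∃ F : (S → ℝ) →ₗ[ℝ] ℝ, ∀ η : Form Plane S 1, (∀ x, SmoothAt η x) → tsupport η ⊆ W →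
      F (curl Ω η) = ∫ x, brk Ω σ η x ∂μ := by
  let L : supportedForms W →ₗ[ℝ] (S → ℝ) :=
    { toFun := fun η => curl Ω η.1
      map_add' := fun α β => funext fun x => curl_add (α.2.1 x) (β.2.1 x)
      map_smul' := fun c α => funext fun x => by
        simp only [curl, ratioForm, Submodule.coe_smul, extD_smul_apply]
        exact ratio_smul_left _ _ _ }
  have hc : ∀ η : supportedForms W, Integrable (brk Ω σ η.1) μ := fun η =>
    integrable_of_continuous (contMDiff_brk_of_tsupport hΩs hΩ hσ η.2.1 η.2.2).continuous
  let P : supportedForms W →ₗ[ℝ] ℝ :=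
    { toFun := fun η => ∫ x, brk Ω σ η.1 x ∂μ
      map_add' := fun α β => by
        rw [← integral_add (hc α) (hc β)]
        exact integral_congr_ae (Filter.Eventually.of_forall fun x => brk_add_right Ω _ _ _ x)
      map_smul' := fun c α => by
        rw [RingHom.id_apply, smul_eq_mul, ← integral_const_mul]
        exact integral_congr_ae (Filter.Eventually.of_forall fun x => brk_smul_right Ω _ _ _ x) }
  obtain ⟨F, hF⟩ := exists_comp_eq_of_ker_le (V := supportedForms W) (W := S → ℝ) L P fun η hη => by
    refine h η.1 η.2.1 (fun x => extD_eq_zero_of_curl hΩ ?_) η.2.2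
    exact congrFun hη x
  exact ⟨F, fun η hη hs => hF ⟨η, hη, hs⟩⟩

/-- Poincaré duality: a closed form on an open subset `W` that pairs to zero with all closed forms
supported in `W` is exact on `W`. -/
theorem exists_primitive_of_pairing (hμ : IsAreaMeasure Ω μ) (hΩs : ∀ x, SmoothAt Ω x)
    (hΩ : ∀ x, Ω x ≠ 0) {W : Set S} (hW : IsOpen W) {σ : Form Plane S 1}
    (hσ : ∀ x ∈ W, SmoothAt σ x) (hσ0 : ∀ x ∈ W, extD σ x = 0)
    (h : ∀ β : Form Plane S 1, (∀ x, SmoothAt β x) → (∀ x, extD β x = 0) → tsupport β ⊆ W →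
      ∫ x, brk Ω σ β x ∂μ = 0) :
    ∃ g : S → ℝ, ∀ x ∈ W, ContMDiffAt 𝓘(ℝ, Plane) 𝓘(ℝ, ℝ) ∞ g x ∧ dfun g x = σ x := by
  obtain ⟨F, hF⟩ := exists_functional (μ := μ) hΩs hΩ hσ h
  have hI : ∀ {f g : S → ℝ}, Continuous f → Continuous g → Integrable (fun x => f x * g x) μ :=
    fun hf hg => integrable_of_continuous (hf.mul hg)
  -- On each small chart the functional is integration against the negative of a primitive, which
  -- is thereby normalized.
  have hloc : ∀ x ∈ W, ∃ (e : OpenPartialHomeomorph S Plane) (f : S → ℝ), x ∈ e.source ∧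
      ContMDiff 𝓘(ℝ, Plane) 𝓘(ℝ, ℝ) ∞ f ∧ (∀ z ∈ e.source, dfun f z = σ z) ∧
      ∀ τ : S → ℝ, ContMDiff 𝓘(ℝ, Plane) 𝓘(ℝ, ℝ) ∞ τ → tsupport τ ⊆ e.source →
        F τ = -∫ z, f z * τ z ∂μ := by
    intro x hx
    obtain ⟨e, f, he, hxe, heW, hf, hfσ⟩ := exists_primitive_chart hW hσ hσ0 hx
    have h0 : ∀ τ : S → ℝ, ContMDiff 𝓘(ℝ, Plane) 𝓘(ℝ, ℝ) ∞ τ → tsupport τ ⊆ e.source →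
        ∫ z, τ z ∂μ = 0 → F τ = -∫ z, f z * τ z ∂μ := by
      intro τ hτ hs hint
      obtain ⟨η, hη, hηs, hητ⟩ := exists_curl_eq hμ hΩs hΩ he hτ hs hint
      have h1 := hF η hη (hηs.trans heW)
      have h2 := integral_brk_dfun hμ hΩs hΩ hf hη
      rw [funext hητ] at h1
      simp only [hητ] at h2
      rw [h1, ← h2]
      refine integral_congr_ae (Filter.Eventually.of_forall fun z => ?_)
      by_cases hz : z ∈ e.source
      · exact brk_congr Ω (hfσ z hz).symm rfl
      · have h3 : η z = 0 := image_eq_zero_of_notMem_tsupport fun h' => hz (hηs h')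
        simp only [brk_eq_zero_right Ω h3]
    by_cases hex : ∃ τ₀ : S → ℝ, ContMDiff 𝓘(ℝ, Plane) 𝓘(ℝ, ℝ) ∞ τ₀ ∧ tsupport τ₀ ⊆ e.source ∧
        ∫ z, τ₀ z ∂μ ≠ 0
    · obtain ⟨τ₀, hτ₀, hs₀, hne⟩ := hex
      set c := (F τ₀ + ∫ z, f z * τ₀ z ∂μ) / ∫ z, τ₀ z ∂μ with hc
      refine ⟨e, fun z => f z - c, hxe, hf.sub contMDiff_const, fun z hz => ?_, fun τ hτ hs => ?_⟩
      · exact (dfun_sub_const (hf z) c).trans (hfσ z hz)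
      · set r := (∫ z, τ z ∂μ) / ∫ z, τ₀ z ∂μ with hr
        have hr' : (∫ z, τ z ∂μ) = r * ∫ z, τ₀ z ∂μ := (div_mul_cancel₀ _ hne).symm
        have hc' : c * ∫ z, τ₀ z ∂μ = F τ₀ + ∫ z, f z * τ₀ z ∂μ := div_mul_cancel₀ _ hne
        have h1 := h0 (τ - r • τ₀) (hτ.sub ((contMDiff_const (c := r)).mul hτ₀)) (by
          refine (tsupport_sub _ _).trans (Set.union_subset hs ?_)
          exact (closure_mono (Function.support_const_smul_subset r τ₀)).trans hs₀) (by
          simp only [Pi.sub_apply, Pi.smul_apply, smul_eq_mul]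
          rw [integral_sub (integrable_of_continuous hτ.continuous)
            ((integrable_of_continuous hτ₀.continuous).const_mul r), integral_const_mul, hr',
            sub_self])
        have h2 : ∫ z, f z * (τ - r • τ₀) z ∂μ = ∫ z, f z * τ z ∂μ - r * ∫ z, f z * τ₀ z ∂μ := by
          rw [← integral_const_mul, ← integral_sub (hI hf.continuous hτ.continuous)
            ((hI hf.continuous hτ₀.continuous).const_mul r)]
          refine integral_congr_ae (Filter.Eventually.of_forall fun z => ?_)
          simp only [Pi.sub_apply, Pi.smul_apply, smul_eq_mul]
          ring
        have h3 : ∫ z, (f z - c) * τ z ∂μ = ∫ z, f z * τ z ∂μ - c * ∫ z, τ z ∂μ := by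
          rw [← integral_const_mul, ← integral_sub (hI hf.continuous hτ.continuous)
            ((integrable_of_continuous hτ.continuous).const_mul c)]
          refine integral_congr_ae (Filter.Eventually.of_forall fun z => ?_)
          simp only
          ring
        rw [map_sub, map_smul, smul_eq_mul, h2] at h1
        rw [h3, hr']
        linear_combination h1 - r * hc'
    · push Not at hex
      exact ⟨e, f, hxe, hf, hfσ, fun τ hτ hs => h0 τ hτ hs (hex τ hτ hs)⟩
  rcases W.eq_empty_or_nonempty with rfl | ⟨x₀, -⟩
  · exact ⟨0, by simp⟩
  have : Nonempty (OpenPartialHomeomorph S Plane) := ⟨chartAt Plane x₀⟩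
  choose! e f hxe hf hfσ hFf using hloc
  have hglue : ∀ x ∈ W, ∀ y ∈ W, ∀ z, z ∈ (e x).source → z ∈ (e y).source → f x z = f y z := by
    intro x hx y hy z hz hz'
    have := eqOn_zero_of_integral_mul hμ hΩs hΩ (g := fun z => f x z - f y z)
      ((hf x hx).continuous.sub (hf y hy).continuous)
      ((e x).open_source.inter (e y).open_source) (fun τ hτ hs => by
        have h1 := hFf x hx τ hτ (hs.trans Set.inter_subset_left)
        have h2 := hFf y hy τ hτ (hs.trans Set.inter_subset_right)
        simp only [sub_mul]
        rw [integral_sub (hI (hf x hx).continuous hτ.continuous)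
          (hI (hf y hy).continuous hτ.continuous)]
        linarith) ⟨hz, hz'⟩
    exact sub_eq_zero.1 this
  refine ⟨fun x => f x x, fun x hx => ?_⟩
  have hev : (fun y => f y y) =ᶠ[𝓝 x] f x := by
    filter_upwards [(e x).open_source.mem_nhds (hxe x hx), hW.mem_nhds hx] with y hy hyW
    exact (hglue x hx y hyW y hy (hxe y hyW)).symm
  exact ⟨(hf x hx x).congr_of_eventuallyEq hev, (dfun_congr hev).trans (hfσ x hx x (hxe x hx))⟩

end Duality

/-! ### Time-dependent functions on a surface -/

section TimeDependent

open MeasureTheory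

variable {S : Type} [TopologicalSpace S] [ChartedSpace Plane S] [IsManifold 𝓘(ℝ, Plane) ∞ S]
  {e : OpenPartialHomeomorph S Plane}

/-- Smooth functions of time and a point of the surface. -/
abbrev TimeSmooth (G : ℝ × S → ℝ) : Prop :=
  ContMDiff (𝓘(ℝ, ℝ).prod 𝓘(ℝ, Plane)) 𝓘(ℝ, ℝ) ∞ G

theorem contDiffAt_timeCoord (he : e ∈ MaxAtlas S) {G : ℝ × S → ℝ} {t : ℝ} {y : Plane}
    (hy : y ∈ e.target)
    (hG : ContMDiffAt (𝓘(ℝ, ℝ).prod 𝓘(ℝ, Plane)) 𝓘(ℝ, ℝ) ∞ G (t, e.symm y)) :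
    ContDiffAt ℝ ∞ (fun q : ℝ × Plane => G (q.1, e.symm q.2)) (t, y) := by
  have h1 : ContMDiffAt 𝓘(ℝ, ℝ × Plane) 𝓘(ℝ, ℝ) ∞ (fun q : ℝ × Plane => q.1) (t, y) :=
    contDiff_fst.contMDiff _
  have h2 : ContMDiffAt 𝓘(ℝ, ℝ × Plane) 𝓘(ℝ, Plane) ∞ (fun q : ℝ × Plane => q.2) (t, y) :=
    contDiff_snd.contMDiff _
  have h3 : ContMDiffAt 𝓘(ℝ, ℝ × Plane) 𝓘(ℝ, Plane) ∞ (fun q : ℝ × Plane => e.symm q.2) (t, y) :=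
    (contMDiffAt_chart_symm he hy).comp (t, y) h2
  exact (hG.comp (t, y) (h1.prodMk h3)).contDiffAt

theorem contMDiffAt_of_timeCoord (he : e ∈ MaxAtlas S) {G : ℝ × S → ℝ} {t : ℝ} {x : S}
    (hx : x ∈ e.source) {κ : ℝ × Plane → ℝ} (hκ : ContDiffAt ℝ ∞ κ (t, e x))
    (h : ∀ s, ∀ z ∈ e.source, G (s, z) = κ (s, e z)) :
    ContMDiffAt (𝓘(ℝ, ℝ).prod 𝓘(ℝ, Plane)) 𝓘(ℝ, ℝ) ∞ G (t, x) := by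
  have h2 : ContMDiffAt (𝓘(ℝ, ℝ).prod 𝓘(ℝ, Plane)) 𝓘(ℝ, Plane) ∞ (fun q : ℝ × S => e q.2) (t, x) :=
    (contMDiffAt_chart he hx).comp (t, x) contMDiffAt_snd
  have h3 : ContMDiffAt (𝓘(ℝ, ℝ).prod 𝓘(ℝ, Plane)) 𝓘(ℝ, ℝ × Plane) ∞
      (fun q : ℝ × S => (q.1, e q.2)) (t, x) := contMDiffAt_fst.prodMk_space h2
  have h4 : ContMDiffAt 𝓘(ℝ, ℝ × Plane) 𝓘(ℝ, ℝ) ∞ κ (t, e x) := hκ.contMDiffAt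
  refine (h4.comp (t, x) h3).congr_of_eventuallyEq ?_
  filter_upwards [continuous_snd.continuousAt.preimage_mem_nhds (e.open_source.mem_nhds hx)]
    with q hq using h q.1 q.2 hq

theorem contDiff_slice {G : ℝ × S → ℝ} (hG : TimeSmooth G) (x : S) :
    ContDiff ℝ ∞ fun s => G (s, x) := by
  have h : ContMDiff 𝓘(ℝ, ℝ) (𝓘(ℝ, ℝ).prod 𝓘(ℝ, Plane)) ∞ fun s : ℝ => (s, x) :=
    contMDiff_id.prodMk contMDiff_const
  exact (hG.comp h).contDiff

theorem contMDiff_slice {G : ℝ × S → ℝ} (hG : TimeSmooth G) (t : ℝ) :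
    ContMDiff 𝓘(ℝ, Plane) 𝓘(ℝ, ℝ) ∞ fun x => G (t, x) :=
  hG.comp (contMDiff_const.prodMk contMDiff_id)

theorem timeSmooth_of_space {f : S → ℝ} (hf : ContMDiff 𝓘(ℝ, Plane) 𝓘(ℝ, ℝ) ∞ f) :
    TimeSmooth fun p : ℝ × S => f p.2 :=
  hf.comp contMDiff_snd

/-- The time derivative. -/
noncomputable def timeDeriv (G : ℝ × S → ℝ) (p : ℝ × S) : ℝ := deriv (fun s => G (s, p.2)) p.1

theorem timeSmooth_timeDeriv {G : ℝ × S → ℝ} (hG : TimeSmooth G) : TimeSmooth (timeDeriv G) := by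
  rintro ⟨t, x⟩
  have he : chartAt Plane x ∈ MaxAtlas S := IsManifold.chart_mem_maximalAtlas x
  set e := chartAt Plane x
  have hx : x ∈ e.source := mem_chart_source Plane x
  set H : ℝ × Plane → ℝ := fun q => G (q.1, e.symm q.2) with hH
  have hHs : ∀ s, ∀ y ∈ e.target, ContDiffAt ℝ ∞ H (s, y) := fun s y hy =>
    contDiffAt_timeCoord he hy (hG _)
  refine contMDiffAt_of_timeCoord he hx (κ := fun q => fderiv ℝ H q ((1 : ℝ), (0 : Plane))) ?_ ?_
  · exact ((hHs t _ (e.map_source hx)).fderiv_right (m := ∞) (by simp)).clm_apply contDiffAt_const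
  · intro s z hz
    have h1 : HasDerivAt (fun r : ℝ => (r, e z)) ((1 : ℝ), (0 : Plane)) s :=
      (hasDerivAt_id s).prodMk (hasDerivAt_const s (e z))
    have h2 := ((hHs s _ (e.map_source hz)).differentiableAt (by simp)).hasFDerivAt.comp_hasDerivAt
      s h1
    have h3 : H ∘ (fun r : ℝ => (r, e z)) = fun r => G (r, z) := by
      funext r
      simp only [hH, Function.comp_apply, e.left_inv hz]
    rw [h3] at h2
    exact h2.deriv

theorem timeSmooth_primitive {k : ℝ × S → ℝ} (hk : TimeSmooth k) :
    TimeSmooth fun p => ∫ u in (0 : ℝ)..p.1, k (u, p.2) := by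
  rintro ⟨t, x⟩
  have he : chartAt Plane x ∈ MaxAtlas S := IsManifold.chart_mem_maximalAtlas x
  set e := chartAt Plane x
  have hx : x ∈ e.source := mem_chart_source Plane x
  set f : (ℝ × Plane) × ℝ → ℝ := fun q => k (q.1.1 * q.2, e.symm q.1.2) with hf
  have hW : IsOpen ((Set.univ : Set ℝ) ×ˢ e.target) := isOpen_univ.prod e.open_target
  have hfs : ContDiffOn ℝ ∞ f (((Set.univ : Set ℝ) ×ˢ e.target) ×ˢ Set.univ) := by
    rintro ⟨⟨s, y⟩, u⟩ ⟨⟨-, hy⟩, -⟩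
    have h1 := contDiffAt_timeCoord he (t := s * u) hy (hk _)
    have h2 : ContDiffAt ℝ ∞ (fun q : (ℝ × Plane) × ℝ => (q.1.1 * q.2, q.1.2)) ((s, y), u) := by
      fun_prop
    exact (h1.comp ((s, y), u) h2).contDiffWithinAt
  have h := (contDiffOn_integral_param hW hfs 0 1).contDiffAt
    (hW.mem_nhds (show (t, e x) ∈ _ from ⟨trivial, e.map_source hx⟩))
  refine contMDiffAt_of_timeCoord he hx (κ := fun q => q.1 * ∫ u in (0 : ℝ)..1, f (q, u))
    (contDiffAt_fst.mul h) ?_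
  intro s z hz
  simp only [hf, e.left_inv hz]
  have := intervalIntegral.mul_integral_comp_mul_left (f := fun u => k (u, z)) (a := 0) (b := 1) s
  rw [this]
  simp

theorem hasDerivAt_primitive {k : ℝ × S → ℝ} (hk : TimeSmooth k) (x : S) (t : ℝ) :
    HasDerivAt (fun s => ∫ u in (0 : ℝ)..s, k (u, x)) (k (t, x)) t := by
  have hc : Continuous fun u => k (u, x) := (contDiff_slice hk x).continuous
  exact intervalIntegral.integral_hasDerivAt_right (hc.intervalIntegrable _ _)
    (hc.stronglyMeasurableAtFilter _ _) hc.continuousAt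

/-- In a chart, the product of a differential with a form. -/
theorem brk_dfun_chart {Ω : Form Plane S 2} (he : e ∈ MaxAtlas S) (hΩ : ∀ x, Ω x ≠ 0) {f : S → ℝ}
    (hf : ContMDiff 𝓘(ℝ, Plane) 𝓘(ℝ, ℝ) ∞ f) (η : Form Plane S 1) {y : Plane} (hy : y ∈ e.target) :
    brk Ω (dfun f) η (e.symm y) = (fderiv ℝ (f ∘ e.symm) y (frame 0) *
      cov (pull e.symm η y) (frame 1) - fderiv ℝ (f ∘ e.symm) y (frame 1) *
      cov (pull e.symm η y) (frame 0)) / density Ω e y := by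
  have h := ratioForm_chart_symm he (wedgeForm (dfun f) η) hΩ hy
  have hs : ContMDiffAt 𝓘(ℝ, Plane) 𝓘(ℝ, ℝ) ∞ (f ∘ e.symm) y :=
    (hf _).comp y (contMDiffAt_chart_symm he hy)
  have h1 : pull e.symm (dfun f) y = (dfun (f ∘ e.symm) : Form Plane Plane 1) y :=
    (extD_pull (smoothAt_fun0.2 (hf _)) (contMDiffAt_chart_symm he hy)).symm
  have h2 : cov (pull e.symm (dfun f) y) = fderiv ℝ (f ∘ e.symm) y := by
    have := cov_dfun (hs.mdifferentiableAt (by simp))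
    rw [diffAt, mfderiv_eq_fderiv] at this
    rw [← this]
    exact congrArg cov h1
  rw [eq_div_iff (density_ne_zero he hΩ hy)]
  refine Eq.trans h ?_
  rw [pull_wedgeForm, wedgeForm, wedge_apply, h2]

theorem timeSmooth_brk_dfun {Ω : Form Plane S 2} (hΩs : ∀ x, SmoothAt Ω x) (hΩ : ∀ x, Ω x ≠ 0)
    {K : ℝ × S → ℝ} (hK : TimeSmooth K) {η : Form Plane S 1} (hη : ∀ x, SmoothAt η x) :
    TimeSmooth fun p => brk Ω (dfun fun x => K (p.1, x)) η p.2 := by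
  rintro ⟨t, x⟩
  have he : chartAt Plane x ∈ MaxAtlas S := IsManifold.chart_mem_maximalAtlas x
  set e := chartAt Plane x
  have hx : x ∈ e.source := mem_chart_source Plane x
  set H : ℝ × Plane → ℝ := fun q => K (q.1, e.symm q.2) with hH
  have hHs : ∀ s, ∀ y ∈ e.target, ContDiffAt ℝ ∞ H (s, y) := fun s y hy =>
    contDiffAt_timeCoord he hy (hK _)
  have hy := e.map_source hx
  have hd : ∀ i, ContDiffAt ℝ ∞ (fun q => fderiv ℝ H q ((0 : ℝ), frame i)) (t, e x) := fun i =>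
    ((hHs t _ hy).fderiv_right (m := ∞) (by simp)).clm_apply contDiffAt_const
  have hηs : ∀ i, ContDiffAt ℝ ∞ (fun q : ℝ × Plane => cov (pull e.symm η q.2) (frame i))
      (t, e x) := by
    intro i
    have h1 : ContDiffAt ℝ ∞ (fun y => cov (pull e.symm η y) (frame i)) (e x) :=
      (cov.toContinuousLinearEquiv.contDiff.contDiffAt.comp _
        (contDiffAt_pull_symm he hy (hη _))).clm_apply contDiffAt_const
    exact h1.comp (t, e x) contDiffAt_snd
  have hds : ContDiffAt ℝ ∞ (fun q : ℝ × Plane => density Ω e q.2) (t, e x) :=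
    (contDiffAt_density he hy (hΩs _)).comp (t, e x) contDiffAt_snd
  refine contMDiffAt_of_timeCoord he hx (κ := fun q =>
    (fderiv ℝ H q ((0 : ℝ), frame 0) * cov (pull e.symm η q.2) (frame 1) -
      fderiv ℝ H q ((0 : ℝ), frame 1) * cov (pull e.symm η q.2) (frame 0)) / density Ω e q.2)
    ((((hd 0).mul (hηs 1)).sub ((hd 1).mul (hηs 0))).div hds (density_ne_zero he hΩ hy)) ?_
  intro s z hz
  have hz' := e.map_source hz
  have h1 := brk_dfun_chart he hΩ (contMDiff_slice hK s) η hz'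
  have h2 : ∀ v, fderiv ℝ ((fun x => K (s, x)) ∘ e.symm) (e z) v =
      fderiv ℝ H (s, e z) ((0 : ℝ), v) := by
    intro v
    have h3 : HasFDerivAt (fun w : Plane => (s, w)) (ContinuousLinearMap.inr ℝ ℝ Plane) (e z) :=
      hasFDerivAt_prodMk_right s (e z)
    have h4 := ((hHs s _ hz').differentiableAt (by simp)).hasFDerivAt.comp (e z) h3
    have h5 : H ∘ (fun w : Plane => (s, w)) = (fun x => K (s, x)) ∘ e.symm := rfl
    rw [← h5, h4.fderiv]
    rfl
  rw [e.left_inv hz, h2, h2] at h1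
  exact h1

variable [CompactSpace S] [MeasurableSpace S] [BorelSpace S] [T2Space S]
  {μ : Measure S} [IsFiniteMeasure μ]

/-- Differentiation under the integral sign. -/
theorem hasDerivAt_integral_timeSmooth {G : ℝ × S → ℝ} (hG : TimeSmooth G) (t : ℝ) :
    HasDerivAt (fun s => ∫ x, G (s, x) ∂μ) (∫ x, timeDeriv G (t, x) ∂μ) t := by
  have hG' := timeSmooth_timeDeriv hG
  obtain ⟨C, hC⟩ := ((isCompact_closedBall t 1).prod (isCompact_univ (X := S))).exists_bound_of_continuousOn
    hG'.continuous.continuousOn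
  have hc : ∀ s, Continuous fun x => G (s, x) := fun s => (contMDiff_slice hG s).continuous
  have hc' : ∀ s, Continuous fun x => timeDeriv G (s, x) := fun s =>
    (contMDiff_slice hG' s).continuous
  refine (hasDerivAt_integral_of_dominated_loc_of_deriv_le (F := fun s x => G (s, x))
    (F' := fun s x => timeDeriv G (s, x)) (bound := fun _ => C)
    (Metric.closedBall_mem_nhds t one_pos) ?_ ?_ ?_ ?_ ?_ ?_).2
  · exact Filter.Eventually.of_forall fun s =>
      (integrable_of_continuous (hc s)).aestronglyMeasurable
  · exact integrable_of_continuous (hc t)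
  · exact (integrable_of_continuous (hc' t)).aestronglyMeasurable
  · exact Filter.Eventually.of_forall fun x s hs => hC (s, x) ⟨hs, trivial⟩
  · exact integrable_const C
  · exact Filter.Eventually.of_forall fun x s _ =>
      ((contDiff_slice hG x).differentiable (by simp) s).hasDerivAt

end TimeDependent

/-! ### A conserved triple integral -/

section Conserved

open MeasureTheory

variable {S : Type} [TopologicalSpace S] [ChartedSpace Plane S] [IsManifold 𝓘(ℝ, Plane) ∞ S]
  {Ω : Form Plane S 2}

theorem smoothAt_dfun {f : S → ℝ} (hf : ContMDiff 𝓘(ℝ, Plane) 𝓘(ℝ, ℝ) ∞ f) (x : S) :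
    SmoothAt (dfun f : Form Plane S 1) x :=
  smoothAt_extD fun y => smoothAt_fun0.2 (hf y)

theorem continuous_brk (hΩs : ∀ x, SmoothAt Ω x) (hΩ : ∀ x, Ω x ≠ 0) {α β : Form Plane S 1}
    (hα : ∀ x, SmoothAt α x) (hβ : ∀ x, SmoothAt β x) : Continuous (brk Ω α β) :=
  ContMDiff.continuous (I := 𝓘(ℝ, Plane)) (n := ∞) fun x => contMDiffAt_brk (hΩs x) hΩ (hα x) (hβ x)

theorem brk_dfun_mul {f g : S → ℝ} (hf : ContMDiff 𝓘(ℝ, Plane) 𝓘(ℝ, ℝ) ∞ f)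
    (hg : ContMDiff 𝓘(ℝ, Plane) 𝓘(ℝ, ℝ) ∞ g) {η : Form Plane S 1} (hη : ∀ x, SmoothAt η x) (x : S) :
    brk Ω (dfun fun y => f y * g y) η x = f x * brk Ω (dfun g) η x + g x * brk Ω (dfun f) η x := by
  have h1 := curl_fsmul (Ω := Ω) (hf.mul hg x) (hη x)
  have h2 := curl_fsmul (Ω := Ω) (hf x) (SmoothAt.fsmul (hg x) (hη x))
  have h3 := curl_fsmul (Ω := Ω) (hg x) (hη x)
  have h4 : fsmul f (fsmul g η) = fsmul (f * g) η := by
    funext y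
    simp only [fsmul, smul_smul, Pi.mul_apply]
  have h5 : brk Ω (dfun f) (fsmul g η) x = g x * brk Ω (dfun f) η x := by
    rw [← brk_smul_right]
    exact brk_congr Ω rfl rfl
  rw [h4, h1, h3, h5] at h2
  simp only [Pi.mul_apply] at h2
  change brk Ω (dfun (f * g)) η x = _
  linarith

theorem extD_dfun {f : S → ℝ} (hf : ContMDiff 𝓘(ℝ, Plane) 𝓘(ℝ, ℝ) ∞ f) (x : S) :
    extD (dfun f : Form Plane S 1) x = 0 := by
  have h : ∀ y, SmoothAt (fun0 f : Form Plane S 0) y := fun y => smoothAt_fun0.2 (hf y)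
  have hx := mem_extChartAt_source (I := 𝓘(ℝ, Plane)) x
  have he : chartAt Plane x ∈ MaxAtlas S := IsManifold.chart_mem_maximalAtlas x
  set e := chartAt Plane x
  have hxe : x ∈ e.source := mem_chart_source Plane x
  have hy := e.map_source hxe
  have h1 : pull e.symm (dfun f) =ᶠ[𝓝 (e x)] extDeriv (pull e.symm (fun0 f : Form Plane S 0)) := by
    filter_upwards [e.open_target.mem_nhds hy] with y hy
    exact (extDeriv_pull_symm he hy (h _)).symm
  have h2 : extDeriv (pull e.symm (dfun f)) (e x) = 0 := by
    rw [h1.extDeriv_eq]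
    have h3 := contDiffAt_pull_symm he hy (h (e.symm (e x)))
    exact extDeriv_extDeriv_apply h3
      (by rw [minSmoothness_of_isRCLikeNormedField]; exact WithTop.coe_le_coe.2 le_top)
  rw [extDeriv_pull_symm he hy (smoothAt_dfun hf _)] at h2
  by_contra h0
  have h4 := pull_symm_ne_zero he hy (α := extD (dfun f : Form Plane S 1))
    (by rw [e.left_inv hxe]; exact h0)
  exact h4 h2

/-- The form `α + dA_t`. -/
noncomputable def shifted (α : Form Plane S 1) (A : ℝ × S → ℝ) (t : ℝ) : Form Plane S 1 :=
  α + dfun fun x => A (t, x)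

theorem smoothAt_shifted {α : Form Plane S 1} (hα : ∀ x, SmoothAt α x) {A : ℝ × S → ℝ}
    (hA : TimeSmooth A) (t : ℝ) (x : S) : SmoothAt (shifted α A t) x :=
  (hα x).add (smoothAt_dfun (contMDiff_slice hA t) x)

theorem extD_shifted {α : Form Plane S 1} (hα : ∀ x, SmoothAt α x) (hα0 : ∀ x, extD α x = 0)
    {A : ℝ × S → ℝ} (hA : TimeSmooth A) (t : ℝ) (x : S) : extD (shifted α A t) x = 0 := by
  have h := smoothAt_dfun (contMDiff_slice hA t) x
  refine (extD_add_apply (hα x) h).trans ?_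
  rw [hα0, extD_dfun (contMDiff_slice hA t)]
  exact add_zero _

variable [CompactSpace S] [T2Space S] [MeasurableSpace S] [BorelSpace S]
  {μ : Measure S} [IsFiniteMeasure μ]

theorem integral_brk_dfun_of_closed (hμ : IsAreaMeasure Ω μ) (hΩs : ∀ x, SmoothAt Ω x)
    (hΩ : ∀ x, Ω x ≠ 0) {f : S → ℝ} (hf : ContMDiff 𝓘(ℝ, Plane) 𝓘(ℝ, ℝ) ∞ f)
    {η : Form Plane S 1} (hη : ∀ x, SmoothAt η x) (hη0 : ∀ x, extD η x = 0) :
    ∫ x, brk Ω (dfun f) η x ∂μ = 0 := by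
  rw [integral_brk_dfun hμ hΩs hΩ hf hη]
  simp [fun x => curl_eq_zero (Ω := Ω) (hη0 x)]

/-- Integration by parts for a product of functions against a closed form. -/
theorem integral_mul_brk_dfun (hμ : IsAreaMeasure Ω μ) (hΩs : ∀ x, SmoothAt Ω x)
    (hΩ : ∀ x, Ω x ≠ 0) {f g : S → ℝ} (hf : ContMDiff 𝓘(ℝ, Plane) 𝓘(ℝ, ℝ) ∞ f)
    (hg : ContMDiff 𝓘(ℝ, Plane) 𝓘(ℝ, ℝ) ∞ g)
    {η : Form Plane S 1} (hη : ∀ x, SmoothAt η x) (hη0 : ∀ x, extD η x = 0) :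
    ∫ x, (f x * brk Ω (dfun g) η x + g x * brk Ω (dfun f) η x) ∂μ = 0 := by
  rw [← integral_brk_dfun_of_closed hμ hΩs hΩ (hf.mul hg) hη hη0]
  exact integral_congr_ae (Filter.Eventually.of_forall fun x => (brk_dfun_mul hf hg hη x).symm)

/-- The conserved quantity of the flow: if `A`, `B`, `C` evolve so that the cyclic sum of
`Ȧ (β_t ∧ γ_t)` vanishes, where `α_t = α + dA_t` and so on, then the integral of
`A β_t ∧ γ_t + B γ_t ∧ α + C α ∧ β` is constant. -/
theorem integral_cyclic_eq (hμ : IsAreaMeasure Ω μ) (hΩs : ∀ x, SmoothAt Ω x) (hΩ : ∀ x, Ω x ≠ 0)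
    {α β γ : Form Plane S 1} (hα : ∀ x, SmoothAt α x) (hα0 : ∀ x, extD α x = 0)
    (hβ : ∀ x, SmoothAt β x) (hβ0 : ∀ x, extD β x = 0)
    (hγ : ∀ x, SmoothAt γ x) (hγ0 : ∀ x, extD γ x = 0) {A B C : ℝ × S → ℝ}
    (hA : TimeSmooth A) (hB : TimeSmooth B) (hC : TimeSmooth C)
    (hQ : TimeSmooth fun p => brk Ω (shifted β B p.1) (shifted γ C p.1) p.2)
    (hcyc : ∀ t x, timeDeriv A (t, x) * brk Ω (shifted β B t) (shifted γ C t) x +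
      timeDeriv B (t, x) * brk Ω (shifted γ C t) (shifted α A t) x +
      timeDeriv C (t, x) * brk Ω (shifted α A t) (shifted β B t) x = 0) (t s : ℝ) :
    ∫ x, (A (t, x) * brk Ω (shifted β B t) (shifted γ C t) x +
      B (t, x) * brk Ω (shifted γ C t) α x + C (t, x) * brk Ω α β x) ∂μ =
    ∫ x, (A (s, x) * brk Ω (shifted β B s) (shifted γ C s) x +
      B (s, x) * brk Ω (shifted γ C s) α x + C (s, x) * brk Ω α β x) ∂μ := by
  have hcs : ∀ {G : ℝ × S → ℝ}, TimeSmooth G → ∀ t, Continuous fun x => G (t, x) := fun hG t =>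
    (contMDiff_slice hG t).continuous
  have hsh : ∀ {η : Form Plane S 1}, (∀ x, SmoothAt η x) →
      TimeSmooth fun p => brk Ω (shifted γ C p.1) η p.2 := by
    intro η hη
    have h : (fun p : ℝ × S => brk Ω (shifted γ C p.1) η p.2) = fun p =>
        brk Ω γ η p.2 + brk Ω (dfun fun x => C (p.1, x)) η p.2 :=
      funext fun p => brk_add_left Ω _ _ _ _
    rw [h]
    exact (timeSmooth_of_space fun x => contMDiffAt_brk (hΩs x) hΩ (hγ x) (hη x)).add
      (timeSmooth_brk_dfun hΩs hΩ hC hη)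
  have hsp : ∀ {f : S → ℝ}, ContMDiff 𝓘(ℝ, Plane) 𝓘(ℝ, ℝ) ∞ f → TimeSmooth fun p : ℝ × S => f p.2 :=
    fun hf => timeSmooth_of_space hf
  set T : ℝ × S → ℝ := fun p => A p * brk Ω (shifted β B p.1) (shifted γ C p.1) p.2 +
    B p * brk Ω (shifted γ C p.1) α p.2 + C p * brk Ω α β p.2 with hTdef
  have hT : TimeSmooth T := ((hA.mul hQ).add (hB.mul (hsh hα))).add
    (hC.mul (hsp fun x => contMDiffAt_brk (hΩs x) hΩ (hα x) (hβ x)))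
  have hder : ∀ t, HasDerivAt (fun s => ∫ x, T (s, x) ∂μ) 0 t := by
    intro t
    have hαt := smoothAt_shifted hα hA t
    have hβt := smoothAt_shifted hβ hB t
    -- The increment of the integrand, up to terms whose integrals vanish after integrating by parts.
    -- It is of first order in `s - t`, with coefficient zero by the cyclic hypothesis.
    set R : ℝ × S → ℝ := fun p =>
      (A p - A (t, p.2)) * brk Ω (shifted β B p.1) (shifted γ C p.1) p.2 +
      (B p - B (t, p.2)) * brk Ω (shifted γ C p.1) (shifted α A t) p.2 +
      (C p - C (t, p.2)) * brk Ω (shifted α A t) (shifted β B t) p.2 with hRdef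
    have hR : TimeSmooth R :=
      (((hA.sub (hsp (contMDiff_slice hA t))).mul hQ).add
        ((hB.sub (hsp (contMDiff_slice hB t))).mul (hsh hαt))).add
        ((hC.sub (hsp (contMDiff_slice hC t))).mul
          (hsp fun x => contMDiffAt_brk (hΩs x) hΩ (hαt x) (hβt x)))
    have hR0 : ∀ x, timeDeriv R (t, x) = 0 := by
      intro x
      have hmul : ∀ {K L : ℝ × S → ℝ}, TimeSmooth K → TimeSmooth L →
          HasDerivAt (fun s => (K (s, x) - K (t, x)) * L (s, x)) (timeDeriv K (t, x) * L (t, x)) t := by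
        intro K L hK hL
        have h1 : HasDerivAt (fun s => K (s, x)) (timeDeriv K (t, x)) t :=
          ((contDiff_slice hK x).differentiable (by simp) t).hasDerivAt
        have h2 : HasDerivAt (fun s => L (s, x)) (timeDeriv L (t, x)) t :=
          ((contDiff_slice hL x).differentiable (by simp) t).hasDerivAt
        have h3 := (h1.sub_const (K (t, x))).fun_mul h2
        simpa only [sub_self, zero_mul, add_zero] using h3
      have h := ((hmul hA hQ).add (hmul hB (hsh hαt))).add
        (hmul hC (hsp fun x => contMDiffAt_brk (hΩs x) hΩ (hαt x) (hβt x)))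
      exact h.deriv.trans (hcyc t x)
    have hRd := hasDerivAt_integral_timeSmooth (μ := μ) hR t
    simp only [hR0, integral_zero] at hRd
    have hincr : ∀ s, ∫ x, T (s, x) ∂μ = ∫ x, T (t, x) ∂μ + ∫ x, R (s, x) ∂μ := by
      intro s
      have hΔB := (contMDiff_slice hB s).sub (contMDiff_slice hB t)
      have hΔC := (contMDiff_slice hC s).sub (contMDiff_slice hC t)
      have hγs := smoothAt_shifted hγ hC s
      have i1 := integral_mul_brk_dfun hμ hΩs hΩ (contMDiff_slice hA t) hΔB hγs
        (extD_shifted hγ hγ0 hC s)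
      have i2 := integral_mul_brk_dfun hμ hΩs hΩ (contMDiff_slice hA t) hΔC hβt
        (extD_shifted hβ hβ0 hB t)
      have i3 := integral_mul_brk_dfun hμ hΩs hΩ (contMDiff_slice hB t) hΔC hα hα0
      have hI : ∀ {f g : S → ℝ} {η : Form Plane S 1}, ContMDiff 𝓘(ℝ, Plane) 𝓘(ℝ, ℝ) ∞ f →
          ContMDiff 𝓘(ℝ, Plane) 𝓘(ℝ, ℝ) ∞ g → (∀ x, SmoothAt η x) →
          Integrable (fun x => f x * brk Ω (dfun g) η x + g x * brk Ω (dfun f) η x) μ :=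
        fun hf hg hη => integrable_of_continuous
          ((hf.continuous.mul (continuous_brk hΩs hΩ (smoothAt_dfun hg) hη)).add
            (hg.continuous.mul (continuous_brk hΩs hΩ (smoothAt_dfun hf) hη)))
      have hTR : Continuous fun x => T (t, x) + R (s, x) := (hcs hT t).add (hcs hR s)
      rw [← integral_add (integrable_of_continuous (hcs hT t)) (integrable_of_continuous (hcs hR s)),
        ← sub_eq_zero, ← integral_sub (integrable_of_continuous (hcs hT s))
          (integrable_of_continuous hTR)]
      have i4 := integral_sub (hI (contMDiff_slice hA t) hΔB hγs) (hI (contMDiff_slice hA t) hΔC hβt)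
      have i5 := integral_add ((hI (contMDiff_slice hA t) hΔB hγs).sub
        (hI (contMDiff_slice hA t) hΔC hβt)) (hI (contMDiff_slice hB t) hΔC hα)
      simp only [Pi.sub_apply] at i5 i4 i1 i2 i3
      rw [i4, i1, i2, i3] at i5
      rw [sub_zero, add_zero] at i5
      rw [← i5]
      refine integral_congr_ae (Filter.Eventually.of_forall fun x => ?_)
      have dB : (dfun (fun x => B (s, x) - B (t, x)) : Form Plane S 1) x =
          ((dfun fun x => B (s, x)) - (dfun fun x => B (t, x)) : Form Plane S 1) x :=
        dfun_sub (contMDiff_slice hB s x) (contMDiff_slice hB t x)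
      have dC : (dfun (fun x => C (s, x) - C (t, x)) : Form Plane S 1) x =
          ((dfun fun x => C (s, x)) - (dfun fun x => C (t, x)) : Form Plane S 1) x :=
        dfun_sub (contMDiff_slice hC s x) (contMDiff_slice hC t x)
      have eB : ∀ η, brk Ω (dfun (fun x => B (s, x) - B (t, x))) η x =
          brk Ω (dfun fun x => B (s, x)) η x - brk Ω (dfun fun x => B (t, x)) η x := fun η => by
        rw [← brk_sub_left]
        exact brk_congr Ω dB rfl
      have eC : ∀ η, brk Ω (dfun (fun x => C (s, x) - C (t, x))) η x =
          brk Ω (dfun fun x => C (s, x)) η x - brk Ω (dfun fun x => C (t, x)) η x := fun η => by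
        rw [← brk_sub_left]
        exact brk_congr Ω dC rfl
      have hl : ∀ (η : Form Plane S 1) (K : ℝ × S → ℝ) (r : ℝ) (ζ : Form Plane S 1),
          brk Ω (shifted η K r) ζ x = brk Ω η ζ x + brk Ω (dfun fun x => K (r, x)) ζ x :=
        fun η K r ζ => brk_add_left Ω _ _ _ _
      have hr : ∀ (η : Form Plane S 1) (K : ℝ × S → ℝ) (r : ℝ) (ζ : Form Plane S 1),
          brk Ω ζ (shifted η K r) x = brk Ω ζ η x + brk Ω ζ (dfun fun x => K (r, x)) x :=
        fun η K r ζ => brk_add_right Ω _ _ _ _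
      simp only [hTdef, hRdef, hl, hr, eB, eC]
      rw [brk_swap Ω β (dfun fun x => C (t, x)), brk_swap Ω β (dfun fun x => C (s, x)),
        brk_swap Ω γ (dfun fun x => A (t, x)), brk_swap Ω (dfun fun x => C (s, x)) (dfun fun x => A (t, x)),
        brk_swap Ω (dfun fun x => C (t, x)) (dfun fun x => B (t, x)),
        brk_swap Ω (dfun fun x => C (s, x)) (dfun fun x => B (t, x)),
        brk_swap Ω α (dfun fun x => B (t, x))]
      ring
    rw [funext hincr]
    simpa using hRd.const_add (∫ x, T (t, x) ∂μ)
  exact is_const_of_deriv_eq_zero (fun r => (hder r).differentiableAt) (fun r => (hder r).deriv) t s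

end Conserved

/-! ### Closed forms along an isotopy -/

section Isotopies

open MeasureTheory

variable {S : Type} [TopologicalSpace S] [ChartedSpace Plane S] [IsManifold 𝓘(ℝ, Plane) ∞ S]
  {Ω : Omega Plane S 2} {Φ : ℝ → Diff Plane S}

/-- The velocity of the trajectory of `x` under an isotopy. -/
noncomputable def trackVel (Φ : ℝ → Diff Plane S) (t : ℝ) (x : S) : Plane :=
  mfderiv 𝓘(ℝ, ℝ) 𝓘(ℝ, Plane) (fun s : ℝ => Φ s x) t (1 : ℝ)

theorem velocity_eq (t : ℝ) (x : S) : velocity Φ t x = trackVel Φ t ((Φ t)⁻¹ x) := rfl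

/-- The value of `α` on the velocity of the isotopy, as a function of time and the initial point. -/
noncomputable def trackRate (α : Form Plane S 1) (Φ : ℝ → Diff Plane S) (p : ℝ × S) : ℝ :=
  cov (α (Φ p.1 p.2)) (trackVel Φ p.1 p.2)

/-- The integral of `α` along the trajectory of `x` up to time `t`. -/
noncomputable def trackInt (α : Form Plane S 1) (Φ : ℝ → Diff Plane S) (p : ℝ × S) : ℝ :=
  ∫ u in (0 : ℝ)..p.1, trackRate α Φ (u, p.2)

theorem contMDiff_track (hΦ : IsSympIsotopy Ω Φ) (x : S) :
    ContMDiff 𝓘(ℝ, ℝ) 𝓘(ℝ, Plane) ∞ fun s => Φ s x :=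
  hΦ.smooth.comp (contMDiff_id.prodMk contMDiff_const)

theorem timeSmooth_comp (hΦ : IsSympIsotopy Ω Φ) {f : S → ℝ}
    (hf : ContMDiff 𝓘(ℝ, Plane) 𝓘(ℝ, ℝ) ∞ f) : TimeSmooth fun p => f (Φ p.1 p.2) :=
  hf.comp hΦ.smooth

theorem trackRate_dfun (hΦ : IsSympIsotopy Ω Φ) {f : S → ℝ}
    (hf : ContMDiff 𝓘(ℝ, Plane) 𝓘(ℝ, ℝ) ∞ f) (p : ℝ × S) :
    trackRate (dfun f) Φ p = timeDeriv (fun p => f (Φ p.1 p.2)) p := by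
  have h1 : MDifferentiableAt 𝓘(ℝ, Plane) 𝓘(ℝ, ℝ) f (Φ p.1 p.2) := (hf _).mdifferentiableAt (by simp)
  have h2 : MDifferentiableAt 𝓘(ℝ, ℝ) 𝓘(ℝ, Plane) (fun s => Φ s p.2) p.1 :=
    (contMDiff_track hΦ p.2 _).mdifferentiableAt (by simp)
  have h3 := mfderiv_comp p.1 h1 h2
  rw [trackRate, cov_dfun h1, timeDeriv, ← fderiv_apply_one_eq_deriv, ← mfderiv_eq_fderiv]
  exact (congrArg (fun L : ℝ →L[ℝ] ℝ => L 1) h3).symm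

variable [T2Space S] [CompactSpace S]

theorem exists_local_primitive {α : Form Plane S 1} (hα : ∀ x, SmoothAt α x)
    (hα0 : ∀ x, extD α x = 0) (x : S) : ∃ f : S → ℝ, ContMDiff 𝓘(ℝ, Plane) 𝓘(ℝ, ℝ) ∞ f ∧
      ∃ N, IsOpen N ∧ x ∈ N ∧ ∀ z ∈ N, dfun f z = α z := by
  obtain ⟨e, f, -, hx, -, hf, hfα⟩ := exists_primitive_chart isOpen_univ (fun z _ => hα z)
    (fun z _ => hα0 z) (Set.mem_univ x)
  exact ⟨f, hf, e.source, e.open_source, hx, hfα⟩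

theorem trackRate_eq_of_primitive (hΦ : IsSympIsotopy Ω Φ) {α : Form Plane S 1} {f : S → ℝ}
    (hf : ContMDiff 𝓘(ℝ, Plane) 𝓘(ℝ, ℝ) ∞ f) {p : ℝ × S}
    (h : dfun f (Φ p.1 p.2) = α (Φ p.1 p.2)) :
    trackRate α Φ p = timeDeriv (fun p => f (Φ p.1 p.2)) p := by
  rw [← trackRate_dfun hΦ hf, trackRate, trackRate, h]

theorem timeSmooth_trackRate (hΦ : IsSympIsotopy Ω Φ) {α : Form Plane S 1}
    (hα : ∀ x, SmoothAt α x) (hα0 : ∀ x, extD α x = 0) : TimeSmooth (trackRate α Φ) := by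
  intro p
  obtain ⟨f, hf, N, hN, hx, hfN⟩ := exists_local_primitive hα hα0 (Φ p.1 p.2)
  refine (timeSmooth_timeDeriv (timeSmooth_comp hΦ hf) p).congr_of_eventuallyEq ?_
  filter_upwards [hΦ.smooth.continuous.continuousAt.preimage_mem_nhds (hN.mem_nhds hx)] with q hq
  exact trackRate_eq_of_primitive hΦ hf (hfN _ hq)

theorem timeSmooth_trackInt (hΦ : IsSympIsotopy Ω Φ) {α : Form Plane S 1}
    (hα : ∀ x, SmoothAt α x) (hα0 : ∀ x, extD α x = 0) : TimeSmooth (trackInt α Φ) :=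
  timeSmooth_primitive (timeSmooth_trackRate hΦ hα hα0)

theorem timeDeriv_trackInt (hΦ : IsSympIsotopy Ω Φ) {α : Form Plane S 1}
    (hα : ∀ x, SmoothAt α x) (hα0 : ∀ x, extD α x = 0) (p : ℝ × S) :
    timeDeriv (trackInt α Φ) p = trackRate α Φ p :=
  (hasDerivAt_primitive (timeSmooth_trackRate hΦ hα hα0) p.2 p.1).deriv

theorem trackInt_zero (α : Form Plane S 1) (x : S) : trackInt α Φ (0, x) = 0 :=
  intervalIntegral.integral_same

theorem pull_dfun {φ : S → S} (hφ : ContMDiff 𝓘(ℝ, Plane) 𝓘(ℝ, Plane) ∞ φ) {f : S → ℝ}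
    (hf : ContMDiff 𝓘(ℝ, Plane) 𝓘(ℝ, ℝ) ∞ f) (x : S) :
    pull φ (dfun f : Form Plane S 1) x = dfun (f ∘ φ) x :=
  (extD_pull (smoothAt_fun0.2 (hf (φ x))) (hφ x)).symm

/-- The homotopy formula: the integrals along trajectories are primitives of `Φ_t^* α - α`. -/
theorem dfun_trackInt (hΦ : IsSympIsotopy Ω Φ) {α : Form Plane S 1}
    (hα : ∀ x, SmoothAt α x) (hα0 : ∀ x, extD α x = 0) (t : ℝ) (x : S) :
    dfun (fun z => trackInt α Φ (t, z)) x = pull (Φ t) α x - α x := by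
  have hF := timeSmooth_trackInt hΦ hα hα0
  have hk := timeSmooth_trackRate hΦ hα hα0
  set D : ℝ → Plane [⋀^Fin 1]→L[ℝ] ℝ := fun t =>
    dfun (fun z => trackInt α Φ (t, z)) x - pull (Φ t) α x with hD
  -- In a primitive `f` of `α` near `Φ_t₀ x`, the increment of the integral is that of `f ∘ Φ_t`.
  have hloc : IsLocallyConstant D := by
    rw [IsLocallyConstant.iff_eventually_eq]
    intro t₀
    obtain ⟨f, hf, N, hN, hx, hfN⟩ := exists_local_primitive hα hα0 (Φ t₀ x)
    have hnh : {p : ℝ × S | Φ p.1 p.2 ∈ N} ∈ 𝓝 (t₀, x) :=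
      hΦ.smooth.continuous.continuousAt.preimage_mem_nhds (hN.mem_nhds hx)
    rw [nhds_prod_eq, Filter.mem_prod_iff] at hnh
    obtain ⟨J, hJ, O, hO, hJO⟩ := hnh
    obtain ⟨ε, hε, hεJ⟩ := Metric.mem_nhds_iff.1 hJ
    filter_upwards [Metric.ball_mem_nhds t₀ hε] with t ht
    have hseg : ∀ u ∈ Set.uIcc t₀ t, u ∈ J := fun u hu => hεJ
      ((convex_ball t₀ ε).ordConnected.uIcc_subset (Metric.mem_ball_self hε) ht hu)
    have hinc : ∀ z ∈ O, trackInt α Φ (t, z) - trackInt α Φ (t₀, z) = f (Φ t z) - f (Φ t₀ z) := by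
      intro z hz
      have hc : Continuous fun u => trackRate α Φ (u, z) := (contDiff_slice hk z).continuous
      have hg := contDiff_slice (timeSmooth_comp hΦ hf) z
      rw [trackInt, trackInt, intervalIntegral.integral_interval_sub_left
        (hc.intervalIntegrable _ _) (hc.intervalIntegrable _ _)]
      refine intervalIntegral.integral_eq_sub_of_hasDerivAt (f := fun u => f (Φ u z))
        (fun u hu => ?_) (hc.intervalIntegrable _ _)
      rw [trackRate_eq_of_primitive hΦ hf (p := (u, z)) (hfN _ (hJO (Set.mk_mem_prod (hseg u hu) hz)))]
      exact (hg.differentiable (by simp) u).hasDerivAt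
    have hcomp : ∀ r, ContMDiff 𝓘(ℝ, Plane) 𝓘(ℝ, ℝ) ∞ (f ∘ Φ r) := fun r =>
      hf.comp (Φ r).contMDiff
    have h1 : (dfun (fun z => trackInt α Φ (t, z) - trackInt α Φ (t₀, z)) : Form Plane S 1) x =
        (dfun (fun z => (f ∘ Φ t) z - (f ∘ Φ t₀) z) : Form Plane S 1) x := by
      apply dfun_congr
      filter_upwards [hO] with z hz using hinc z hz
    rw [dfun_sub (contMDiff_slice hF t x) (contMDiff_slice hF t₀ x),
      dfun_sub (hcomp t x) (hcomp t₀ x), ← pull_dfun (Φ t).contMDiff hf,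
      ← pull_dfun (Φ t₀).contMDiff hf] at h1
    have h2 : ∀ r ∈ J, pull (Φ r) (dfun f : Form Plane S 1) x = pull (Φ r) α x := fun r hr => by
      have : (dfun f : Form Plane S 1) (Φ r x) = α (Φ r x) := hfN _ (hJO (Set.mk_mem_prod hr (mem_of_mem_nhds hO)))
      simp only [pull, this]
    rw [h2 t (hεJ ht), h2 t₀ (mem_of_mem_nhds hJ)] at h1
    simp only [hD]
    rw [sub_eq_sub_iff_add_eq_add] at h1 ⊢
    rw [h1]
    exact add_comm _ _
  have h := hloc.apply_eq_of_preconnectedSpace t 0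
  simp only [hD, trackInt_zero, hΦ.zero] at h
  have h0 : (dfun (fun _ => (0 : ℝ)) : Form Plane S 1) x = 0 := dfun_const 0 x
  have h1 : pull ((1 : Diff Plane S) : S → S) α x = α x := congrFun (pull_id α) x
  rw [h1] at h
  have h2 := h.trans (congrArg (· - α x) h0)
  rw [sub_eq_iff_eq_add] at h2
  rw [h2]
  abel

theorem pull_eq_shifted (hΦ : IsSympIsotopy Ω Φ) {α : Form Plane S 1}
    (hα : ∀ x, SmoothAt α x) (hα0 : ∀ x, extD α x = 0) (t : ℝ) :
    pull (Φ t) α = shifted α (trackInt α Φ) t := by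
  funext x
  rw [shifted]
  refine Eq.trans ?_ (congrArg (α x + ·) (dfun_trackInt hΦ hα hα0 t x)).symm
  abel

theorem brk_pull_symp {φ : Diff Plane S} (hφ : φ ∈ Symp Ω) (hΩ : ∀ x, Ω.1 x ≠ 0)
    (α β : Form Plane S 1) (x : S) :
    brk Ω.1 (pull φ α) (pull φ β) x = brk Ω.1 α β (φ x) :=
  brk_pull (congrFun (congrArg Subtype.val hφ) x) (hΩ x) α β

variable [MeasurableSpace S] [BorelSpace S] {μ : Measure S} [IsFiniteMeasure μ]

/-- The cyclic identity between the path integrals of three closed forms over a symplectic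
isotopy. The path integrals `A` satisfy `Ȧ = α(X)`, with `X` the velocity, and the cyclic sum of
`α(X) β ∧ γ` is the contraction of a `3`-form with `X`, hence zero on a surface. -/
theorem integral_trackInt_cyclic (hμ : IsAreaMeasure Ω.1 μ) (hΩ : ∀ x, Ω.1 x ≠ 0)
    (hΦ : IsSympIsotopy Ω Φ) {α β γ : Form Plane S 1} (hα : ∀ x, SmoothAt α x)
    (hα0 : ∀ x, extD α x = 0) (hβ : ∀ x, SmoothAt β x) (hβ0 : ∀ x, extD β x = 0)
    (hγ : ∀ x, SmoothAt γ x) (hγ0 : ∀ x, extD γ x = 0) :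
    ∫ x, (trackInt α Φ (1, x) * brk Ω.1 (pull (Φ 1) β) (pull (Φ 1) γ) x +
      trackInt β Φ (1, x) * brk Ω.1 (pull (Φ 1) γ) α x +
      trackInt γ Φ (1, x) * brk Ω.1 α β x) ∂μ = 0 := by
  have hQ : TimeSmooth fun p => brk Ω.1 (shifted β (trackInt β Φ) p.1)
      (shifted γ (trackInt γ Φ) p.1) p.2 := by
    have h : (fun p : ℝ × S => brk Ω.1 (shifted β (trackInt β Φ) p.1)
        (shifted γ (trackInt γ Φ) p.1) p.2) = fun p => brk Ω.1 β γ (Φ p.1 p.2) := by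
      funext p
      rw [← pull_eq_shifted hΦ hβ hβ0, ← pull_eq_shifted hΦ hγ hγ0, brk_pull_symp (hΦ.mem _) hΩ]
    rw [h]
    exact timeSmooth_comp hΦ fun x => contMDiffAt_brk (Ω.2 x) hΩ (hβ x) (hγ x)
  have h := integral_cyclic_eq hμ Ω.2 hΩ hα hα0 hβ hβ0 hγ hγ0 (timeSmooth_trackInt hΦ hα hα0)
    (timeSmooth_trackInt hΦ hβ hβ0) (timeSmooth_trackInt hΦ hγ hγ0) hQ (fun t x => by
      rw [← pull_eq_shifted hΦ hα hα0, ← pull_eq_shifted hΦ hβ hβ0, ← pull_eq_shifted hΦ hγ hγ0,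
        brk_pull_symp (hΦ.mem _) hΩ, brk_pull_symp (hΦ.mem _) hΩ, brk_pull_symp (hΦ.mem _) hΩ,
        timeDeriv_trackInt hΦ hα hα0, timeDeriv_trackInt hΦ hβ hβ0, timeDeriv_trackInt hΦ hγ hγ0]
      have hc := cyclic_wedge (α (Φ t x)) (β (Φ t x)) (γ (Φ t x)) (trackVel Φ t x)
      have hr := congrArg (fun A => ratio A (Ω.1 (Φ t x))) hc
      simp only [ratio_add, ratio_smul_left, ratio_zero] at hr
      exact hr) 1 0
  simp only [trackInt_zero, zero_mul, add_zero, integral_zero] at h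
  rw [pull_eq_shifted hΦ hβ hβ0, pull_eq_shifted hΦ hγ hγ0]
  exact h

end Isotopies

/-! ### The inverse isotopy and the flux form -/

section FluxForm

open MeasureTheory

variable {S : Type} [TopologicalSpace S] [ChartedSpace Plane S] [IsManifold 𝓘(ℝ, Plane) ∞ S]
  {Ω : Omega Plane S 2} {Φ : ℝ → Diff Plane S}

/-- The inverse of an isotopy is smooth in time and space: in charts `(t, y) ↦ (t, Φ_t y)` has an
invertible derivative. -/
theorem contMDiff_inverse (hΦ : IsSympIsotopy Ω Φ) :
    ContMDiff (𝓘(ℝ, ℝ).prod 𝓘(ℝ, Plane)) 𝓘(ℝ, Plane) ∞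
      fun p : ℝ × S => ((Φ p.1)⁻¹ : Diff Plane S) p.2 := by
  rintro ⟨t₀, z₀⟩
  set x₀ : S := ((Φ t₀)⁻¹ : Diff Plane S) z₀ with hx₀
  have hΦx : Φ t₀ x₀ = z₀ := (Φ t₀).apply_inv_self z₀
  have he : chartAt Plane x₀ ∈ MaxAtlas S := IsManifold.chart_mem_maximalAtlas x₀
  have he' : chartAt Plane z₀ ∈ MaxAtlas S := IsManifold.chart_mem_maximalAtlas z₀
  have hx : x₀ ∈ (chartAt Plane x₀).source := mem_chart_source Plane x₀
  have hz : z₀ ∈ (chartAt Plane z₀).source := mem_chart_source Plane z₀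
  set e := chartAt Plane x₀
  set e' := chartAt Plane z₀
  have hy := e.map_source hx
  set q₀ : ℝ × Plane := (t₀, e x₀) with hq₀
  set H : ℝ × Plane → Plane := fun q => e' (Φ q.1 (e.symm q.2)) with hH
  have hcs : ContMDiffAt 𝓘(ℝ, ℝ × Plane) (𝓘(ℝ, ℝ).prod 𝓘(ℝ, Plane)) ∞
      (fun q : ℝ × Plane => (q.1, e.symm q.2)) q₀ := by
    have h1 : ContMDiffAt 𝓘(ℝ, ℝ × Plane) 𝓘(ℝ, ℝ) ∞ (fun q : ℝ × Plane => q.1) q₀ :=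
      contDiff_fst.contMDiff _
    have h2 : ContMDiffAt 𝓘(ℝ, ℝ × Plane) 𝓘(ℝ, Plane) ∞ (fun q : ℝ × Plane => q.2) q₀ :=
      contDiff_snd.contMDiff _
    exact h1.prodMk ((contMDiffAt_chart_symm he hy).comp q₀ h2)
  have hGc : ContMDiffAt 𝓘(ℝ, ℝ × Plane) 𝓘(ℝ, Plane) ∞
      (fun q : ℝ × Plane => Φ q.1 (e.symm q.2)) q₀ := (hΦ.smooth _).comp q₀ hcs
  have hG0 : Φ q₀.1 (e.symm q₀.2) = z₀ := by
    simp only [hq₀, e.left_inv hx, hΦx]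
  have hHs : ContDiffAt ℝ ∞ H q₀ := by
    refine ContMDiffAt.contDiffAt (ContMDiffAt.comp q₀ (contMDiffAt_chart he' ?_) hGc)
    rw [hG0]
    exact hz
  set F : ℝ × Plane → ℝ × Plane := fun q => (q.1, H q) with hF
  have hFs : ContDiffAt ℝ ∞ F q₀ := contDiffAt_fst.prodMk hHs
  have hHd : HasFDerivAt H (fderiv ℝ H q₀) q₀ := (hHs.differentiableAt (by simp)).hasFDerivAt
  have hFd : HasFDerivAt F ((ContinuousLinearMap.fst ℝ ℝ Plane).prod (fderiv ℝ H q₀)) q₀ :=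
    hasFDerivAt_fst.prodMk hHd
  -- The derivative of `F` is triangular, and its spatial part is injective because `Φ t₀` has a
  -- smooth inverse, written `K` in coordinates.
  have hinj : Function.Injective ((ContinuousLinearMap.fst ℝ ℝ Plane).prod (fderiv ℝ H q₀)) := by
    rw [injective_iff_map_eq_zero]
    rintro ⟨τ, v⟩ h
    obtain ⟨h1, h2⟩ := Prod.ext_iff.1 h
    obtain rfl : τ = 0 := h1
    set K : Plane → Plane := fun w => e (((Φ t₀)⁻¹ : Diff Plane S) (e'.symm w)) with hK
    have h3 : HasFDerivAt (fun y => H (t₀, y))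
        ((fderiv ℝ H q₀).comp (ContinuousLinearMap.inr ℝ ℝ Plane)) (e x₀) :=
      hHd.comp (e x₀) (hasFDerivAt_prodMk_right t₀ (e x₀))
    have hw : H (t₀, e x₀) = e' z₀ := congrArg e' hG0
    have hKs : DifferentiableAt ℝ K (H (t₀, e x₀)) := by
      rw [hw]
      have h5 := contMDiffAt_chart_symm he' (e'.map_source hz)
      have h6 : ContMDiffAt 𝓘(ℝ, Plane) 𝓘(ℝ, Plane) ∞ e
          (((Φ t₀)⁻¹ : Diff Plane S) (e'.symm (e' z₀))) := by
        rw [e'.left_inv hz]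
        exact contMDiffAt_chart he hx
      have h7 := h6.comp (e' z₀) ((((Φ t₀)⁻¹ : Diff Plane S).contMDiff _).comp (e' z₀) h5)
      exact h7.contDiffAt.differentiableAt (by simp)
    have h8 := hKs.hasFDerivAt.comp (e x₀) h3
    have h9 : K ∘ (fun y => H (t₀, y)) =ᶠ[𝓝 (e x₀)] id := by
      have hc : ContinuousAt (fun y => Φ t₀ (e.symm y)) (e x₀) :=
        ContinuousAt.comp (Φ t₀).continuous.continuousAt (e.continuousAt_symm hy)
      have hm : e'.source ∈ 𝓝 (Φ t₀ (e.symm (e x₀))) := by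
        rw [e.left_inv hx, hΦx]
        exact e'.open_source.mem_nhds hz
      filter_upwards [hc.preimage_mem_nhds hm, e.open_target.mem_nhds hy] with y hy1 hy2
      simp only [hK, hH, Function.comp_apply]
      rw [e'.left_inv hy1, Diff.inv_apply_self, e.right_inv hy2]
      rfl
    have h10 := (h8.congr_of_eventuallyEq h9.symm).unique (hasFDerivAt_id (e x₀))
    have h11 := congrArg (fun L : Plane →L[ℝ] Plane => L v) h10
    have h12 : (fderiv ℝ H q₀) ((0 : ℝ), v) = 0 := h2
    simp only [ContinuousLinearMap.comp_apply, ContinuousLinearMap.inr_apply, h12, map_zero] at h11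
    rw [Prod.mk_eq_zero]
    exact ⟨rfl, h11.symm⟩
  set L : (ℝ × Plane) ≃L[ℝ] (ℝ × Plane) := (LinearEquiv.ofInjectiveEndo
    ((ContinuousLinearMap.fst ℝ ℝ Plane).prod (fderiv ℝ H q₀) :
      (ℝ × Plane) →ₗ[ℝ] (ℝ × Plane)) hinj).toContinuousLinearEquiv
  have hFL : HasFDerivAt F (L : (ℝ × Plane) →L[ℝ] (ℝ × Plane)) q₀ := hFd
  have hn : (∞ : ℕ∞ω) ≠ 0 := by simp
  set Θ := hFs.toOpenPartialHomeomorph F hFL hn with hΘ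
  have hΘF : ∀ q, Θ q = F q := fun q => rfl
  have hq₀s : q₀ ∈ Θ.source := hFs.mem_toOpenPartialHomeomorph_source hFL hn
  have hF0 : F q₀ = (t₀, e' z₀) := by simp only [hF, hH, hq₀, e.left_inv hx, hΦx]
  have hΘs : ContDiffAt ℝ ∞ Θ.symm (t₀, e' z₀) := by
    rw [← hF0]
    exact hFs.to_localInverse hFL hn
  have hΘ0 : Θ.symm (t₀, e' z₀) = q₀ := by rw [← hF0, ← hΘF, Θ.left_inv hq₀s]
  have hc1 : ContMDiffAt (𝓘(ℝ, ℝ).prod 𝓘(ℝ, Plane)) 𝓘(ℝ, ℝ × Plane) ∞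
      (fun p : ℝ × S => (p.1, e' p.2)) (t₀, z₀) :=
    contMDiffAt_fst.prodMk_space ((contMDiffAt_chart he' hz).comp (t₀, z₀) contMDiffAt_snd)
  have hc2 : ContMDiffAt (𝓘(ℝ, ℝ).prod 𝓘(ℝ, Plane)) 𝓘(ℝ, ℝ × Plane) ∞
      (fun p : ℝ × S => Θ.symm (p.1, e' p.2)) (t₀, z₀) :=
    ContMDiffAt.comp (t₀, z₀) (g := Θ.symm) hΘs.contMDiffAt hc1
  have hc3 : ContMDiffAt (𝓘(ℝ, ℝ).prod 𝓘(ℝ, Plane)) 𝓘(ℝ, Plane) ∞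
      (fun p : ℝ × S => e.symm (Θ.symm (p.1, e' p.2)).2) (t₀, z₀) := by
    have h1 : ContMDiffAt 𝓘(ℝ, ℝ × Plane) 𝓘(ℝ, Plane) ∞ (fun q : ℝ × Plane => e.symm q.2)
        (Θ.symm (t₀, e' z₀)) := by
      rw [hΘ0]
      exact (contMDiffAt_chart_symm he hy).comp q₀ (contDiff_snd.contMDiff _)
    exact ContMDiffAt.comp (g := fun q : ℝ × Plane => e.symm q.2) (t₀, z₀) h1 hc2
  -- Near `(t₀, z₀)` the local inverse of `F` computes the inverse of the isotopy.
  refine hc3.congr_of_eventuallyEq ?_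
  have hO : ∀ᶠ q in 𝓝 q₀, Φ q.1 (e.symm q.2) ∈ e'.source := by
    refine hGc.continuousAt.eventually (e'.open_source.mem_nhds ?_)
    change Φ q₀.1 (e.symm q₀.2) ∈ _
    rw [hG0]
    exact hz
  have ht2 : Filter.Tendsto (fun p : ℝ × S => Θ.symm (p.1, e' p.2)) (𝓝 (t₀, z₀)) (𝓝 q₀) := by
    have := hc2.continuousAt
    rwa [ContinuousAt, hΘ0] at this
  have hT : ∀ᶠ p in 𝓝 (t₀, z₀), (p.1, e' p.2) ∈ Θ.target := by
    refine hc1.continuousAt.eventually (Θ.open_target.mem_nhds ?_)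
    change (t₀, e' z₀) ∈ _
    rw [← hF0]
    exact Θ.map_source hq₀s
  have hsrc : ∀ᶠ p : ℝ × S in 𝓝 (t₀, z₀), p.2 ∈ e'.source :=
    continuous_snd.continuousAt.eventually (e'.open_source.mem_nhds hz)
  filter_upwards [ht2.eventually hO, hT, hsrc] with p h1 h2 h3
  have h4 : F (Θ.symm (p.1, e' p.2)) = (p.1, e' p.2) := Θ.right_inv h2
  have h5 : (Θ.symm (p.1, e' p.2)).1 = p.1 := congrArg Prod.fst h4
  have h6 : e' (Φ (Θ.symm (p.1, e' p.2)).1 (e.symm (Θ.symm (p.1, e' p.2)).2)) = e' p.2 :=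
    congrArg Prod.snd h4
  rw [h5] at h1 h6
  have h7 := e'.injOn h1 h3 h6
  change ((Φ p.1)⁻¹ : Diff Plane S) p.2 = _
  conv_lhs => rw [← h7]
  exact Diff.inv_apply_self _ _

variable [T2Space S] [CompactSpace S]

/-- The value of a closed form on the velocity field is smooth in time and space. -/
theorem timeSmooth_velocity (hΦ : IsSympIsotopy Ω Φ) {α : Form Plane S 1}
    (hα : ∀ x, SmoothAt α x) (hα0 : ∀ x, extD α x = 0) :
    TimeSmooth fun p => cov (α p.2) (velocity Φ p.1 p.2) := by
  have h : ContMDiff (𝓘(ℝ, ℝ).prod 𝓘(ℝ, Plane)) (𝓘(ℝ, ℝ).prod 𝓘(ℝ, Plane)) ∞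
      fun p : ℝ × S => (p.1, ((Φ p.1)⁻¹ : Diff Plane S) p.2) :=
    contMDiff_fst.prodMk (contMDiff_inverse hΦ)
  have h2 : (fun p : ℝ × S => cov (α p.2) (velocity Φ p.1 p.2)) =
      fun p : ℝ × S => trackRate α Φ (p.1, ((Φ p.1)⁻¹ : Diff Plane S) p.2) := by
    funext p
    simp only [trackRate, velocity_eq, Diff.apply_inv_self]
  rw [h2]
  exact (timeSmooth_trackRate hΦ hα hα0).comp h

/-- Coordinates around a point given by globally defined functions. -/
theorem exists_coordinates (hΩ : ∀ x, Ω.1 x ≠ 0) (x : S) : ∃ u v : S → ℝ,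
    ContMDiff 𝓘(ℝ, Plane) 𝓘(ℝ, ℝ) ∞ u ∧ ContMDiff 𝓘(ℝ, Plane) 𝓘(ℝ, ℝ) ∞ v ∧
    brk Ω.1 (dfun u) (dfun v) x ≠ 0 := by
  have he : chartAt Plane x ∈ MaxAtlas S := IsManifold.chart_mem_maximalAtlas x
  set e := chartAt Plane x
  have hx : x ∈ e.source := mem_chart_source Plane x
  have hy := e.map_source hx
  obtain ⟨χ, hχ, hχs, N, hN, hxN, hN1⟩ := exists_cutoff (isClosed_singleton (x := x))
    e.open_source (Set.singleton_subset_iff.2 hx)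
  set w : Fin 2 → S → ℝ := fun i z => χ z * e z i with hw
  have hws : ∀ i, ContMDiff 𝓘(ℝ, Plane) 𝓘(ℝ, ℝ) ∞ (w i) := by
    intro i z
    by_cases hz : z ∈ e.source
    · have h1 : ContMDiff 𝓘(ℝ, Plane) 𝓘(ℝ, ℝ) ∞ fun y : Plane => y i :=
        (EuclideanSpace.proj i : Plane →L[ℝ] ℝ).contMDiff
      exact (hχ z).mul ((h1 _).comp z (contMDiffAt_chart he hz))
    · refine (contMDiffAt_const (c := (0 : ℝ))).congr_of_eventuallyEq ?_
      filter_upwards [notMem_tsupport_iff_eventuallyEq.1 fun h => hz (hχs h)] with y hy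
      simp [hw, hy]
  have hd : ∀ i, fderiv ℝ (w i ∘ e.symm) (e x) = (EuclideanSpace.proj i : Plane →L[ℝ] ℝ) := by
    intro i
    have h1 : w i ∘ e.symm =ᶠ[𝓝 (e x)] (EuclideanSpace.proj i : Plane →L[ℝ] ℝ) := by
      have h2 : N ∈ 𝓝 (e.symm (e x)) := by
        rw [e.left_inv hx]
        exact hN.mem_nhds (hxN rfl)
      filter_upwards [(e.continuousAt_symm hy).preimage_mem_nhds h2, e.open_target.mem_nhds hy]
        with y hy1 hy2
      simp [hw, hN1 _ hy1, e.right_inv hy2]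
    rw [h1.fderiv_eq, ContinuousLinearMap.fderiv]
  have hp : ∀ i, cov (pull e.symm (dfun (w i)) (e x)) = (EuclideanSpace.proj i : Plane →L[ℝ] ℝ) := by
    intro i
    have hs : ContMDiffAt 𝓘(ℝ, Plane) 𝓘(ℝ, ℝ) ∞ (w i ∘ e.symm) (e x) :=
      (hws i _).comp _ (contMDiffAt_chart_symm he hy)
    have h1 : pull e.symm (dfun (w i)) (e x) = (dfun (w i ∘ e.symm) : Form Plane Plane 1) (e x) :=
      (extD_pull (smoothAt_fun0.2 (hws i _)) (contMDiffAt_chart_symm he hy)).symm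
    have h2 := cov_dfun (hs.mdifferentiableAt (by simp))
    rw [diffAt, mfderiv_eq_fderiv] at h2
    rw [← hd i, ← h2]
    exact congrArg cov h1
  refine ⟨w 0, w 1, hws 0, hws 1, ?_⟩
  have h := brk_dfun_chart he hΩ (hws 0) (dfun (w 1)) hy
  rw [e.left_inv hx] at h
  rw [h, hd 0]
  have h1 := hp 1
  refine div_ne_zero ?_ (density_ne_zero he hΩ hy)
  have h2 : ∀ v : Plane, cov (pull e.symm (dfun (w 1)) (e x)) v = v 1 := fun v =>
    congrArg (fun L : Plane →L[ℝ] ℝ => L v) h1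
  refine ne_of_eq_of_ne (b := (1 : ℝ)) ?_ one_ne_zero
  refine (congrArg₂ (fun a b : ℝ => (frame 0) 0 * a - (frame 1) 0 * b) (h2 _) (h2 _)).trans ?_
  simp [frame_apply]

/-- The contraction of the area form with a vector, in coordinates. -/
theorem curryLeft_eq (hΩ : ∀ x, Ω.1 x ≠ 0) {α β : Form Plane S 1} {x : S}
    (h : brk Ω.1 α β x ≠ 0) (v : Plane) :
    (Ω.1 x).curryLeft v = (brk Ω.1 α β x)⁻¹ • (cov (α x) v • β x - cov (β x) v • α x) := by
  rw [← curryLeft_wedge]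
  have h1 : wedge (α x) (β x) = brk Ω.1 α β x • Ω.1 x := ratio_smul_self _ (hΩ x)
  rw [h1]
  have h2 : (brk Ω.1 α β x • Ω.1 x).curryLeft v = brk Ω.1 α β x • (Ω.1 x).curryLeft v := rfl
  rw [h2, smul_smul, inv_mul_cancel₀ h, one_smul]

theorem continuous_contraction (hΦ : IsSympIsotopy Ω Φ) (hΩ : ∀ x, Ω.1 x ≠ 0) (x : S) :
    Continuous fun t => (Ω.1 x).curryLeft (velocity Φ t x) := by
  obtain ⟨u, v, hu, hv, huv⟩ := exists_coordinates hΩ x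
  have hc : ∀ {f : S → ℝ}, ContMDiff 𝓘(ℝ, Plane) 𝓘(ℝ, ℝ) ∞ f →
      Continuous fun t => cov (dfun f x) (velocity Φ t x) := fun hf =>
    (contDiff_slice (timeSmooth_velocity hΦ (smoothAt_dfun hf) (extD_dfun hf)) x).continuous
  simp_rw [fun t => curryLeft_eq hΩ huv (velocity Φ t x)]
  have h1 : Continuous fun t => cov (dfun u x) (velocity Φ t x) • (dfun v : Form Plane S 1) x :=
    (hc hu).smul continuous_const
  have h2 : Continuous fun t => cov (dfun v x) (velocity Φ t x) • (dfun u : Form Plane S 1) x :=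
    (hc hv).smul continuous_const
  exact (h1.sub h2).const_smul (brk Ω.1 (dfun u) (dfun v) x)⁻¹

theorem contMDiff_integral_velocity (hΦ : IsSympIsotopy Ω Φ) {α : Form Plane S 1}
    (hα : ∀ x, SmoothAt α x) (hα0 : ∀ x, extD α x = 0) :
    ContMDiff 𝓘(ℝ, Plane) 𝓘(ℝ, ℝ) ∞
      fun x => ∫ t in (0 : ℝ)..1, cov (α x) (velocity Φ t x) :=
  contMDiff_slice (timeSmooth_primitive (timeSmooth_velocity hΦ hα hα0)) 1

/-- The flux form is smooth: in coordinates `u`, `v` it is a combination of `du` and `dv` whose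
coefficients are time integrals of `du(X_t)` and `dv(X_t)`. -/
theorem smoothAt_fluxForm (hΦ : IsSympIsotopy Ω Φ) (hΩ : ∀ x, Ω.1 x ≠ 0) (x : S) :
    SmoothAt (fluxForm Ω Φ) x := by
  obtain ⟨u, v, hu, hv, huv⟩ := exists_coordinates hΩ x
  have hus := smoothAt_dfun hu
  have hvs := smoothAt_dfun hv
  have hb : ContMDiff 𝓘(ℝ, Plane) 𝓘(ℝ, ℝ) ∞ (brk Ω.1 (dfun u) (dfun v)) := fun z =>
    contMDiffAt_brk (Ω.2 z) hΩ (hus z) (hvs z)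
  have hWu := contMDiff_integral_velocity hΦ hus (extD_dfun hu)
  have hWv := contMDiff_integral_velocity hΦ hvs (extD_dfun hv)
  have hsm : SmoothAt (fsmul (fun z => (brk Ω.1 (dfun u) (dfun v) z)⁻¹)
      (fsmul (fun z => ∫ t in (0 : ℝ)..1, cov (dfun u z) (velocity Φ t z)) (dfun v) +
      (-1 : ℝ) • fsmul (fun z => ∫ t in (0 : ℝ)..1, cov (dfun v z) (velocity Φ t z)) (dfun u))) x :=
    SmoothAt.fsmul ((hb x).inv₀ huv)
      ((SmoothAt.fsmul (hWu x) (hvs x)).add ((SmoothAt.fsmul (hWv x) (hus x)).smul _))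
  refine hsm.congr ?_
  filter_upwards [hb.continuous.continuousAt.eventually_ne huv] with z hz
  have hc : ∀ {f : S → ℝ}, ContMDiff 𝓘(ℝ, Plane) 𝓘(ℝ, ℝ) ∞ f →
      Continuous fun t => cov (dfun f z) (velocity Φ t z) := fun hf =>
    (contDiff_slice (timeSmooth_velocity hΦ (smoothAt_dfun hf) (extD_dfun hf)) z).continuous
  rw [fluxForm]
  simp_rw [fun t => curryLeft_eq hΩ hz (velocity Φ t z)]
  have h1 : Continuous fun t => cov (dfun u z) (velocity Φ t z) • (dfun v : Form Plane S 1) z :=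
    (hc hu).smul continuous_const
  have h2 : Continuous fun t => cov (dfun v z) (velocity Φ t z) • (dfun u : Form Plane S 1) z :=
    (hc hv).smul continuous_const
  rw [intervalIntegral.integral_smul, intervalIntegral.integral_sub
    (h1.intervalIntegrable 0 1) (h2.intervalIntegrable 0 1),
    intervalIntegral.integral_smul_const, intervalIntegral.integral_smul_const]
  have h3 : ∀ a b : Plane [⋀^Fin 1]→L[ℝ] ℝ, a - b = a + (-1 : ℝ) • b := fun a b => by
    ext w; simp [sub_eq_add_neg]
  exact congrArg _ (h3 _ _)

end FluxForm

/-! ### The pairing of the flux form with closed forms -/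

section FluxPairing

open MeasureTheory

variable {S : Type} [TopologicalSpace S] [ChartedSpace Plane S] [IsManifold 𝓘(ℝ, Plane) ∞ S]
  {Ω : Omega Plane S 2} {Φ : ℝ → Diff Plane S} [T2Space S] [CompactSpace S]

/-- The exterior product with a fixed form, divided by a fixed `2`-form. -/
noncomputable def wedgeRatio (b : Plane [⋀^Fin 1]→L[ℝ] ℝ) (B : Plane [⋀^Fin 2]→L[ℝ] ℝ) :
    (Plane [⋀^Fin 1]→L[ℝ] ℝ) →L[ℝ] ℝ :=
  (cov b (frame 1) / B frame) • ContinuousAlternatingMap.apply ℝ Plane ℝ (fun _ => frame 0) -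
    (cov b (frame 0) / B frame) • ContinuousAlternatingMap.apply ℝ Plane ℝ (fun _ => frame 1)

theorem wedgeRatio_apply (a b : Plane [⋀^Fin 1]→L[ℝ] ℝ) (B : Plane [⋀^Fin 2]→L[ℝ] ℝ) :
    wedgeRatio b B a = ratio (wedge a b) B := by
  rw [ratio, wedge_apply]
  change (cov b (frame 1) / B frame) * cov a (frame 0) -
    (cov b (frame 0) / B frame) * cov a (frame 1) = _
  ring

theorem brk_fluxForm (hΦ : IsSympIsotopy Ω Φ) (hΩ : ∀ x, Ω.1 x ≠ 0) (α : Form Plane S 1) (x : S) :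
    brk Ω.1 (fluxForm Ω Φ) α x = -∫ t in (0 : ℝ)..1, cov (α x) (velocity Φ t x) := by
  have h1 : brk Ω.1 (fluxForm Ω Φ) α x = wedgeRatio (α x) (Ω.1 x) (fluxForm Ω Φ x) :=
    (wedgeRatio_apply _ _ _).symm
  have hI : IntervalIntegrable (fun t => (Ω.1 x).curryLeft (velocity Φ t x)) volume 0 1 :=
    (continuous_contraction hΦ hΩ x).intervalIntegrable 0 1
  have h2 := (wedgeRatio (α x) (Ω.1 x)).intervalIntegral_comp_comm hI
  rw [h1, fluxForm, ← intervalIntegral.integral_neg]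
  refine h2.symm.trans (intervalIntegral.integral_congr fun t _ => ?_)
  refine (wedgeRatio_apply _ _ _).trans ?_
  rw [wedge_curryLeft, ratio_smul _ (hΩ x)]

variable [MeasurableSpace S] [BorelSpace S] {μ : Measure S} [IsFiniteMeasure μ]

theorem integral_swap_timeSmooth {k : ℝ × S → ℝ} (hk : TimeSmooth k) :
    ∫ x, (∫ t in (0 : ℝ)..1, k (t, x)) ∂μ = ∫ t in (0 : ℝ)..1, ∫ x, k (t, x) ∂μ := by
  refine (intervalIntegral_integral_swap (f := fun t x => k (t, x)) ?_).symm
  obtain ⟨C, hC⟩ := ((isCompact_uIcc (a := (0 : ℝ)) (b := 1)).prod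
    (isCompact_univ (X := S))).exists_bound_of_continuousOn hk.continuous.continuousOn
  have : IsFiniteMeasure (volume.restrict (Set.uIoc (0 : ℝ) 1)) :=
    ⟨by rw [Measure.restrict_apply_univ, Set.uIoc_of_le zero_le_one]; simp⟩
  refine Integrable.of_bound hk.continuous.aestronglyMeasurable C ?_
  have h : (volume.restrict (Set.uIoc (0 : ℝ) 1)).prod μ =
      (volume.prod μ).restrict (Set.uIoc (0 : ℝ) 1 ×ˢ Set.univ) := by
    rw [← Measure.prod_restrict, Measure.restrict_univ]
  rw [h]
  refine ae_restrict_of_forall_mem (measurableSet_uIoc.prod MeasurableSet.univ) ?_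
  exact fun p hp => hC p ⟨Set.uIoc_subset_uIcc hp.1, trivial⟩

/-- The flux form pairs with a closed form as minus the total integral along trajectories. -/
theorem integral_brk_fluxForm (hμ : IsAreaMeasure Ω.1 μ) (hΩ : ∀ x, Ω.1 x ≠ 0)
    (hΦ : IsSympIsotopy Ω Φ) {α : Form Plane S 1} (hα : ∀ x, SmoothAt α x)
    (hα0 : ∀ x, extD α x = 0) :
    ∫ x, brk Ω.1 (fluxForm Ω Φ) α x ∂μ = -∫ x, trackInt α Φ (1, x) ∂μ := by
  have h1 := integral_swap_timeSmooth (μ := μ) (timeSmooth_velocity hΦ hα hα0)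
  have h2 := integral_swap_timeSmooth (μ := μ) (timeSmooth_trackRate hΦ hα hα0)
  simp only [brk_fluxForm hΦ hΩ]
  rw [integral_neg, h1]
  unfold trackInt
  simp only
  rw [h2]
  congr 1
  refine intervalIntegral.integral_congr fun t _ => ?_
  have hinv : pull ((Φ t)⁻¹ : Diff Plane S) Ω.1 = Ω.1 := congrArg Subtype.val (inv_mem (hΦ.mem t))
  rw [← integral_comp_symp hμ hinv (contMDiff_slice (timeSmooth_velocity hΦ hα hα0) t).continuous]
  refine integral_congr_ae (Filter.Eventually.of_forall fun x => ?_)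
  simp only [trackRate, velocity_eq, Diff.inv_apply_self]

theorem trackInt_dfun (hΦ : IsSympIsotopy Ω Φ) {f : S → ℝ}
    (hf : ContMDiff 𝓘(ℝ, Plane) 𝓘(ℝ, ℝ) ∞ f) (x : S) :
    trackInt (dfun f) Φ (1, x) = f (Φ 1 x) - f x := by
  have hg := contDiff_slice (timeSmooth_comp hΦ hf) x
  have h := intervalIntegral.integral_eq_sub_of_hasDerivAt (f := fun u => f (Φ u x))
    (f' := fun u => trackRate (dfun f) Φ (u, x)) (a := 0) (b := 1) (fun u _ => by
      rw [trackRate_dfun hΦ hf]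
      exact (hg.differentiable (by simp) u).hasDerivAt)
    ((contDiff_slice (timeSmooth_trackRate hΦ (smoothAt_dfun hf)
      (extD_dfun hf)) x).continuous.intervalIntegrable 0 1)
  rw [trackInt, h, hΦ.zero]
  rfl

/-- The flux form is closed: the integral of `f dζ`, for `ζ` the flux form, is up to sign that of
`f ∘ Φ₁ - f`, which vanishes since `Φ₁` preserves the area. -/
theorem extD_fluxForm (hμ : IsAreaMeasure Ω.1 μ) (hΩ : ∀ x, Ω.1 x ≠ 0)
    (hΦ : IsSympIsotopy Ω Φ) (x : S) : extD (fluxForm Ω Φ) x = 0 := by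
  have hζ := smoothAt_fluxForm hΦ hΩ
  have hc : Continuous (curl Ω.1 (fluxForm Ω Φ)) := (contMDiff_curl Ω.2 hΩ hζ).continuous
  refine extD_eq_zero_of_curl hΩ (eqOn_zero_of_integral_mul hμ Ω.2 hΩ hc isOpen_univ
    (fun f hf _ => ?_) (Set.mem_univ x))
  have h1 := integral_brk_dfun hμ Ω.2 hΩ hf hζ
  have h2 := integral_brk_fluxForm hμ hΩ hΦ (smoothAt_dfun hf) (extD_dfun hf)
  have h3 : ∫ x, trackInt (dfun f) Φ (1, x) ∂μ = 0 := by
    simp only [trackInt_dfun hΦ hf]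
    have hfc : Continuous fun x => f (Φ 1 x) := hf.continuous.comp (Φ 1).continuous
    have hinv : pull ((Φ 1)⁻¹ : Diff Plane S) Ω.1 = Ω.1 := congrArg Subtype.val (inv_mem (hΦ.mem 1))
    rw [integral_sub (integrable_of_continuous hfc) (integrable_of_continuous hf.continuous),
      integral_comp_symp hμ hinv hf.continuous, sub_self]
  rw [h3, neg_zero] at h2
  simp only [brk_swap Ω.1 (fluxForm Ω Φ)] at h2
  rw [integral_neg] at h2
  simp only [mul_comm (curl Ω.1 (fluxForm Ω Φ) _)]
  linarith

end FluxPairing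

/-! ### Extension from an open subset -/

section Extension

open MeasureTheory TopologicalSpace

variable {S : Type} [TopologicalSpace S] [ChartedSpace Plane S] [IsManifold 𝓘(ℝ, Plane) ∞ S]
  {U : Opens S} {k : ℕ}

theorem mdifferentiableAt_val (q : U) :
    MDifferentiableAt 𝓘(ℝ, Plane) 𝓘(ℝ, Plane) (Subtype.val : U → S) q :=
  (contMDiff_subtype_val (n := ∞) q).mdifferentiableAt (by simp)

theorem pull_val_extZero (β : Form Plane U k) : pull (Subtype.val : U → S) (extZero β) = β := by
  funext q
  have h1 : pull (Subtype.val : U → S) (extZero β) q =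
      pull (Subtype.val : U → S) (pull (retr q) β) q := by
    rw [pull, extZero_eq_pull β q q]
    rfl
  have h2 : MDifferentiableAt 𝓘(ℝ, Plane) 𝓘(ℝ, Plane) (retr q) (q : S) :=
    (contMDiffAt_retr q q).mdifferentiableAt (by simp)
  rw [h1, ← pull_comp_apply β h2 (mdifferentiableAt_val q),
    show retr q ∘ (Subtype.val : U → S) = id from funext (retr_val q), pull_id]

theorem extZero_pull_val (β : Form Plane S k) {x : S} (hx : x ∈ U) :
    extZero (pull (Subtype.val : U → S) β) x = β x :=
  eq_of_pull_val (⟨x, hx⟩ : U) (congrFun (pull_val_extZero _) _)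

theorem extZero_of_notMem (β : Form Plane U k) {x : S} (hx : x ∉ U) : extZero β x = 0 := by
  simp [extZero, hx]

theorem extZero_eq_zero {β : Form Plane U k} {q : U} (h : β q = 0) : extZero β (q : S) = 0 := by
  rw [extZero_eq_pull β q q, pull, retr_val, h]
  rfl

theorem smoothAt_extZero_of_mem {β : Form Plane U k} (hβ : ∀ q, SmoothAt β q) {x : S}
    (hx : x ∈ U) : SmoothAt (extZero β) x :=
  SmoothAt.congr (SmoothAt.pull (hβ _) (contMDiffAt_retr ⟨x, hx⟩ ⟨x, hx⟩))
    (extZero_eventually β ⟨x, hx⟩)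

theorem extD_extZero_of_mem {β : Form Plane U k} (hβ : ∀ q, SmoothAt β q) {x : S} (hx : x ∈ U) :
    extD (extZero β) x = extZero (extD β) x := by
  rw [extD_congr (extZero_eventually β ⟨x, hx⟩),
    extD_pull (hβ _) (contMDiffAt_retr ⟨x, hx⟩ ⟨x, hx⟩)]
  exact (extZero_eq_pull _ _ ⟨x, hx⟩).symm

theorem extZero_sub (α β : Form Plane U k) :
    (extZero (α - β) : Form Plane S k) = extZero α - extZero β := by
  have h := extZero_add (S := S) (α - β) β
  rw [sub_add_cancel] at h
  exact eq_sub_of_add_eq h.symm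

variable [T2Space S]

theorem extZero_pull_diff {φ : Diff Plane U} (hφ : ∃ K : Set U, IsCompact K ∧ ∀ x ∉ K, φ x = x)
    (β : Form Plane U k) : extZero (pull φ β) = pull (extDiff φ hφ : S → S) (extZero β) := by
  funext x
  by_cases hx : x ∈ U
  · have hd : MDifferentiableAt 𝓘(ℝ, Plane) 𝓘(ℝ, Plane) (extDiff φ hφ : S → S) x :=
      ((extDiff φ hφ).contMDiff x).mdifferentiableAt (by simp)
    refine eq_of_pull_val (⟨x, hx⟩ : U) ?_
    rw [pull_val_extZero, ← pull_comp_apply (g := (extDiff φ hφ : S → S))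
      (f := (Subtype.val : U → S)) (extZero β) hd (mdifferentiableAt_val _),
      show (extDiff φ hφ : S → S) ∘ (Subtype.val : U → S) = Subtype.val ∘ φ from
        funext (extId_val φ),
      pull_comp_apply (g := (Subtype.val : U → S)) (f := φ) (extZero β) (mdifferentiableAt_val _)
        ((φ.contMDiff _).mdifferentiableAt (by simp)), pull_val_extZero]
  · have h1 : (extDiff φ hφ : S → S) x = x := extId_of_notMem _ hx
    rw [extZero_of_notMem _ hx, pull, h1, extZero_of_notMem _ hx]
    rfl

variable {Ω : Omega Plane S 2}

/-- The extension by the identity of an isotopy with compact support. -/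
theorem isSympIsotopy_extDiff {Φ : ℝ → Diff Plane U} (hΦ : IsSympIsotopy (restrictForm U Ω) Φ)
    {K : Set U} (hK : IsCompact K) (h : ∀ t, ∀ x ∉ K, Φ t x = x) :
    IsSympIsotopy Ω fun t => extDiff (Φ t) ⟨K, hK, h t⟩ where
  smooth := by
    rintro ⟨t, x⟩
    by_cases hx : x ∈ U
    · have h1 : ContMDiffAt (𝓘(ℝ, ℝ).prod 𝓘(ℝ, Plane)) (𝓘(ℝ, ℝ).prod 𝓘(ℝ, Plane)) ∞
          (fun p : ℝ × S => (p.1, retr (⟨x, hx⟩ : U) p.2)) (t, x) :=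
        contMDiffAt_fst.prodMk ((contMDiffAt_retr (⟨x, hx⟩ : U) ⟨x, hx⟩).comp (t, x) contMDiffAt_snd)
      have h2 := contMDiff_subtype_val.contMDiffAt.comp (t, x) ((hΦ.smooth _).comp (t, x) h1)
      refine h2.congr_of_eventuallyEq ?_
      filter_upwards [continuous_snd.continuousAt.preimage_mem_nhds (U.isOpen.mem_nhds hx)]
        with p hp
      have h3 : retr (⟨x, hx⟩ : U) p.2 = ⟨p.2, hp⟩ := retr_val _ (⟨p.2, hp⟩ : U)
      simp only [Function.comp_apply, h3]
      exact extId_val _ (⟨p.2, hp⟩ : U)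
    · refine contMDiffAt_snd.congr_of_eventuallyEq ?_
      have hc : IsClosed (Subtype.val '' K : Set S) := (hK.image continuous_subtype_val).isClosed
      have hxK : x ∉ (Subtype.val '' K : Set S) := by
        rintro ⟨q, -, rfl⟩
        exact hx q.2
      filter_upwards [continuous_snd.continuousAt.preimage_mem_nhds
        (hc.isOpen_compl.mem_nhds hxK)] with p hp
      change extId (Φ p.1) p.2 = p.2
      by_cases hpU : p.2 ∈ U
      · have h4 : Φ p.1 ⟨p.2, hpU⟩ = ⟨p.2, hpU⟩ := h _ _ fun hK => hp ⟨_, hK, rfl⟩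
        rw [extId, dif_pos hpU, h4]
      · exact extId_of_notMem _ hpU
  mem t := extDiff_mem_Symp (hΦ.mem t) _
  zero := by
    refine Diffeomorph.ext fun x => ?_
    change extId (Φ 0) x = x
    rw [hΦ.zero]
    exact extId_id x

theorem trackInt_eq_zero {Φ : ℝ → Diff Plane S} (α : Form Plane S 1) {x : S}
    (h : ∀ t, Φ t x = x) : trackInt α Φ (1, x) = 0 := by
  have h1 : ∀ t, trackRate α Φ (t, x) = 0 := by
    intro t
    have h2 : (fun s : ℝ => Φ s x) = fun _ => x := funext h
    have h3 : trackVel Φ t x = 0 := by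
      rw [trackVel, h2, mfderiv_const]
      rfl
    rw [trackRate, h3, map_zero]
  simp [trackInt, h1]

variable [CompactSpace S]

/-- A form on an open subset agrees near a compact subset with a smooth form on the surface. -/
theorem exists_global_form {lam : Form Plane U 1} (hlam : ∀ q, SmoothAt lam q) {C : Set S}
    (hC : IsClosed C) (hCU : C ⊆ U) : ∃ Λ : Form Plane S 1, (∀ x, SmoothAt Λ x) ∧
      ∃ N, IsOpen N ∧ C ⊆ N ∧ N ⊆ U ∧ ∀ x ∈ N, Λ x = extZero lam x := by
  obtain ⟨χ, hχ, hχs, N, hN, hCN, hN1⟩ := exists_cutoff hC U.isOpen hCU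
  refine ⟨fsmul χ (extZero lam), fun x => ?_, N ∩ U, hN.inter U.isOpen, fun x hx =>
    ⟨hCN hx, hCU hx⟩, Set.inter_subset_right, fun x hx => ?_⟩
  · by_cases hx : x ∈ U
    · exact SmoothAt.fsmul (hχ x) (smoothAt_extZero_of_mem hlam hx)
    · refine (smoothAt_zero x).congr ?_
      filter_upwards [notMem_tsupport_iff_eventuallyEq.1 fun h => hx (hχs h)] with y hy
      simp [fsmul_apply, hy]
  · rw [fsmul_apply, hN1 x hx.1, one_smul]

variable [MeasurableSpace S] [BorelSpace S] {μ : Measure S} [IsFiniteMeasure μ]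

/-- The extended flux pairs with compactly supported closed forms as minus the total integral along
the trajectories of the isotopy, if there is one: this is Stokes' theorem for `dλ = -Ω`. -/
theorem integral_brk_extZero_flux (hμ : IsAreaMeasure Ω.1 μ) (hΩ : ∀ x, Ω.1 x ≠ 0)
    {Φ : ℝ → Diff Plane U} (hΦ : IsSympIsotopy (restrictForm U Ω) Φ) {K : Set U} (hK : IsCompact K)
    (h : ∀ t, ∀ x ∉ K, Φ t x = x) {lam : Omega Plane U 1}
    (hlam : d Plane U 1 lam = -restrictForm U Ω) {a : Omega Plane U 1} (ha : a ∈ Z1c Plane U) :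
    ∫ x, brk Ω.1 (extZero (((Φ 1)⁻¹.pull lam - lam : Omega Plane U 1)).1) (extZero a.1) x ∂μ =
      -∫ x, trackInt (extZero a.1) (fun t => extDiff (Φ t) ⟨K, hK, h t⟩) (1, x) ∂μ := by
  set Ψ : ℝ → Diff Plane S := fun t => extDiff (Φ t) ⟨K, hK, h t⟩ with hΨ
  have hΨs : IsSympIsotopy Ω Ψ := isSympIsotopy_extDiff hΦ hK h
  have hinv : ∃ K : Set U, IsCompact K ∧ ∀ x ∉ K, ((Φ 1)⁻¹ : Diff Plane U) x = x :=
    ⟨K, hK, fun x hx => by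
      conv_lhs => rw [← h 1 x hx]
      exact Diff.inv_apply_self _ x⟩
  have hΨinv : extDiff (S := S) (Φ 1)⁻¹ hinv = (Ψ 1)⁻¹ := Diffeomorph.ext fun x => rfl
  obtain ⟨L, hL, haL⟩ := ha.2
  have hα := smoothAt_extZero (S := S) ha.2
  have hα0 : ∀ x, extD (extZero a.1 : Form Plane S 1) x = 0 := fun x => by
    rw [extD_extZero ha.2]
    by_cases hx : x ∈ U
    · refine extZero_eq_zero (q := ⟨x, hx⟩) ?_
      exact congrFun (congrArg Subtype.val (LinearMap.mem_ker.1 ha.1)) _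
    · exact extZero_of_notMem _ hx
  set C : Set S := Subtype.val '' (K ∪ L) with hCdef
  have hC : IsClosed C := ((hK.union hL).image continuous_subtype_val).isClosed
  have hCU : C ⊆ U := by
    rintro _ ⟨q, -, rfl⟩
    exact q.2
  obtain ⟨Λ, hΛ, N, hN, hCN, hNU, hΛN⟩ := exists_global_form lam.2 hC hCU
  have hfix : ∀ x ∉ C, ∀ t, Ψ t x = x := by
    intro x hx t
    by_cases hxU : x ∈ U
    · have h1 : Φ t ⟨x, hxU⟩ = ⟨x, hxU⟩ := h t _ fun hK => hx ⟨_, Or.inl hK, rfl⟩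
      exact (extId_val _ (⟨x, hxU⟩ : U)).trans (congrArg Subtype.val h1)
    · exact extId_of_notMem _ hxU
  have hinvC : ∀ x ∈ C, ((Ψ 1)⁻¹ : Diff Plane S) x ∈ C := by
    intro x hx
    by_contra hx'
    have h1 := hfix _ hx' 1
    rw [Diff.apply_inv_self] at h1
    exact hx' (h1 ▸ hx)
  have hαC : ∀ x ∉ C, (extZero a.1 : Form Plane S 1) x = 0 := by
    intro x hx
    by_cases hxU : x ∈ U
    · exact extZero_eq_zero (q := ⟨x, hxU⟩) (haL _ fun hL => hx ⟨_, Or.inr hL, rfl⟩)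
    · exact extZero_of_notMem _ hxU
  set α : Form Plane S 1 := extZero a.1 with hαdef
  have hpull : ∀ {η : Form Plane S 1} (φ : Diff Plane S), (∀ x, SmoothAt η x) →
      ∀ x, SmoothAt (pull φ η) x := fun φ hη x => (hη _).pull (φ.contMDiff x)
  have hsymp := hΨs.mem 1
  have e1 : ∀ x, brk Ω.1 (extZero (((Φ 1)⁻¹.pull lam - lam : Omega Plane U 1)).1) α x =
      brk Ω.1 (pull ((Ψ 1)⁻¹ : Diff Plane S) Λ) α x - brk Ω.1 Λ α x := by
    intro x
    by_cases hx : x ∈ C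
    · rw [← brk_sub_left]
      refine brk_congr Ω.1 ?_ rfl
      have h1 : (((Φ 1)⁻¹.pull lam - lam : Omega Plane U 1)).1 =
        pull ((Φ 1)⁻¹ : Diff Plane U) lam.1 - lam.1 := rfl
      rw [h1, extZero_sub, extZero_pull_diff hinv, hΨinv, Pi.sub_apply, Pi.sub_apply, hΛN x (hCN hx),
        pull, pull, hΛN _ (hCN (hinvC x hx))]
    · rw [brk_eq_zero_right Ω.1 (hαC x hx), brk_eq_zero_right Ω.1 (hαC x hx),
        brk_eq_zero_right Ω.1 (hαC x hx), sub_zero]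
  have hΛc := continuous_brk Ω.2 hΩ hΛ hα
  have hΛc' := continuous_brk Ω.2 hΩ hΛ (hpull (Ψ 1) hα)
  have e2 : ∀ x, brk Ω.1 (pull ((Ψ 1)⁻¹ : Diff Plane S) Λ) α x =
      brk Ω.1 Λ (pull (Ψ 1) α) (((Ψ 1)⁻¹ : Diff Plane S) x) := by
    intro x
    rw [← brk_pull_symp (inv_mem hsymp) hΩ]
    refine brk_congr Ω.1 rfl ?_
    have h1 := pull_comp_apply (g := (Ψ 1 : S → S)) (f := ((Ψ 1)⁻¹ : Diff Plane S)) (x := x) α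
      (((Ψ 1).contMDiff _).mdifferentiableAt (by simp))
      ((((Ψ 1)⁻¹ : Diff Plane S).contMDiff _).mdifferentiableAt (by simp))
    rw [← h1, show (Ψ 1 : S → S) ∘ ((Ψ 1)⁻¹ : Diff Plane S) = id from
      funext (Diff.apply_inv_self _), pull_id]
  set F : S → ℝ := fun x => trackInt α Ψ (1, x) with hF
  have hFs : ContMDiff 𝓘(ℝ, Plane) 𝓘(ℝ, ℝ) ∞ F := contMDiff_slice (timeSmooth_trackInt hΨs hα hα0) 1
  have e3 : ∀ x, brk Ω.1 Λ (pull (Ψ 1) α) x - brk Ω.1 Λ α x = -brk Ω.1 (dfun F) Λ x := by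
    intro x
    rw [← brk_sub_right, ← brk_swap]
    exact brk_congr Ω.1 rfl (dfun_trackInt hΨs hα hα0 1 x).symm
  have e4 : ∀ x, F x * curl Ω.1 Λ x = -F x := by
    intro x
    by_cases hx : x ∈ C
    · have hxU : x ∈ U := hCU hx
      have h1 : extD Λ x = (-1 : ℝ) • Ω.1 x := by
        have h2 : Λ =ᶠ[𝓝 x] extZero lam.1 := by
          filter_upwards [hN.mem_nhds (hCN hx)] with y hy using hΛN y hy
        have h3 : extD lam.1 = (-1 : ℝ) • (pull (Subtype.val : U → S) Ω.1) := by
          refine (congrArg Subtype.val hlam).trans ?_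
          funext q
          exact (neg_one_smul ℝ (pull (Subtype.val : U → S) Ω.1 q)).symm
        rw [extD_congr h2, extD_extZero_of_mem lam.2 hxU, h3, extZero_smul, Pi.smul_apply]
        exact congrArg _ (extZero_pull_val Ω.1 hxU)
      have h2 : curl Ω.1 Λ x = -1 :=
        (congrArg (fun A => ratio A (Ω.1 x)) h1).trans (ratio_smul _ (hΩ x))
      rw [h2]
      ring
    · have : F x = 0 := trackInt_eq_zero α (hfix x hx)
      rw [this]
      ring
  have hinv1 : pull (((Ψ 1)⁻¹)⁻¹ : Diff Plane S) Ω.1 = Ω.1 := by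
    rw [inv_inv]
    exact congrArg Subtype.val hsymp
  have e5 := integral_comp_symp hμ hinv1 hΛc'
  have hc1 : Continuous fun x => brk Ω.1 Λ (pull (Ψ 1) α) (((Ψ 1)⁻¹ : Diff Plane S) x) :=
    hΛc'.comp ((Ψ 1)⁻¹ : Diff Plane S).continuous
  simp only [e1, e2]
  rw [integral_sub (integrable_of_continuous hc1) (integrable_of_continuous hΛc), e5,
    ← integral_sub (integrable_of_continuous hΛc') (integrable_of_continuous hΛc)]
  simp only [e3]
  rw [integral_neg, integral_brk_dfun hμ Ω.2 hΩ hFs hΛ]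
  simp only [e4]
  rw [integral_neg, neg_neg]

end Extension

/-! ### The cohomology of the complement of a disk -/

section Complement

open TopologicalSpace

variable {S : Type} [TopologicalSpace S] [ChartedSpace Plane S] [IsManifold 𝓘(ℝ, Plane) ∞ S]

theorem eventually_eq_of_dfun_eq_zero {W : Set S} (hW : IsOpen W) {f : S → ℝ}
    (hf : ∀ x ∈ W, ContMDiffAt 𝓘(ℝ, Plane) 𝓘(ℝ, ℝ) ∞ f x)
    (h : ∀ x ∈ W, (dfun f : Form Plane S 1) x = 0) {x : S} (hx : x ∈ W) :
    ∀ᶠ y in 𝓝 x, f y = f x := by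
  obtain ⟨e, he, hxe, heW⟩ := exists_rectChart hW hx
  have hconv : Convex ℝ e.target := by
    obtain ⟨-, a, b, c, d, -, -, ht⟩ := he
    exact ht ▸ convex_rect a b c d
  have hder : ∀ y ∈ e.target, HasFDerivAt (f ∘ e.symm) (0 : Plane →L[ℝ] ℝ) y := by
    intro y hy
    have hz := heW (e.map_target hy)
    have h1 : MDifferentiableAt 𝓘(ℝ, Plane) 𝓘(ℝ, ℝ) f (e.symm y) :=
      (hf _ hz).mdifferentiableAt (by simp)
    have h2 : diffAt f (e.symm y) = (0 : Plane →L[ℝ] ℝ) := by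
      rw [← cov_dfun h1, h _ hz, map_zero]
    have h3 := (contMDiffAt_chart_symm he.1 hy).mdifferentiableAt (by simp)
    have h4 := (h1.hasMFDerivAt.comp y h3.hasMFDerivAt).hasFDerivAt
    exact h4.congr_fderiv (ContinuousLinearMap.ext fun v => congrArg
      (fun L : Plane →L[ℝ] ℝ => L (mfderiv 𝓘(ℝ, Plane) 𝓘(ℝ, Plane) e.symm y v)) h2)
  have hconst : ∀ z ∈ e.source, f z = f x := by
    intro z hz
    have := e.open_target.is_const_of_fderiv_eq_zero (𝕜 := ℝ) hconv.isPreconnected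
      (fun y hy => (hder y hy).differentiableAt.differentiableWithinAt)
      (fun y hy => (hder y hy).fderiv) (e.map_source hz) (e.map_source hxe)
    simpa [e.left_inv hz, e.left_inv hxe] using this
  filter_upwards [e.open_source.mem_nhds hxe] with z hz using hconst z hz

theorem eq_of_dfun_eq_zero {W D : Set S} (hW : IsOpen W) {f : S → ℝ}
    (hf : ∀ x ∈ W, ContMDiffAt 𝓘(ℝ, Plane) 𝓘(ℝ, ℝ) ∞ f x)
    (h : ∀ x ∈ W, (dfun f : Form Plane S 1) x = 0) (hD : IsPreconnected D) (hDW : D ⊆ W)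
    {x y : S} (hx : x ∈ D) (hy : y ∈ D) : f x = f y := by
  have : PreconnectedSpace D := Subtype.preconnectedSpace hD
  have hl : IsLocallyConstant fun p : D => f p :=
    (IsLocallyConstant.iff_eventually_eq _).2 fun p =>
      continuous_subtype_val.continuousAt.eventually
        (eventually_eq_of_dfun_eq_zero hW hf h (hDW p.2))
  exact hl.apply_eq_of_preconnectedSpace ⟨x, hx⟩ ⟨y, hy⟩

variable {U : Opens S}

theorem dfun_val_eq {β : Omega Plane S 0} {α : Omega Plane S 1} (h : d Plane S 0 β = α) (x : S) :
    dfun (fun x => β.1 x ![]) x = α.1 x := by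
  rw [dfun, ← eq_fun0]
  exact congrFun (congrArg Subtype.val h) x

theorem contMDiff_val (β : Omega Plane S 0) :
    ContMDiff 𝓘(ℝ, Plane) 𝓘(ℝ, ℝ) ∞ fun x => β.1 x ![] := fun x => by
  rw [← smoothAt_fun0 (E := Plane), ← eq_fun0]
  exact β.2 x

theorem d_restrictForm {k : ℕ} (α : Omega Plane S k) :
    d Plane U k (restrictForm U α) = restrictForm U (d Plane S k α) := d_pullOmega _ _ _

/-- The smooth `0`-form of a smooth function. -/
noncomputable def omega0 {f : S → ℝ} (hf : ContMDiff 𝓘(ℝ, Plane) 𝓘(ℝ, ℝ) ∞ f) : Omega Plane S 0 :=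
  ⟨fun0 f, fun x => smoothAt_fun0.2 (hf x)⟩

theorem isPreconnected_of_isClosedDisk {D : Set S} (hD : IsClosedDisk Plane D) :
    IsPreconnected D := by
  obtain ⟨e, -, het, rfl⟩ := hD
  exact (convex_closedBall 0 1).isPreconnected.image _ (e.continuousOn_symm.mono het)

theorem nonempty_of_isClosedDisk {D : Set S} (hD : IsClosedDisk Plane D) : D.Nonempty := by
  obtain ⟨e, -, -, rfl⟩ := hD
  exact ⟨_, 0, by simp, rfl⟩

theorem mk_eq_of_dfun {α β : Z1 Plane S} {f : S → ℝ}
    (hf : ContMDiff 𝓘(ℝ, Plane) 𝓘(ℝ, ℝ) ∞ f) (h : ∀ x, dfun f x = α.1.1 x - β.1.1 x) :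
    H1.mk α = H1.mk β :=
  (Submodule.Quotient.eq _).2 ⟨omega0 hf, Subtype.ext (funext h)⟩

theorem extD_of_mem_Z1 {M : Type*} [TopologicalSpace M] [ChartedSpace Plane M]
    [IsManifold 𝓘(ℝ, Plane) ∞ M] (α : Z1 Plane M) (x : M) : extD α.1.1 x = 0 :=
  congrFun (congrArg Subtype.val (LinearMap.mem_ker.1 α.2)) x

variable [CompactSpace S]

theorem isCompact_preimage_compl {N : Set S} (hN : IsOpen N) (hUN : (U : Set S)ᶜ ⊆ N) :
    IsCompact ((Subtype.val : U → S) ⁻¹' Nᶜ) := by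
  rw [Subtype.isCompact_iff, Set.image_preimage_eq_of_subset]
  · exact hN.isClosed_compl.isCompact
  · intro x hx
    simpa using fun h => hx (hUN h)

variable [T2Space S]

/-- Extension by zero is injective on cohomology: a primitive of the extended form is constant near
the disk, which is connected, and subtracting this constant gives it compact support. -/
theorem extH1c_injective (hU : IsClosedDisk Plane ((U : Set S)ᶜ)) :
    Function.Injective (extH1c (E := Plane) U) := by
  refine (injective_iff_map_eq_zero _).2 fun u hu => ?_
  obtain ⟨a, rfl⟩ := Submodule.Quotient.mk_surjective _ u
  obtain ⟨β, hβ⟩ := (Submodule.Quotient.mk_eq_zero _).1 hu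
  set f : S → ℝ := fun x => β.1 x ![] with hfdef
  have hf : ContMDiff 𝓘(ℝ, Plane) 𝓘(ℝ, ℝ) ∞ f := contMDiff_val β
  obtain ⟨K, hK, haK⟩ := a.2.2
  set W : Set S := (Subtype.val '' K)ᶜ with hWdef
  have hW : IsOpen W := (hK.image continuous_subtype_val).isClosed.isOpen_compl
  have hUW : (U : Set S)ᶜ ⊆ W := by
    rintro x hx ⟨q, -, rfl⟩
    exact hx q.2
  have hf0 : ∀ x ∈ W, (dfun f : Form Plane S 1) x = 0 := by
    intro x hx
    rw [hfdef, dfun_val_eq hβ x]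
    change extZero a.1.1 x = 0
    by_cases hxU : x ∈ U
    · exact extZero_eq_zero (q := ⟨x, hxU⟩) (haK _ fun h => hx ⟨_, h, rfl⟩)
    · exact extZero_of_notMem _ hxU
  -- The primitive is constant on the disk, hence near it.
  obtain ⟨x₀, hx₀⟩ := nonempty_of_isClosedDisk hU
  set N : Set S := {x | ∀ᶠ y in 𝓝 x, f y = f x₀} with hNdef
  have hN : IsOpen N := isOpen_setOfPred_eventually_nhds
  have hUN : (U : Set S)ᶜ ⊆ N := fun x hx => by
    have h1 := eventually_eq_of_dfun_eq_zero hW (fun x _ => hf x) hf0 (hUW hx)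
    rwa [eq_of_dfun_eq_zero hW (fun x _ => hf x) hf0 (isPreconnected_of_isClosedDisk hU) hUW hx hx₀]
      at h1
  have hg : ContMDiff 𝓘(ℝ, Plane) 𝓘(ℝ, ℝ) ∞ fun x => f x - f x₀ := hf.sub contMDiff_const
  refine (Submodule.Quotient.mk_eq_zero _).2 ⟨restrictForm U (omega0 hg), ?_, ?_⟩
  · refine ⟨_, isCompact_preimage_compl hN hUN, fun q hq => ?_⟩
    have hq' : (q : S) ∈ N := by simpa using hq
    have h1 : f q - f x₀ = 0 := sub_eq_zero.2 hq'.self_of_nhds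
    ext v
    exact h1
  · rw [d_restrictForm]
    refine Subtype.ext ?_
    have h1 : (d Plane S 0 (omega0 hg)).1 = extZero a.1.1 := funext fun x =>
      (dfun_sub_const (hf x) _).trans (dfun_val_eq hβ x)
    change pull (Subtype.val : U → S) (d Plane S 0 (omega0 hg)).1 = a.1.1
    rw [h1, pull_val_extZero]

/-- Every closed form is cohomologous to one that vanishes near the disk. -/
theorem exists_extZero_add_dfun (hU : IsClosedDisk Plane ((U : Set S)ᶜ)) (α : Z1 Plane S) :
    ∃ (a : Z1c Plane U) (f : S → ℝ), ContMDiff 𝓘(ℝ, Plane) 𝓘(ℝ, ℝ) ∞ f ∧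
      ∀ x, α.1.1 x = extZero a.1.1 x + dfun f x := by
  obtain ⟨e, he, het, hD⟩ := hU
  obtain ⟨δ, hδ, hδt⟩ := (isCompact_closedBall (0 : Plane) 1).exists_thickening_subset_open
    e.open_target het
  rw [thickening_closedBall hδ zero_le_one] at hδt
  obtain ⟨f, hf, N, hN, hUN, hfN⟩ := exists_primitive_near he (convex_ball (0 : Plane) (δ + 1))
    Metric.isOpen_ball hδt (fun x _ => α.1.2 x) (fun x _ => extD_of_mem_Z1 α x)
    U.isOpen.isClosed_compl (hD.le.trans (Set.image_mono fun y hy => by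
      rw [Metric.mem_closedBall] at hy
      rw [Metric.mem_ball]
      linarith))
  set β : Omega Plane S 1 := α.1 - d Plane S 0 (omega0 hf) with hβ
  have hβx : ∀ x, β.1 x = α.1.1 x - dfun f x := fun x => rfl
  have hβ0 : d Plane S 1 β = 0 := by
    rw [hβ, map_sub, LinearMap.mem_ker.1 α.2, zero_sub, neg_eq_zero]
    exact Subtype.ext (funext fun x => extD_dfun hf x)
  refine ⟨⟨restrictForm U β, ?_, _, isCompact_preimage_compl hN hUN, fun q hq => ?_⟩, f, hf,
    fun x => ?_⟩
  · exact LinearMap.mem_ker.2 (by rw [d_restrictForm, hβ0, map_zero])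
  · have hq' : (q : S) ∈ N := by simpa using hq
    change pull (Subtype.val : U → S) β.1 q = 0
    rw [pull, hβx, hfN _ hq', sub_self]
    rfl
  · have h1 : extZero (restrictForm U β).1 x = β.1 x := by
      by_cases hx : x ∈ U
      · exact extZero_pull_val β.1 hx
      · rw [extZero_of_notMem _ hx, hβx, hfN _ (hUN hx), sub_self]
    rw [h1, hβx, sub_add_cancel]

theorem extH1c_surjective (hU : IsClosedDisk Plane ((U : Set S)ᶜ)) :
    Function.Surjective (extH1c (E := Plane) U) := by
  intro u
  obtain ⟨α, rfl⟩ := Submodule.Quotient.mk_surjective _ u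
  obtain ⟨a, f, hf, h⟩ := exists_extZero_add_dfun hU α
  refine ⟨H1c.mk a, (mk_eq_of_dfun (α := α) (β := extZ1c a) hf fun x => ?_).symm⟩
  rw [h x]
  exact (add_sub_cancel_left _ _).symm

theorem extH1c_actH1c {Ω : Omega Plane S 2} (φ : SympC (restrictForm U Ω)) (u : H1c Plane U) :
    extH1c U (actH1c Plane U φ.1 u) = actH1OfSympC U Ω φ (extH1c U u) := by
  obtain ⟨a, rfl⟩ := Submodule.Quotient.mk_surjective _ u
  exact congrArg H1.mk (Subtype.ext (Subtype.ext (extZero_pull_diff (φ⁻¹).2.2 a.1.1)))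

end Complement

/-! ### The intersection pairing on cohomology -/

section Pairing

open MeasureTheory

variable {S : Type} [TopologicalSpace S] [ChartedSpace Plane S] [IsManifold 𝓘(ℝ, Plane) ∞ S]
  [T2Space S] [CompactSpace S] [MeasurableSpace S] [BorelSpace S]
  {Ω : Omega Plane S 2} {μ : Measure S} [IsFiniteMeasure μ]

theorem integrable_brk (hΩ : ∀ x, Ω.1 x ≠ 0) (α β : Omega Plane S 1) :
    Integrable (brk Ω.1 α.1 β.1) μ :=
  integrable_of_continuous (continuous_brk Ω.2 hΩ α.2 β.2)

theorem integral_brk_swap (α β : Form Plane S 1) :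
    ∫ x, brk Ω.1 α β x ∂μ = -∫ x, brk Ω.1 β α x ∂μ := by
  rw [← integral_neg]
  exact integral_congr_ae (Filter.Eventually.of_forall fun x => by
    have := brk_swap Ω.1 α β x
    simp only
    linarith)

variable (μ) in
/-- The pairing `∫ α ∧ β` of closed `1`-forms: the product of the density `(α ∧ β) / Ω` with the
area measure. -/
noncomputable def pairing (hΩ : ∀ x, Ω.1 x ≠ 0) : Z1 Plane S →ₗ[ℝ] Z1 Plane S →ₗ[ℝ] ℝ :=
  LinearMap.mk₂ ℝ (fun α β => ∫ x, brk Ω.1 α.1.1 β.1.1 x ∂μ)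
    (fun α α' β => by
      rw [← integral_add (integrable_brk hΩ _ _) (integrable_brk hΩ _ _)]
      exact integral_congr_ae (Filter.Eventually.of_forall fun x => brk_add_left Ω.1 _ _ _ x))
    (fun c α β => by
      rw [smul_eq_mul, ← integral_const_mul]
      exact integral_congr_ae (Filter.Eventually.of_forall fun x => brk_smul_left Ω.1 _ _ _ x))
    (fun α β β' => by
      rw [← integral_add (integrable_brk hΩ _ _) (integrable_brk hΩ _ _)]
      exact integral_congr_ae (Filter.Eventually.of_forall fun x => brk_add_right Ω.1 _ _ _ x))
    (fun c α β => by
      rw [smul_eq_mul, ← integral_const_mul]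
      exact integral_congr_ae (Filter.Eventually.of_forall fun x => brk_smul_right Ω.1 _ _ _ x))

theorem pairing_apply (hΩ : ∀ x, Ω.1 x ≠ 0) (α β : Z1 Plane S) :
    pairing μ hΩ α β = ∫ x, brk Ω.1 α.1.1 β.1.1 x ∂μ := rfl

theorem pairing_eq_zero_left (hμ : IsAreaMeasure Ω.1 μ) (hΩ : ∀ x, Ω.1 x ≠ 0) {α : Z1 Plane S}
    (hα : α ∈ (LinearMap.range (d Plane S 0)).comap (Z1 Plane S).subtype) (β : Z1 Plane S) :
    pairing μ hΩ α β = 0 := by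
  obtain ⟨γ, hγ⟩ := hα
  rw [pairing_apply, ← integral_brk_dfun_of_closed hμ Ω.2 hΩ (contMDiff_val γ) β.1.2
    (extD_of_mem_Z1 β)]
  exact integral_congr_ae (Filter.Eventually.of_forall fun x =>
    brk_congr Ω.1 (dfun_val_eq hγ x).symm rfl)

theorem pairing_eq_zero_right (hμ : IsAreaMeasure Ω.1 μ) (hΩ : ∀ x, Ω.1 x ≠ 0) {α : Z1 Plane S}
    (hα : α ∈ (LinearMap.range (d Plane S 0)).comap (Z1 Plane S).subtype) (β : Z1 Plane S) :
    pairing μ hΩ β α = 0 := by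
  rw [pairing_apply, integral_brk_swap, ← pairing_apply hΩ, pairing_eq_zero_left hμ hΩ hα, neg_zero]

/-- The bilinear form induced on a quotient. -/
noncomputable def quotientForm {V : Type*} [AddCommGroup V] [Module ℝ V] (p : Submodule ℝ V)
    (B : V →ₗ[ℝ] V →ₗ[ℝ] ℝ) (hl : ∀ v ∈ p, ∀ w, B v w = 0) (hr : ∀ v ∈ p, ∀ w, B w v = 0) :
    (V ⧸ p) →ₗ[ℝ] (V ⧸ p) →ₗ[ℝ] ℝ :=
  (p.liftQ (p.liftQ B fun v hv => LinearMap.ext (hl v hv)).flip fun v hv =>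
    LinearMap.ext fun u => by
      obtain ⟨w, rfl⟩ := Submodule.Quotient.mk_surjective p u
      exact hr v hv w).flip

/-- The pairing `∫ α ∧ β` on cohomology. -/
noncomputable def pairingH1 (hμ : IsAreaMeasure Ω.1 μ) (hΩ : ∀ x, Ω.1 x ≠ 0) :
    H1 Plane S →ₗ[ℝ] H1 Plane S →ₗ[ℝ] ℝ :=
  quotientForm _ (pairing μ hΩ) (fun _ hv w => pairing_eq_zero_left hμ hΩ hv w)
    fun _ hv w => pairing_eq_zero_right hμ hΩ hv w

theorem H1.mk_surjective : Function.Surjective (H1.mk : Z1 Plane S → H1 Plane S) :=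
  Submodule.Quotient.mk_surjective _

/-- Poincaré duality for the closed surface. -/
theorem pairingH1_injective (hμ : IsAreaMeasure Ω.1 μ) (hΩ : ∀ x, Ω.1 x ≠ 0) :
    Function.Injective (pairingH1 hμ hΩ) := by
  refine (injective_iff_map_eq_zero _).2 fun u hu => ?_
  obtain ⟨α, rfl⟩ := Submodule.Quotient.mk_surjective _ u
  obtain ⟨g, hg⟩ := exists_primitive_of_pairing hμ Ω.2 hΩ isOpen_univ (fun x _ => α.1.2 x)
    (fun x _ => extD_of_mem_Z1 α x) fun β hβ hβ0 _ =>
      LinearMap.congr_fun hu (H1.mk (⟨⟨β, hβ⟩, LinearMap.mem_ker.2 (Subtype.ext (funext hβ0))⟩ :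
        Z1 Plane S))
  exact mk_eq_of_dfun (α := α) (β := 0) (fun x => (hg x trivial).1) fun x =>
    (hg x trivial).2.trans (sub_zero _).symm

/-- A functional that satisfies the cyclic identity with a nondegenerate bilinear form on a space
of dimension at least three vanishes. -/
theorem eq_zero_of_cyclic {V : Type*} [AddCommGroup V] [Module ℝ V] (hV : 2 < Module.finrank ℝ V)
    (B : V →ₗ[ℝ] V →ₗ[ℝ] ℝ) (hB : Function.Injective B) (c : V →ₗ[ℝ] ℝ)
    {Z : Type*} {π : Z → V} (hπ : Function.Surjective π)
    (h : ∀ u v w, c (π u) * B (π v) (π w) + c (π v) * B (π w) (π u) +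
      c (π w) * B (π u) (π v) = 0) : c = 0 := by
  have h : ∀ u v w, c u * B v w + c v * B w u + c w * B u v = 0 := fun u v w => by
    obtain ⟨α, rfl⟩ := hπ u
    obtain ⟨β, rfl⟩ := hπ v
    obtain ⟨γ, rfl⟩ := hπ w
    exact h α β γ
  have : Module.Finite ℝ V := Module.finite_of_finrank_pos (by omega)
  refine LinearMap.ext fun u => by_contra fun hu => ?_
  have hT : LinearMap.ker (c.prod (B u)) ≠ ⊥ :=
    LinearMap.ker_ne_bot_of_finrank_lt (by simpa using hV)
  obtain ⟨v, hv, hv0⟩ := (Submodule.ne_bot_iff _).1 hT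
  have h1 : c v = 0 := congrArg Prod.fst (LinearMap.mem_ker.1 hv)
  have h2 : B u v = 0 := congrArg Prod.snd (LinearMap.mem_ker.1 hv)
  refine hv0 (hB ?_)
  rw [map_zero]
  refine LinearMap.ext fun w => ?_
  have h3 := h u v w
  rw [h1, h2, zero_mul, mul_zero, add_zero, add_zero] at h3
  exact (mul_eq_zero.1 h3).resolve_left hu

end Pairing

section Endpoint

open MeasureTheory

variable {S : Type} [TopologicalSpace S] [ChartedSpace Plane S] [IsManifold 𝓘(ℝ, Plane) ∞ S]
  [T2Space S] [CompactSpace S] {Ω : Omega Plane S 2} {Φ Ψ : ℝ → Diff Plane S}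

/-- The integrals of closed forms along the trajectory of a point. -/
noncomputable def trackIntLin (hΦ : IsSympIsotopy Ω Φ) (x : S) : Z1 Plane S →ₗ[ℝ] ℝ where
  toFun α := trackInt α.1.1 Φ (1, x)
  map_add' α β := by
    have hi : ∀ γ : Z1 Plane S, IntervalIntegrable (fun u => trackRate γ.1.1 Φ (u, x))
        volume 0 1 := fun γ =>
      (contDiff_slice (timeSmooth_trackRate hΦ γ.1.2 (extD_of_mem_Z1 γ)) x).continuous.intervalIntegrable
        0 1
    refine Eq.trans ?_ (intervalIntegral.integral_add (hi α) (hi β))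
    refine intervalIntegral.integral_congr fun u _ => ?_
    exact congrArg (fun L : Plane →L[ℝ] ℝ => L (trackVel Φ u x)) (map_add cov _ _)
  map_smul' c α := by
    refine Eq.trans ?_ (intervalIntegral.integral_const_mul c _)
    refine intervalIntegral.integral_congr fun u _ => ?_
    exact congrArg (fun L : Plane →L[ℝ] ℝ => L (trackVel Φ u x)) (map_smul cov c _)

variable [ConnectedSpace S]

theorem trackInt_sub_eq (hΦ : IsSympIsotopy Ω Φ) (hΨ : IsSympIsotopy Ω Ψ) (h : Φ 1 = Ψ 1)
    (α : Z1 Plane S) (x y : S) :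
    trackInt α.1.1 Φ (1, x) - trackInt α.1.1 Ψ (1, x) =
      trackInt α.1.1 Φ (1, y) - trackInt α.1.1 Ψ (1, y) := by
  have h1 := contMDiff_slice (timeSmooth_trackInt hΦ α.1.2 (extD_of_mem_Z1 α)) 1
  have h2 := contMDiff_slice (timeSmooth_trackInt hΨ α.1.2 (extD_of_mem_Z1 α)) 1
  refine eq_of_dfun_eq_zero (f := fun x => trackInt α.1.1 Φ (1, x) - trackInt α.1.1 Ψ (1, x))
    isOpen_univ (fun x _ => (h1 x).sub (h2 x)) (fun x _ => ?_) isPreconnected_univ subset_rfl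
    trivial trivial
  rw [dfun_sub (h1 x) (h2 x), dfun_trackInt hΦ α.1.2 (extD_of_mem_Z1 α),
    dfun_trackInt hΨ α.1.2 (extD_of_mem_Z1 α), h, sub_self]

variable [MeasurableSpace S] [BorelSpace S] {μ : Measure S} [IsFiniteMeasure μ]

theorem integral_brk_pull_pull (hμ : IsAreaMeasure Ω.1 μ) (hΩ : ∀ x, Ω.1 x ≠ 0) {φ : Diff Plane S}
    (hφ : φ ∈ Symp Ω) {β γ : Form Plane S 1} (hβ : ∀ x, SmoothAt β x) (hγ : ∀ x, SmoothAt γ x) :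
    ∫ y, brk Ω.1 (pull φ β) (pull φ γ) y ∂μ = ∫ y, brk Ω.1 β γ y ∂μ := by
  rw [← integral_comp_symp hμ (congrArg Subtype.val (inv_mem hφ)) (continuous_brk Ω.2 hΩ hβ hγ)]
  exact integral_congr_ae (Filter.Eventually.of_forall fun y => brk_pull_symp hφ hΩ _ _ y)

/-- The end point of an isotopy acts trivially on cohomology. -/
theorem integral_brk_pull_left (hμ : IsAreaMeasure Ω.1 μ) (hΩ : ∀ x, Ω.1 x ≠ 0)
    (hΨ : IsSympIsotopy Ω Ψ) {γ α : Form Plane S 1} (hγ : ∀ x, SmoothAt γ x)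
    (hγ0 : ∀ x, extD γ x = 0) (hα : ∀ x, SmoothAt α x) (hα0 : ∀ x, extD α x = 0) :
    ∫ y, brk Ω.1 (pull (Ψ 1) γ) α y ∂μ = ∫ y, brk Ω.1 γ α y ∂μ := by
  have hp : ∀ x, SmoothAt (pull (Ψ 1) γ) x := fun x => (hγ _).pull ((Ψ 1).contMDiff x)
  rw [← sub_eq_zero, ← integral_sub (integrable_of_continuous (continuous_brk Ω.2 hΩ hp hα))
    (integrable_of_continuous (continuous_brk Ω.2 hΩ hγ hα))]
  refine Eq.trans (integral_congr_ae (Filter.Eventually.of_forall fun y => ?_))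
    (integral_brk_dfun_of_closed hμ Ω.2 hΩ (contMDiff_slice (timeSmooth_trackInt hΨ hγ hγ0) 1)
      hα hα0)
  simp only
  rw [← brk_sub_left]
  exact brk_congr Ω.1 (dfun_trackInt hΨ hγ hγ0 1 y).symm rfl

/-- If the integrals of closed forms along the trajectories of two isotopies with the same end point
differ by constants, then these constants satisfy the cyclic identity with the pairing. -/
theorem cyclic_of_trackInt_eq_add (hμ : IsAreaMeasure Ω.1 μ) (hΩ : ∀ x, Ω.1 x ≠ 0)
    (hΦ : IsSympIsotopy Ω Φ) (hΨ : IsSympIsotopy Ω Ψ) (h : Φ 1 = Ψ 1) {α β γ : Form Plane S 1}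
    (hα : ∀ x, SmoothAt α x) (hα0 : ∀ x, extD α x = 0) (hβ : ∀ x, SmoothAt β x)
    (hβ0 : ∀ x, extD β x = 0) (hγ : ∀ x, SmoothAt γ x) (hγ0 : ∀ x, extD γ x = 0) {a b c : ℝ}
    (ha : ∀ y, trackInt α Φ (1, y) = trackInt α Ψ (1, y) + a)
    (hb : ∀ y, trackInt β Φ (1, y) = trackInt β Ψ (1, y) + b)
    (hc : ∀ y, trackInt γ Φ (1, y) = trackInt γ Ψ (1, y) + c) :
    a * ∫ y, brk Ω.1 β γ y ∂μ + b * ∫ y, brk Ω.1 γ α y ∂μ + c * ∫ y, brk Ω.1 α β y ∂μ = 0 := by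
  have hp : ∀ {η : Form Plane S 1}, (∀ x, SmoothAt η x) → ∀ x, SmoothAt (pull (Ψ 1) η) x :=
    fun hη x => (hη _).pull ((Ψ 1).contMDiff x)
  have hi : ∀ {δ ε ζ : Form Plane S 1}, (∀ x, SmoothAt δ x) → (∀ x, extD δ x = 0) →
      (∀ x, SmoothAt ε x) → (∀ x, SmoothAt ζ x) →
      Integrable (fun y => trackInt δ Ψ (1, y) * brk Ω.1 ε ζ y) μ := fun hδ hδ0 hε hζ =>
    integrable_of_continuous ((contMDiff_slice (timeSmooth_trackInt hΨ hδ hδ0) 1).continuous.mul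
      (continuous_brk Ω.2 hΩ hε hζ))
  have hj : ∀ {ε ζ : Form Plane S 1} (r : ℝ), (∀ x, SmoothAt ε x) → (∀ x, SmoothAt ζ x) →
      Integrable (fun y => r * brk Ω.1 ε ζ y) μ := fun r hε hζ =>
    (integrable_of_continuous (continuous_brk Ω.2 hΩ hε hζ)).const_mul r
  have k1 := integral_trackInt_cyclic hμ hΩ hΦ hα hα0 hβ hβ0 hγ hγ0
  have k2 := integral_trackInt_cyclic hμ hΩ hΨ hα hα0 hβ hβ0 hγ hγ0
  rw [h] at k1
  have j1 := hi hα hα0 (hp hβ) (hp hγ)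
  have j2 := hi hβ hβ0 (hp hγ) hα
  have j3 := hi hγ hγ0 hα hβ
  have i1 := hj a (hp hβ) (hp hγ)
  have i2 := hj b (hp hγ) hα
  have i3 := hj c hα hβ
  rw [← integral_brk_pull_pull hμ hΩ (hΨ.mem 1) hβ hγ,
    ← integral_brk_pull_left hμ hΩ hΨ hγ hγ0 hα hα0, ← integral_const_mul, ← integral_const_mul,
    ← integral_const_mul]
  have k3 := integral_add ((j1.add j2).add j3) ((i1.add i2).add i3)
  have k4 : ∀ y, trackInt α Φ (1, y) * brk Ω.1 (pull (Ψ 1) β) (pull (Ψ 1) γ) y +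
      trackInt β Φ (1, y) * brk Ω.1 (pull (Ψ 1) γ) α y + trackInt γ Φ (1, y) * brk Ω.1 α β y =
      (trackInt α Ψ (1, y) * brk Ω.1 (pull (Ψ 1) β) (pull (Ψ 1) γ) y +
      trackInt β Ψ (1, y) * brk Ω.1 (pull (Ψ 1) γ) α y + trackInt γ Ψ (1, y) * brk Ω.1 α β y) +
      (a * brk Ω.1 (pull (Ψ 1) β) (pull (Ψ 1) γ) y + b * brk Ω.1 (pull (Ψ 1) γ) α y +
      c * brk Ω.1 α β y) := by
    intro y
    rw [ha, hb, hc]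
    ring
  have k5 := (integral_congr_ae (Filter.Eventually.of_forall k4)).symm.trans k1
  have k6 := k3.symm.trans k5
  have k7 := integral_add (i1.add i2) i3
  have k8 := integral_add i1 i2
  simp only [Pi.add_apply] at k6 k7 k8
  linarith

/-- The difference of the integrals of closed forms along the trajectories of a point under two
isotopies with the same end point. -/
noncomputable def trackIntDiff (hΦ : IsSympIsotopy Ω Φ) (hΨ : IsSympIsotopy Ω Ψ) (h : Φ 1 = Ψ 1)
    (x : S) : H1 Plane S →ₗ[ℝ] ℝ :=
  Submodule.liftQ _ (trackIntLin hΦ x - trackIntLin hΨ x) (by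
    rintro β ⟨γ, hγ⟩
    have h1 : β.1.1 = dfun fun x => γ.1 x ![] := funext fun x => (dfun_val_eq hγ x).symm
    change trackInt β.1.1 Φ (1, x) - trackInt β.1.1 Ψ (1, x) = 0
    rw [h1, trackInt_dfun hΦ (contMDiff_val γ), trackInt_dfun hΨ (contMDiff_val γ), h, sub_self])

/-- On a surface of genus at least two, the integrals of closed forms along the trajectories depend
only on the end point of the isotopy. -/
theorem trackInt_eq_of_endpoint (hμ : IsAreaMeasure Ω.1 μ) (hΩ : ∀ x, Ω.1 x ≠ 0)
    (hV : 2 < Module.finrank ℝ (H1 Plane S)) (hΦ : IsSympIsotopy Ω Φ) (hΨ : IsSympIsotopy Ω Ψ)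
    (h : Φ 1 = Ψ 1) (α : Z1 Plane S) (x : S) :
    trackInt α.1.1 Φ (1, x) = trackInt α.1.1 Ψ (1, x) := by
  obtain ⟨c, hc⟩ : ∃ c : H1 Plane S →ₗ[ℝ] ℝ, ∀ (β : Z1 Plane S) y, trackInt β.1.1 Φ (1, y) =
      trackInt β.1.1 Ψ (1, y) + c (H1.mk β) := by
    refine ⟨trackIntDiff hΦ hΨ h x, fun β y => ?_⟩
    have h1 := trackInt_sub_eq hΦ hΨ h β y x
    have h2 : trackIntDiff hΦ hΨ h x (H1.mk β) =
      trackInt β.1.1 Φ (1, x) - trackInt β.1.1 Ψ (1, x) := rfl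
    rw [h2, ← h1]
    ring
  have key : ∀ α β γ : Z1 Plane S, c (H1.mk α) * pairingH1 hμ hΩ (H1.mk β) (H1.mk γ) +
      c (H1.mk β) * pairingH1 hμ hΩ (H1.mk γ) (H1.mk α) +
      c (H1.mk γ) * pairingH1 hμ hΩ (H1.mk α) (H1.mk β) = 0 := fun α β γ =>
    cyclic_of_trackInt_eq_add hμ hΩ hΦ hΨ h α.1.2 (extD_of_mem_Z1 α) β.1.2
      (extD_of_mem_Z1 β) γ.1.2 (extD_of_mem_Z1 γ) (hc α) (hc β) (hc γ)
  have h0 : c = 0 := eq_zero_of_cyclic hV (pairingH1 hμ hΩ) (pairingH1_injective hμ hΩ) c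
    H1.mk_surjective key
  rw [hc α x, h0, LinearMap.zero_apply, add_zero]

end Endpoint

/-! ### The crossed homomorphism -/

section CrossedHom

open MeasureTheory TopologicalSpace

theorem fluxC_mul {M : Type*} [TopologicalSpace M] [T2Space M] [ChartedSpace Plane M]
    [IsManifold 𝓘(ℝ, Plane) ∞ M] {Ω : Omega Plane M 2} {lam : Omega Plane M 1}
    (hlam : d Plane M 1 lam = -Ω) (φ ψ : SympC Ω) :
    fluxC lam hlam (φ * ψ) = fluxC lam hlam φ + actH1c Plane M φ.1 (fluxC lam hlam ψ) := by
  refine congrArg H1c.mk (Subtype.ext ?_)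
  change (φ.1 * ψ.1)⁻¹.pull lam - lam =
    (φ.1⁻¹.pull lam - lam) + φ.1⁻¹.pull (ψ.1⁻¹.pull lam - lam)
  rw [mul_inv_rev, Diff.pull_mul, map_sub]
  abel

variable {S : Type} [TopologicalSpace S] [T2Space S] [CompactSpace S] [ConnectedSpace S]
  [ChartedSpace Plane S] [IsManifold 𝓘(ℝ, Plane) ∞ S] {Ω : Omega Plane S 2} {U : Opens S}
  [MeasurableSpace S] [BorelSpace S] {μ : Measure S} [IsFiniteMeasure μ]

/-- The class of the flux form of an isotopy is determined by its pairings, which are the total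
integrals along the trajectories. -/
theorem hasFlux_of_pairing (hμ : IsAreaMeasure Ω.1 μ) (hΩ : ∀ x, Ω.1 x ≠ 0)
    (hU : IsClosedDisk Plane ((U : Set S)ᶜ)) {Φ : ℝ → Diff Plane S} (hΦ : IsSympIsotopy Ω Φ)
    (σ : Z1 Plane S) (h : ∀ a : Z1c Plane U, ∫ x, brk Ω.1 σ.1.1 (extZero a.1.1) x ∂μ =
      -∫ x, trackInt (extZero a.1.1) Φ (1, x) ∂μ) : HasFlux Ω Φ (H1.mk σ) := by
  refine ⟨⟨⟨fluxForm Ω Φ, smoothAt_fluxForm hΦ hΩ⟩, LinearMap.mem_ker.2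
    (Subtype.ext (funext (extD_fluxForm hμ hΩ hΦ)))⟩, rfl, pairingH1_injective hμ hΩ
    (LinearMap.ext fun w => ?_)⟩
  obtain ⟨u, rfl⟩ := extH1c_surjective hU w
  obtain ⟨a, rfl⟩ := Submodule.Quotient.mk_surjective _ u
  change ∫ x, brk Ω.1 (fluxForm Ω Φ) (extZ1c a).1.1 x ∂μ =
    ∫ x, brk Ω.1 σ.1.1 (extZ1c a).1.1 x ∂μ
  rw [integral_brk_fluxForm hμ hΩ hΦ (extZ1c a).1.2 (extD_of_mem_Z1 _)]
  exact (h a).symm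

end CrossedHom

section Independence

open MeasureTheory TopologicalSpace

variable {S : Type} [TopologicalSpace S] [T2Space S] [CompactSpace S]
  [ChartedSpace Plane S] [IsManifold 𝓘(ℝ, Plane) ∞ S] {Ω : Omega Plane S 2} {U : Opens S}

/-- On the identity component the extended flux is the flux of every isotopy. -/
theorem isFlux_fluxC [ConnectedSpace S] (hΩ : ∀ x, Ω.1 x ≠ 0)
    (hV : 2 < Module.finrank ℝ (H1 Plane S)) (hU : IsClosedDisk Plane ((U : Set S)ᶜ))
    {lam : Omega Plane U 1} (hlam : d Plane U 1 lam = -restrictForm U Ω)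
    (φ : SympC (restrictForm U Ω)) (hφ : φ.1 ∈ Symp0c (restrictForm U Ω)) :
    IsFlux Ω (extSymp U Ω φ).1 (extH1c U (fluxC lam hlam φ)) := by
  let : MeasurableSpace S := borel S
  have : BorelSpace S := ⟨rfl⟩
  obtain ⟨μ, _, hμ⟩ := exists_areaMeasure Ω.2
  obtain ⟨Φ, hΦ, ⟨K, hK, hfix⟩, h1⟩ := hφ
  have hΨ := isSympIsotopy_extDiff hΦ hK hfix
  have hend : extDiff (S := S) (Φ 1) ⟨K, hK, hfix 1⟩ = (extSymp U Ω φ).1 :=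
    Diffeomorph.ext fun x => by
      change extId (Φ 1) x = extId φ.1 x
      rw [h1]
  refine ⟨⟨_, hΨ, hend⟩, fun Ψ' hΨ' h' => ?_⟩
  refine hasFlux_of_pairing hμ hΩ hU hΨ' (extZ1c ⟨_, pull_inv_sub_mem_Z1c hlam φ⟩) fun a => ?_
  have h2 := integral_brk_extZero_flux hμ hΩ hΦ hK hfix hlam a.2
  rw [h1] at h2
  refine h2.trans (congrArg Neg.neg (integral_congr_ae (Filter.Eventually.of_forall fun x => ?_)))
  exact trackInt_eq_of_endpoint hμ hΩ hV hΨ hΨ' (hend.trans h'.symm) (extZ1c a) x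

theorem tsupport_extZero_subset {a : Omega Plane U 1} (ha : a ∈ OmegaC Plane U 1) :
    tsupport (extZero a.1 : Form Plane S 1) ⊆ U := by
  obtain ⟨K, hK, haK⟩ := ha
  have hc : IsClosed (Subtype.val '' K : Set S) := (hK.image continuous_subtype_val).isClosed
  refine (closure_minimal (fun x hx => ?_) hc).trans ?_
  · by_contra hxK
    refine hx ?_
    by_cases hxU : x ∈ U
    · exact extZero_eq_zero (q := ⟨x, hxU⟩) (haK _ fun h => hxK ⟨_, h, rfl⟩)
    · exact extZero_of_notMem _ hxU
  · rintro _ ⟨q, -, rfl⟩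
    exact q.2

/-- The restriction of a closed form with support in `U`. -/
theorem exists_extZero_eq {β : Form Plane S 1} (hβ : ∀ x, SmoothAt β x)
    (hβ0 : ∀ x, extD β x = 0) (hs : tsupport β ⊆ U) :
    ∃ a : Z1c Plane U, extZero a.1.1 = β := by
  have hβU : ∀ x ∉ U, β x = 0 := fun x hx => image_eq_zero_of_notMem_tsupport fun h => hx (hs h)
  refine ⟨⟨restrictForm U ⟨β, hβ⟩, ?_, _, isCompact_preimage_compl
    (isClosed_tsupport β).isOpen_compl (Set.compl_subset_compl.2 hs), fun q hq => ?_⟩,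
    funext fun x => ?_⟩
  · have h0 : d Plane S 1 ⟨β, hβ⟩ = 0 := Subtype.ext (funext hβ0)
    exact LinearMap.mem_ker.2 (by rw [d_restrictForm, h0, map_zero])
  · have hq' : (q : S) ∉ tsupport β := by simpa using hq
    change pull (Subtype.val : U → S) β q = 0
    rw [pull, image_eq_zero_of_notMem_tsupport hq']
    rfl
  · by_cases hx : x ∈ U
    · exact extZero_pull_val β hx
    · exact (extZero_of_notMem _ hx).trans (hβU x hx).symm

variable [MeasurableSpace S] [BorelSpace S] {μ : Measure S} [IsFiniteMeasure μ]

/-- A closed form on `U` pairs to zero with the differentials of compactly supported functions. -/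
theorem integral_brk_extZero_eq_zero (hμ : IsAreaMeasure Ω.1 μ) (hΩ : ∀ x, Ω.1 x ≠ 0)
    (m : Z1 Plane U) {γ : Omega Plane U 0} (hγ : γ ∈ OmegaC Plane U 0) :
    ∫ x, brk Ω.1 (extZero m.1.1) (extZero (extD γ.1)) x ∂μ = 0 := by
  obtain ⟨K, hK, hγK⟩ := id hγ
  set C : Set S := Subtype.val '' K with hCdef
  have hC : IsClosed C := (hK.image continuous_subtype_val).isClosed
  have hCU : C ⊆ U := by
    rintro _ ⟨q, -, rfl⟩
    exact q.2
  obtain ⟨Λ, hΛ, N, hN, hCN, hNU, hΛN⟩ := exists_global_form m.1.2 hC hCU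
  have hF0 : ∀ x ∉ C, (extZero γ.1 : Form Plane S 0) x = 0 := by
    intro x hx
    by_cases hxU : x ∈ U
    · exact extZero_eq_zero (q := ⟨x, hxU⟩) (hγK _ fun h => hx ⟨_, h, rfl⟩)
    · exact extZero_of_notMem _ hxU
  set F : S → ℝ := fun x => (extZero γ.1 : Form Plane S 0) x ![] with hF
  have hFs : ContMDiff 𝓘(ℝ, Plane) 𝓘(ℝ, ℝ) ∞ F :=
    contMDiff_val ⟨extZero γ.1, smoothAt_extZero hγ⟩
  have hFd : dfun F = (extZero (extD γ.1) : Form Plane S 1) := by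
    rw [dfun, hF, ← eq_fun0, extD_extZero hγ]
  have hFC : ∀ x ∉ C, (dfun F : Form Plane S 1) x = 0 := by
    intro x hx
    refine (dfun_congr (g := fun _ => (0 : ℝ)) ?_).trans (dfun_const 0 x)
    filter_upwards [hC.isOpen_compl.mem_nhds hx] with y hy
    exact congrArg (fun A => A ![]) (hF0 y hy)
  have h1 : ∀ x, brk Ω.1 (extZero m.1.1) (extZero (extD γ.1)) x = -brk Ω.1 (dfun F) Λ x := by
    intro x
    rw [← hFd, ← brk_swap]
    by_cases hx : x ∈ C
    · exact brk_congr Ω.1 (hΛN x (hCN hx)).symm rfl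
    · rw [brk_eq_zero_right Ω.1 (hFC x hx), brk_eq_zero_right Ω.1 (hFC x hx)]
  have h2 : ∀ x, F x * curl Ω.1 Λ x = 0 := by
    intro x
    by_cases hx : x ∈ C
    · have h3 : Λ =ᶠ[𝓝 x] extZero m.1.1 := by
        filter_upwards [hN.mem_nhds (hCN hx)] with y hy using hΛN y hy
      have h4 : extD Λ x = 0 := by
        rw [extD_congr h3, extD_extZero_of_mem m.1.2 (hCU hx)]
        exact extZero_eq_zero (q := ⟨x, hCU hx⟩) (extD_of_mem_Z1 m _)
      rw [curl_eq_zero h4, mul_zero]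
    · have h5 : F x = 0 := congrArg (fun A => A ![]) (hF0 x hx)
      rw [h5, zero_mul]
  simp only [h1]
  rw [integral_neg, integral_brk_dfun hμ Ω.2 hΩ hFs hΛ]
  simp only [h2, integral_zero, neg_zero]

theorem finite_of_lt_finrank {V : Type*} [AddCommGroup V] [Module ℝ V] {n : ℕ}
    (h : n < Module.finrank ℝ V) : Module.Finite ℝ V :=
  Module.finite_of_finrank_pos (by omega)

theorem pairingH1_surjective (hμ : IsAreaMeasure Ω.1 μ) (hΩ : ∀ x, Ω.1 x ≠ 0)
    [Module.Finite ℝ (H1 Plane S)] : Function.Surjective (pairingH1 hμ hΩ) :=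
  (LinearMap.injective_iff_surjective_of_finrank_eq_finrank Subspace.dual_finrank_eq.symm).1
    (pairingH1_injective hμ hΩ)

end Independence

section Restriction

open MeasureTheory TopologicalSpace

variable {S : Type} [TopologicalSpace S] [T2Space S] [CompactSpace S]
  [ChartedSpace Plane S] [IsManifold 𝓘(ℝ, Plane) ∞ S] {Ω : Omega Plane S 2} {U : Opens S}

/-- The restriction `H¹(S) → H¹(U)` is surjective: every closed form on the complement of the disk is
the sum of a closed form of the surface and an exact form. -/
theorem exists_closed_extension (hΩ : ∀ x, Ω.1 x ≠ 0)
    [Module.Finite ℝ (H1 Plane S)] (hU : IsClosedDisk Plane ((U : Set S)ᶜ)) (m : Z1 Plane U) :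
    ∃ (ν : Z1 Plane S) (g : S → ℝ), ∀ x ∈ U, ContMDiffAt 𝓘(ℝ, Plane) 𝓘(ℝ, ℝ) ∞ g x ∧
      dfun g x = extZero m.1.1 x - ν.1.1 x := by
  let : MeasurableSpace S := borel S
  have : BorelSpace S := ⟨rfl⟩
  obtain ⟨μ, _, hμ⟩ := exists_areaMeasure Ω.2
  have hms : ∀ x ∈ (U : Set S), SmoothAt (extZero m.1.1) x := fun x hx =>
    smoothAt_extZero_of_mem m.1.2 hx
  have hi : ∀ a : Z1c Plane U, Integrable (brk Ω.1 (extZero m.1.1) (extZ1c a).1.1) μ := fun a =>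
    integrable_of_continuous (contMDiff_brk_of_tsupport Ω.2 hΩ hms (extZ1c a).1.2
      (tsupport_extZero_subset a.2.2)).continuous
  let P : Z1c Plane U →ₗ[ℝ] ℝ :=
    { toFun := fun a => ∫ x, brk Ω.1 (extZero m.1.1) (extZ1c a).1.1 x ∂μ
      map_add' := fun a b => by
        rw [map_add, ← integral_add (hi a) (hi b)]
        exact integral_congr_ae (Filter.Eventually.of_forall fun x => brk_add_right Ω.1 _ _ _ x)
      map_smul' := fun c a => by
        rw [map_smul, RingHom.id_apply, smul_eq_mul, ← integral_const_mul]
        exact integral_congr_ae (Filter.Eventually.of_forall fun x => brk_smul_right Ω.1 _ _ _ x) }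
  obtain ⟨F, hF⟩ := exists_comp_eq_of_ker_le (V := Z1c Plane U) (W := H1 Plane S)
    ((extH1c U).comp (Submodule.mkQ _)) P fun a ha => by
      have h1 : (Submodule.mkQ _ a : H1c Plane U) = 0 :=
        (injective_iff_map_eq_zero _).1 (extH1c_injective hU) _ ha
      obtain ⟨γ, hγ, hγa⟩ := (Submodule.Quotient.mk_eq_zero _).1 h1
      have h2 : a.1.1 = extD γ.1 := congrArg Subtype.val hγa.symm
      change ∫ x, brk Ω.1 (extZero m.1.1) (extZero a.1.1) x ∂μ = 0
      rw [h2]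
      exact integral_brk_extZero_eq_zero hμ hΩ m hγ
  obtain ⟨w, hw⟩ := pairingH1_surjective hμ hΩ F
  obtain ⟨ν, rfl⟩ := H1.mk_surjective w
  have hσ : ∀ x ∈ (U : Set S), SmoothAt (extZero m.1.1 + (-ν).1.1) x := fun x hx =>
    (hms x hx).add ((-ν).1.2 x)
  obtain ⟨g, hg⟩ := exists_primitive_of_pairing (σ := extZero m.1.1 + (-ν).1.1) hμ Ω.2 hΩ U.isOpen
    hσ (fun x hx => by
      rw [extD_add_apply (hms x hx) ((-ν).1.2 x), extD_of_mem_Z1, add_zero,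
        extD_extZero_of_mem m.1.2 hx]
      exact extZero_eq_zero (q := ⟨x, hx⟩) (extD_of_mem_Z1 m _)) fun β hβ hβ0 hs => by
    obtain ⟨a, rfl⟩ := exists_extZero_eq hβ hβ0 hs
    have h1 : ∫ x, brk Ω.1 ν.1.1 (extZero a.1.1) x ∂μ =
        ∫ x, brk Ω.1 (extZero m.1.1) (extZero a.1.1) x ∂μ :=
      (LinearMap.congr_fun hw _).trans (hF a)
    have h2 : ∀ x, brk Ω.1 (extZero m.1.1 + (-ν).1.1) (extZero a.1.1) x =
        brk Ω.1 (extZero m.1.1) (extZero a.1.1) x - brk Ω.1 ν.1.1 (extZero a.1.1) x := fun x => by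
      rw [← brk_sub_left]
      exact brk_congr Ω.1 (sub_eq_add_neg _ _).symm rfl
    simp only [h2]
    exact (integral_sub (hi a) (integrable_brk hΩ ν.1 (extZ1c a).1)).trans (sub_eq_zero.2 h1.symm)
  exact ⟨ν, g, fun x hx => ⟨(hg x hx).1, (hg x hx).2.trans (sub_eq_add_neg _ _).symm⟩⟩

end Restriction

/-! ### The class in group cohomology -/

section Cocycle

open TopologicalSpace

variable {S : Type} [TopologicalSpace S] [T2Space S] [CompactSpace S]
  [ChartedSpace Plane S] [IsManifold 𝓘(ℝ, Plane) ∞ S] {Ω : Omega Plane S 2} {U : Opens S}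

/-- Crossed homomorphisms that pairwise differ by principal ones have a common cohomology class. -/
theorem exists_cohomology_class {G V : Type} [Group G] [AddCommGroup V] [Module ℝ V]
    (ρ : Representation ℝ G V) {ι : Type} (F : ι → G → V)
    (hF : ∀ i a b, F i (a * b) = F i a + ρ a (F i b))
    (h : ∀ i j, ∃ y, ∀ a, ρ a y - y = F i a - F j a) :
    ∃ κ : groupCohomology.H1 (Rep.of ρ), ∀ i, ∃ z : groupCohomology.cocycles₁ (Rep.of ρ),
      (∀ a, z a = F i a) ∧ groupCohomology.H1π (Rep.of ρ) z = κ := by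
  have hz : ∀ i, F i ∈ groupCohomology.cocycles₁ (Rep.of ρ) := fun i =>
    (groupCohomology.mem_cocycles₁_iff _).2 fun a b => (hF i a b).trans (add_comm _ _)
  rcases isEmpty_or_nonempty ι with hι | ⟨⟨i₀⟩⟩
  · exact ⟨0, fun i => hι.elim i⟩
  · refine ⟨groupCohomology.H1π _ ⟨_, hz i₀⟩, fun i => ⟨⟨_, hz i⟩, fun _ => rfl, ?_⟩⟩
    obtain ⟨y, hy⟩ := h i i₀
    exact (groupCohomology.H1π_eq_iff _ _).2 ⟨y, funext hy⟩

/-- If `ν` extends the closed form `m` on `U` up to the differential of a function `g` on `U`, then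
for a compactly supported diffeomorphism the forms `ψ^* m - m` and `ψ^* ν - ν` differ by the
differential of `g - g ∘ ψ`, which vanishes outside `U`. -/
theorem exists_dfun_eq_pull_sub {m : Form Plane U 1} {ν : Form Plane S 1} {g : S → ℝ}
    (hg : ∀ x ∈ U, ContMDiffAt 𝓘(ℝ, Plane) 𝓘(ℝ, ℝ) ∞ g x ∧ dfun g x = extZero m x - ν x)
    {ψ : Diff Plane U} (hψ : ∃ K : Set U, IsCompact K ∧ ∀ x ∉ K, ψ x = x) :
    ∃ f : S → ℝ, ContMDiff 𝓘(ℝ, Plane) 𝓘(ℝ, ℝ) ∞ f ∧ ∀ x, dfun f x =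
      (pull (extDiff ψ hψ : S → S) ν x - ν x) - extZero (pull ψ m - m) x := by
  set Ψ : Diff Plane S := extDiff ψ hψ with hΨ
  have hnear : ∀ x ∉ U, (Ψ : S → S) =ᶠ[𝓝 x] id := fun x hx => by
    obtain ⟨K, hK, h⟩ := hψ
    exact extId_eventually hK h hx
  have hΨU : ∀ x ∈ U, Ψ x ∈ U := fun x hx => by
    have h1 : Ψ x = ψ ⟨x, hx⟩ := extId_val _ (⟨x, hx⟩ : U)
    rw [h1]
    exact Subtype.prop _
  have hgΨ : ∀ x ∈ U, ContMDiffAt 𝓘(ℝ, Plane) 𝓘(ℝ, ℝ) ∞ (g ∘ Ψ) x := fun x hx =>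
    (hg _ (hΨU x hx)).1.comp x (Ψ.contMDiff x)
  have h0 : ∀ x ∉ U, (fun y => g y - (g ∘ Ψ) y) =ᶠ[𝓝 x] fun _ => 0 := fun x hx => by
    filter_upwards [hnear x hx] with y hy
    simp [hy]
  refine ⟨fun y => g y - (g ∘ Ψ) y, fun x => ?_, fun x => ?_⟩
  · by_cases hx : x ∈ U
    · exact (hg x hx).1.sub (hgΨ x hx)
    · exact contMDiffAt_const.congr_of_eventuallyEq (h0 x hx)
  · by_cases hx : x ∈ U
    · have h1 : (dfun (g ∘ Ψ) : Form Plane S 1) x = pull Ψ (dfun g) x :=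
        extD_pull (smoothAt_fun0.2 (hg _ (hΨU x hx)).1) (Ψ.contMDiff x)
      have h2 : pull Ψ (dfun g) x = pull Ψ (extZero m) x - pull Ψ ν x := by
        rw [pull, (hg _ (hΨU x hx)).2]
        ext v
        rfl
      rw [dfun_sub (hg x hx).1 (hgΨ x hx), h1, h2, (hg x hx).2, extZero_sub,
        extZero_pull_diff hψ, Pi.sub_apply]
      abel
    · rw [dfun_congr (h0 x hx), dfun_const, pull_congr (hnear x hx), pull_id, sub_self,
        extZero_of_notMem _ hx, sub_self]

theorem fluxC_sub {lam lam' : Omega Plane U 1} (hlam : d Plane U 1 lam = -restrictForm U Ω)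
    (hlam' : d Plane U 1 lam' = -restrictForm U Ω) (φ : SympC (restrictForm U Ω)) :
    extH1c U (fluxC lam hlam φ) - extH1c U (fluxC lam' hlam' φ) =
      H1.mk (extZ1c ⟨_, pull_inv_sub_mem_Z1c hlam φ⟩ -
        extZ1c ⟨_, pull_inv_sub_mem_Z1c hlam' φ⟩) := rfl

/-- Extended fluxes for two primitives of `-Ω` on the complement of the disk differ by the coboundary
of a class that restricts to the class of the difference of the primitives. -/
theorem exists_coboundary (hΩ : ∀ x, Ω.1 x ≠ 0) [Module.Finite ℝ (H1 Plane S)]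
    (hU : IsClosedDisk Plane ((U : Set S)ᶜ)) {lam lam' : Omega Plane U 1}
    (hlam : d Plane U 1 lam = -restrictForm U Ω) (hlam' : d Plane U 1 lam' = -restrictForm U Ω) :
    ∃ y : H1 Plane S, ∀ φ : SympC (restrictForm U Ω), actH1OfSympC U Ω φ y - y =
      extH1c U (fluxC lam hlam φ) - extH1c U (fluxC lam' hlam' φ) := by
  obtain ⟨ν, g, hg⟩ := exists_closed_extension hΩ hU
    ⟨lam - lam', LinearMap.mem_ker.2 (by rw [map_sub, hlam, hlam', sub_self])⟩
  refine ⟨H1.mk ν, fun φ => ?_⟩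
  obtain ⟨f, hf, hfd⟩ := exists_dfun_eq_pull_sub hg (φ⁻¹).2.2
  refine Eq.trans ?_ (fluxC_sub hlam hlam' φ).symm
  refine mk_eq_of_dfun (α := (⟨((extSymp U Ω φ).1⁻¹).pull ν.1,
    ((extSymp U Ω φ).1⁻¹).pull_mem_Z1 ν.2⟩ : Z1 Plane S) - ν) hf fun x => (hfd x).trans ?_
  refine congrArg (_ - ·) ((congrFun (congrArg (extZero (S := S)) ?_) x).trans
    (congrFun (extZero_sub (φ.1⁻¹.pull lam - lam).1 (φ.1⁻¹.pull lam' - lam').1) x))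
  exact congrArg Subtype.val (show φ.1⁻¹.pull (lam - lam') - (lam - lam') =
    (φ.1⁻¹.pull lam - lam) - (φ.1⁻¹.pull lam' - lam') by rw [map_sub]; abel)

theorem extFlux_mul {lam : Omega Plane U 1} (hlam : d Plane U 1 lam = -restrictForm U Ω)
    (φ ψ : SympC (restrictForm U Ω)) : extH1c U (fluxC lam hlam (φ * ψ)) =
      extH1c U (fluxC lam hlam φ) + actH1OfSympC U Ω φ (extH1c U (fluxC lam hlam ψ)) := by
  exact (congrArg (extH1c U) (fluxC_mul hlam φ ψ)).trans (((extH1c U).map_add _ _).trans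
    (congrArg (extH1c U (fluxC lam hlam φ) + ·) (extH1c_actH1c φ _)))

/-- The class of the extended flux does not depend on the primitive of `-Ω`. -/
theorem exists_extFlux_class (hΩ : ∀ x, Ω.1 x ≠ 0) [Module.Finite ℝ (H1 Plane S)]
    (hU : IsClosedDisk Plane ((U : Set S)ᶜ)) :
    ∃ κ : groupCohomology.H1 (Rep.of (actH1OfSympC U Ω)),
      ∀ (lam : Omega Plane U 1) (hlam : d Plane U 1 lam = -restrictForm U Ω),
        ∃ z : groupCohomology.cocycles₁ (Rep.of (actH1OfSympC U Ω)),
          (∀ φ, z φ = extH1c U (fluxC lam hlam φ)) ∧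
          groupCohomology.H1π (Rep.of (actH1OfSympC U Ω)) z = κ :=
  (exists_cohomology_class (actH1OfSympC U Ω)
    (fun (lam : {lam : Omega Plane U 1 // d Plane U 1 lam = -restrictForm U Ω}) φ =>
      extH1c U (fluxC lam.1 lam.2 φ)) (fun lam => extFlux_mul lam.2)
    (fun lam lam' => exists_coboundary hΩ hU lam.2 lam'.2)).imp
    fun _ hκ lam hlam => hκ ⟨lam, hlam⟩

end Cocycle

end SurfaceFlux

theorem proposition4p1
    -- a closed connected surface of genus at least two
    {S : Type} [TopologicalSpace S] [T2Space S] [CompactSpace S] [ConnectedSpace S]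
    [ChartedSpace SurfaceFlux.Plane S] [IsManifold 𝓘(ℝ, SurfaceFlux.Plane) ∞ S]
    (g : ℕ) (hg : 2 ≤ g)
    (hgenus : Module.finrank ℝ (SurfaceFlux.H1 SurfaceFlux.Plane S) = 2 * g)
    -- an area form, which orients the surface
    (Ω : SurfaceFlux.Omega SurfaceFlux.Plane S 2) (hΩ : ∀ x, Ω.1 x ≠ 0)
    -- the complement of an embedded closed disk
    (U : TopologicalSpace.Opens S)
    (hU : SurfaceFlux.IsClosedDisk SurfaceFlux.Plane ((U : Set S)ᶜ)) :
    -- extension by zero identifies `H¹_c(U)` with `H¹(S)`, compatibly with the group actions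
    (Function.Bijective (SurfaceFlux.extH1c (E := SurfaceFlux.Plane) U) ∧
      ∀ (φ : SurfaceFlux.SympC (SurfaceFlux.restrictForm U Ω))
        (u : SurfaceFlux.H1c SurfaceFlux.Plane U),
        SurfaceFlux.extH1c U (SurfaceFlux.actH1c SurfaceFlux.Plane U φ.1 u) =
          SurfaceFlux.actH1OfSympC U Ω φ (SurfaceFlux.extH1c U u)) ∧
    (∀ (lam : SurfaceFlux.Omega SurfaceFlux.Plane U 1)
      (hlam : SurfaceFlux.d SurfaceFlux.Plane U 1 lam = -SurfaceFlux.restrictForm U Ω),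
      -- the map is a crossed homomorphism
      (∀ φ ψ : SurfaceFlux.SympC (SurfaceFlux.restrictForm U Ω),
        SurfaceFlux.fluxC lam hlam (φ * ψ) = SurfaceFlux.fluxC lam hlam φ +
          SurfaceFlux.actH1c SurfaceFlux.Plane U φ.1 (SurfaceFlux.fluxC lam hlam ψ)) ∧
      -- on the identity component it is the restriction of the flux homomorphism of `S`
      (∀ φ : SurfaceFlux.SympC (SurfaceFlux.restrictForm U Ω),
        φ.1 ∈ SurfaceFlux.Symp0c (SurfaceFlux.restrictForm U Ω) →
        SurfaceFlux.IsFlux Ω (SurfaceFlux.extSymp U Ω φ).1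
          (SurfaceFlux.extH1c U (SurfaceFlux.fluxC lam hlam φ)))) ∧
    -- its class in the group cohomology `H¹(Symp^c(U); H¹(S))` does not depend on `lam`
    ∃ κ : groupCohomology.H1 (Rep.of (SurfaceFlux.actH1OfSympC U Ω)),
      ∀ (lam : SurfaceFlux.Omega SurfaceFlux.Plane U 1)
        (hlam : SurfaceFlux.d SurfaceFlux.Plane U 1 lam = -SurfaceFlux.restrictForm U Ω),
        ∃ z : groupCohomology.cocycles₁ (Rep.of (SurfaceFlux.actH1OfSympC U Ω)),
          (∀ φ, z φ = SurfaceFlux.extH1c U (SurfaceFlux.fluxC lam hlam φ)) ∧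
          groupCohomology.H1π (Rep.of (SurfaceFlux.actH1OfSympC U Ω)) z = κ := by
  have hV : 2 < Module.finrank ℝ (SurfaceFlux.H1 SurfaceFlux.Plane S) := by omega
  have := SurfaceFlux.finite_of_lt_finrank hV
  exact ⟨⟨⟨SurfaceFlux.extH1c_injective hU, SurfaceFlux.extH1c_surjective hU⟩,
    SurfaceFlux.extH1c_actH1c⟩, fun lam hlam => ⟨SurfaceFlux.fluxC_mul hlam,
    SurfaceFlux.isFlux_fluxC hΩ hV hU hlam⟩, SurfaceFlux.exists_extFlux_class hΩ hU⟩
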